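/- Let $q_1>q_2\ge 3$ be integers. For $n\in\mathbb N$ let $H(n,q_1,q_2)$ be the hypergraph with vertex set $[n]=\{1,\dots,n\}$ whose edges are the arithmetic progressions (with positive common difference) of lengths $q_1$ and $q_2$ contained in $[n]$; edges of size $q_1$ are called long and edges of size $q_2$ short. For $p\in[0,1]$ let $[n]_p$ be the random subset of $[n]$ containing each element independently with probability $p$, and let $H(n,q_1,q_2,p)$ be the subhypergraph of $H(n,q_1,q_2)$ induced by $[n]_p$. A cover of an edge $E=\{a_1,\dots,a_q\}$, $q=|E|$, consists of edges $E_1,\dots,E_q$ with $E\cap E_i=\{a_i\}$ and $|E_i|\ne|E|$ for all $i$; it is simple if $E_i\cap\bigcup_{j\ne i}E_j=\emptyset$ for all $i$. A simple path $P$ of length $\ell\ge1$ consists of short edges $E_1,\dots,E_\ell$ and long edges $E_{i,j}$ ($1\le i\le\ell$, $1\le j\le q_2$) such that $E_{i,1},\dots,E_{i,q_2}$ is a cover of $E_i$ for every $i$, $E_{i+1,1}=E_{i,q_2}$ for every $i<\ell$, and apart from these identifications any two edges of the same cardinality are disjoint. Write $E(P)$ for its set of edges and $V(P)$ for their union. A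 hypergraph all of whose edges have size $q_1$ or $q_2$ is called 2-blocking if it consists of the edges of one of the following configurations: 1. a short edge together with a cover of it that is not simple; 2. a simple path $P$ (of some length $\ell\ge1$) together with an edge $E\notin E(P)$ such that $|E\cap V(P)|\ge3$ and $E\cap E_{\ell,q_2}=\{v\}$ for some $v\notin E_\ell$ (a spoiled simple path); 3. a simple path $P$ together with short edges $S_v$, one for every $v\in E_{1,1}\setminus E_1$, such that $S_v\cap E_{1,1}=\{v\}$ and $|S_v\cap V(P)|=2$ (a simple path with a saw); 4. a simple path $P$ of length $\ell\ge1$ together with a short edge $E_{\ell+1}$ and a simple cover $E_{\ell+1,1},\dots,E_{\ell+1,q_2}$ of it, such that $E_{\ell+1}\cap V(P)=\{v\}$ for some $v\in E_{\ell,q_2}\setminus E_\ell$, $E_{\ell+1,1}=E_{\ell,q_2}$, and $E_{\ell+1,i}\cap V(P)\neq\emptyset$ for some $i\in\{2,\dots,q_2\}$ (a simple path with a spoiled extension). Then there is a constant $c_0=c_0(q_1,q_2)>0$ such that for every $0<c\le c_0$, with $p=p(n)=c\,n^{-\frac{q_2}{q_1(q_2-1)}}$, the probability that $H(n,q_1,q_2,p)$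 contains no 2-blocking hypergraph as a subhypergraph tends to $1$ as $n\to\infty$. -/

import Mathlib

open Filter Topology ProbabilityTheory

namespace AsymVdW

variable {α : Type*}

/-- The hypergraph consisting of a given family of edges (its vertex set is their union). -/
def ofEdges (S : Set (Set α)) : Hypergraph α where
  vertexSet := ⋃₀ S
  edgeSet := S
  subset_vertexSet_of_mem_edgeSet' := fun _ he => Set.subset_sUnion_of_mem he

/-- `B` is a subhypergraph of `H`. -/
def IsSubhypergraph (B H : Hypergraph α) : Prop :=
  B.vertexSet ⊆ H.vertexSet ∧ B.edgeSet ⊆ H.edgeSet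

/-- The subhypergraph of `H` induced by a set `S` of vertices. -/
def induce (H : Hypergraph α) (S : Set α) : Hypergraph α where
  vertexSet := H.vertexSet ∩ S
  edgeSet := {e | e ∈ H.edgeSet ∧ e ⊆ S}
  subset_vertexSet_of_mem_edgeSet' := fun _ he =>
    Set.subset_inter (H.subset_vertexSet_of_mem_edgeSet' he.1) he.2

/-- Every edge has cardinality `q₁` (a long edge) or `q₂` (a short edge). -/
def IsUniform (q₁ q₂ : ℕ) (H : Hypergraph α) : Prop :=
  ∀ e ∈ H.edgeSet, e.ncard = q₁ ∨ e.ncard = q₂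

/-- `e` is an arithmetic progression of length `q` with positive common difference. -/
def IsAP (q : ℕ) (e : Set ℕ) : Prop :=
  ∃ a d : ℕ, 0 < d ∧ e = {x | ∃ i < q, x = a + i * d}

/-- The hypergraph `H(n, q₁, q₂)` on `[n] = {1, …, n}` whose edges are the arithmetic progressions
of lengths `q₁` and `q₂` contained in `[n]`. -/
def apHypergraph (n q₁ q₂ : ℕ) : Hypergraph ℕ where
  vertexSet := Set.Icc 1 n
  edgeSet := {e | e ⊆ Set.Icc 1 n ∧ (IsAP q₁ e ∨ IsAP q₂ e)}
  subset_vertexSet_of_mem_edgeSet' := fun _ he => he.1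

/-- The edges `C 1, …, C |E|` cover the edge `E = {a 1, …, a |E|}`. -/
def IsCover (E : Set α) (C : ℕ → Set α) : Prop :=
  ∃ a : ℕ → α, Set.BijOn a (Set.Icc 1 E.ncard) E ∧
    ∀ i ∈ Set.Icc 1 E.ncard, E ∩ C i = {a i} ∧ (C i).ncard ≠ E.ncard

/-- The edges `C 1, …, C |E|` are a simple cover of `E`: no `C i` meets the union of the others. -/
def IsSimpleCover (E : Set α) (C : ℕ → Set α) : Prop :=
  IsCover E C ∧ ∀ i ∈ Set.Icc 1 E.ncard,
    C i ∩ (⋃ j ∈ Set.Icc 1 E.ncard \ {i}, C j) = ∅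

/-- The short edges `E i` (`1 ≤ i ≤ ℓ`) and the long edges `L i j` (`1 ≤ i ≤ ℓ`, `1 ≤ j ≤ q₂`) form
a simple path of length `ℓ ≥ 1`.  The values of `E` and `L` outside these ranges are irrelevant. The
long edges `L i q₂` and `L (i + 1) 1` are one and the same edge. -/
structure IsSimplePath (q₁ q₂ ℓ : ℕ) (E : ℕ → Set α) (L : ℕ → ℕ → Set α) : Prop where
  one_le : 1 ≤ ℓ
  short : ∀ i ∈ Set.Icc 1 ℓ, (E i).ncard = q₂
  long : ∀ i ∈ Set.Icc 1 ℓ, ∀ j ∈ Set.Icc 1 q₂, (L i j).ncard = q₁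
  cover : ∀ i ∈ Set.Icc 1 ℓ, IsCover (E i) (L i)
  shared : ∀ i ∈ Set.Icc 1 ℓ, i < ℓ → L (i + 1) 1 = L i q₂
  short_disjoint : ∀ i ∈ Set.Icc 1 ℓ, ∀ i' ∈ Set.Icc 1 ℓ, i ≠ i' → Disjoint (E i) (E i')
  long_disjoint : ∀ i ∈ Set.Icc 1 ℓ, ∀ j ∈ Set.Icc 1 q₂, ∀ i' ∈ Set.Icc 1 ℓ, ∀ j' ∈ Set.Icc 1 q₂,
    (i, j) ≠ (i', j') → ¬ (i' = i + 1 ∧ j = q₂ ∧ j' = 1) → ¬ (i = i' + 1 ∧ j' = q₂ ∧ j = 1) →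
    Disjoint (L i j) (L i' j')

/-- The edges of a simple path. -/
def pathEdges (q₂ ℓ : ℕ) (E : ℕ → Set α) (L : ℕ → ℕ → Set α) : Set (Set α) :=
  {e | ∃ i ∈ Set.Icc 1 ℓ, e = E i ∨ ∃ j ∈ Set.Icc 1 q₂, e = L i j}

/-- The vertices of a simple path. -/
def pathVerts (q₂ ℓ : ℕ) (E : ℕ → Set α) (L : ℕ → ℕ → Set α) : Set α :=
  ⋃₀ pathEdges q₂ ℓ E L

/-- `B` is a short edge together with a non-simple cover of it. -/
def IsNonSimplyCoveredEdge (q₂ : ℕ) (B : Hypergraph α) : Prop :=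
  ∃ (E : Set α) (C : ℕ → Set α), E.ncard = q₂ ∧ IsCover E C ∧ ¬ IsSimpleCover E C ∧
    B = ofEdges ({E} ∪ C '' Set.Icc 1 q₂)

/-- `B` is a simple path together with a spoiling edge. -/
def IsSpoiledPath (q₁ q₂ : ℕ) (B : Hypergraph α) : Prop :=
  ∃ (ℓ : ℕ) (E : ℕ → Set α) (L : ℕ → ℕ → Set α) (F : Set α), IsSimplePath q₁ q₂ ℓ E L ∧
    F ∉ pathEdges q₂ ℓ E L ∧ 3 ≤ (F ∩ pathVerts q₂ ℓ E L).ncard ∧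
    (∃ v, v ∉ E ℓ ∧ F ∩ L ℓ q₂ = {v}) ∧
    B = ofEdges (pathEdges q₂ ℓ E L ∪ {F})

/-- `B` is a simple path together with saw edges `S v`, one for each `v ∈ L 1 1 \ E 1`. -/
def IsPathWithSaw (q₁ q₂ : ℕ) (B : Hypergraph α) : Prop :=
  ∃ (ℓ : ℕ) (E : ℕ → Set α) (L : ℕ → ℕ → Set α) (S : α → Set α), IsSimplePath q₁ q₂ ℓ E L ∧
    (∀ v ∈ L 1 1 \ E 1, (S v).ncard = q₂ ∧ S v ∩ L 1 1 = {v} ∧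
      (S v ∩ pathVerts q₂ ℓ E L).ncard = 2) ∧
    B = ofEdges (pathEdges q₂ ℓ E L ∪ S '' (L 1 1 \ E 1))

/-- `B` is a simple path together with a spoiled extension: a short edge `F` and a simple cover
`C 1, …, C q₂` of it. -/
def IsPathWithSpoiledExtension (q₁ q₂ : ℕ) (B : Hypergraph α) : Prop :=
  ∃ (ℓ : ℕ) (E : ℕ → Set α) (L : ℕ → ℕ → Set α) (F : Set α) (C : ℕ → Set α),
    IsSimplePath q₁ q₂ ℓ E L ∧
    F.ncard = q₂ ∧ IsSimpleCover F C ∧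
    (∃ v ∈ L ℓ q₂ \ E ℓ, F ∩ pathVerts q₂ ℓ E L = {v}) ∧
    C 1 = L ℓ q₂ ∧
    (∃ i ∈ Set.Icc 2 q₂, (C i ∩ pathVerts q₂ ℓ E L).Nonempty) ∧
    B = ofEdges (pathEdges q₂ ℓ E L ∪ ({F} ∪ C '' Set.Icc 1 q₂))

/-- The (asymmetric) 2-blocking hypergraphs. -/
def IsTwoBlocking (q₁ q₂ : ℕ) (B : Hypergraph α) : Prop :=
  IsUniform q₁ q₂ B ∧
    (IsNonSimplyCoveredEdge q₂ B ∨ IsSpoiledPath q₁ q₂ B ∨ IsPathWithSaw q₁ q₂ B ∨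
      IsPathWithSpoiledExtension q₁ q₂ B)

end AsymVdW

/-! Write q = q₂, Q = q₁ and M = Q(q-1), so that p = c·n^(-q/M). The proof is a first moment
argument. Sets of v vertices that are determined by D numbers of size at most n occur about n^D·p^v
times in expectation, and this is at most c^v·n^(-1/M) as soon as D·M + 1 ≤ q·v. There are at most
a·K^L patterns for a path of length L, while v is at least M(L-1); hence for small c the sum over
all lengths is dominated by a geometric series and still carries the factor n^(-1/M)
(`rare_of_code`). What remains is to compare numbers of parameters with numbers of vertices.

A path of length L is a tree of qL+1 progressions, given by one base point and one difference per
edge: qL+2 parameters against Q((q-1)L+1) vertices. The resulting exponent of n is (q-2)/(q-1), so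
paths themselves do occur; but the loss of a single parameter changes it to -1/(q-1). Vertices are
linear forms in the parameters, so a relation among boundedly many vertices that is not an identity
of forms costs a parameter (`rare_relation`). The forms are triangular in the differences, so
nontriviality can be read off at the last edge involved.

In a spoiled path, three points of one progression are related, and only one of them involves the
difference of the last long edge. In a saw, each tooth is determined by two vertices of the path, so
teeth bring new vertices without new parameters; two teeth sharing a new vertex yield a relation,
which can be an identity only if both teeth end on the first short edge, in distinct points. Hence a
new vertex lies on at most q-1 teeth, and double counting gives enough of them. In a spoiled
extension, every new long edge that meets the path loses its difference as a parameter; one that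
meets it twice also fixes the new short edge, and two such edges give a relation within the old
path.

A non-simple cover involves no path. Cover edges whose differences are forced by the covered edge
have a large union, because progressions with distinct differences intersect in few points
(`le_mul_ncard_iUnion`); every other edge meets each of the rest in at most one point
(`le_mul_ncard_cover`). -/

namespace AsymVdW

/-! ### The first moment method for coded families of vertex sets. -/

open MeasureTheory in
lemma setBernoulli_superset_le (u : Set ℕ) (p : unitInterval) (V : Finset ℕ) :
    setBernoulli u p {S : Set ℕ | (V : Set ℕ) ⊆ S} ≤ ENNReal.ofReal ((p : ℝ) ^ V.card) := by
  rw [setBernoulli_apply']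
  have h : ((fun t : ℕ → Prop => {i | t i}) ⁻¹' {S : Set ℕ | (V : Set ℕ) ⊆ S})
      = Set.pi (V : Set ℕ) (fun _ => {True}) := by
    ext t
    simp [Set.subset_def, Set.pi]
  rw [h, Measure.infinitePi_pi _ (by intros; exact MeasurableSet.of_discrete)]
  -- Only an inequality holds in general: a point outside `u` is never selected.
  have h2 : ∀ i ∈ V, (unitInterval.toNNReal p • Measure.dirac (i ∈ u) +
      unitInterval.toNNReal (unitInterval.symm p) • Measure.dirac False : Measure Prop) {True}
      ≤ ENNReal.ofReal (p : ℝ) := by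
    intro i _
    have e : ((unitInterval.toNNReal p : NNReal) : ENNReal) = ENNReal.ofReal (p : ℝ) := by
      rw [ENNReal.ofReal, ← unitInterval.coe_toNNReal, Real.toNNReal_coe]
    have hm : MeasurableSet ({True} : Set Prop) := MeasurableSet.of_discrete
    rw [Measure.add_apply, Measure.smul_apply, Measure.smul_apply, Measure.dirac_apply' _ hm,
      Measure.dirac_apply' _ hm, ← e]
    by_cases hi : i ∈ u <;> simp [hi, ENNReal.smul_def]
  calc _ ≤ ∏ _i ∈ V, ENNReal.ofReal (p : ℝ) := Finset.prod_le_prod' h2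
    _ = _ := by rw [Finset.prod_const, ENNReal.ofReal_pow p.2.1]

/-- A family of finite sets, each coded injectively by at most `D.card` numbers `≤ n`. -/
lemma finite_and_ncard_le_of_code {𝒱 : Set (Finset ℕ)} {R : Finset ℕ → (ℕ → ℕ) → Prop}
    {D : Finset ℕ} {n : ℕ} (h : ∀ V ∈ 𝒱, ∃ z, R V z ∧ ∀ i ∈ D, z i ≤ n)
    (hu : ∀ V V' z z', R V z → R V' z' → (∀ i ∈ D, z i = z' i) → V = V') :
    𝒱.Finite ∧ 𝒱.ncard ≤ (n + 1) ^ D.card := by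
  choose! z hz hzn using h
  let f : Finset ℕ → (D → Fin (n + 1)) := fun V i => Fin.ofNat (n + 1) (z V i)
  have hf : Set.InjOn f 𝒱 := by
    intro V hV V' hV' he
    refine hu V V' _ _ (hz V hV) (hz V' hV') fun i hi => ?_
    have := congrArg Fin.val (congrFun he ⟨i, hi⟩)
    simpa [f, Fin.ofNat, Nat.mod_eq_of_lt (Nat.lt_succ_of_le (hzn V hV i hi)),
      Nat.mod_eq_of_lt (Nat.lt_succ_of_le (hzn V' hV' i hi))] using this
  have hmaps : Set.MapsTo f 𝒱 Set.univ := fun _ _ => Set.mem_univ _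
  refine ⟨Set.Finite.of_injOn hmaps hf Set.finite_univ, ?_⟩
  have := Set.ncard_le_ncard_of_injOn f (s := 𝒱) (t := Set.univ) (fun _ _ => Set.mem_univ _) hf
  simpa [Set.ncard_univ] using this

open MeasureTheory in
lemma measure_exists_subset_le {𝒱 : Set (Finset ℕ)} (hfin : 𝒱.Finite) (u : Set ℕ)
    (p : unitInterval) (B : ℝ) (hB : ∀ V ∈ 𝒱, (p : ℝ) ^ V.card ≤ B) {m : ℕ}
    (hm : 𝒱.ncard ≤ m) (hB0 : 0 ≤ B) :
    setBernoulli u p {S : Set ℕ | ∃ V ∈ 𝒱, (V : Set ℕ) ⊆ S} ≤ ENNReal.ofReal (m * B) := by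
  have h : {S : Set ℕ | ∃ V ∈ 𝒱, (V : Set ℕ) ⊆ S} =
      ⋃ V ∈ hfin.toFinset, {S : Set ℕ | (V : Set ℕ) ⊆ S} := by
    ext S; simp
  rw [h]
  calc _ ≤ ∑ V ∈ hfin.toFinset, setBernoulli u p {S : Set ℕ | (V : Set ℕ) ⊆ S} :=
        measure_biUnion_finset_le _ _
    _ ≤ ∑ _V ∈ hfin.toFinset, ENNReal.ofReal B := by
        refine Finset.sum_le_sum fun V hV => (setBernoulli_superset_le u p V).trans ?_
        exact ENNReal.ofReal_le_ofReal (hB V (by simpa using hV))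
    _ = ENNReal.ofReal (𝒱.ncard * B) := by
        rw [Finset.sum_const, nsmul_eq_mul, Set.ncard_eq_toFinset_card _ hfin,
          ENNReal.ofReal_mul (by positivity), ENNReal.ofReal_natCast]
    _ ≤ _ := ENNReal.ofReal_le_ofReal (by gcongr)

/-- Exponent bookkeeping: the `+ 1` in `hdv` is what leaves the spare factor n^(-1/M) after n^d is
absorbed, and `hv` turns c^v into a power growing linearly in the length. -/
lemma count_mul_prob_le {q Q L n d v : ℕ} (hM : 0 < Q * (q - 1)) (hn : 1 ≤ n)
    {c p : ℝ} (hc : 0 < c) (hc1 : c ≤ 1)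
    (hp : p = c * (n : ℝ) ^ (-((q : ℝ) / (Q * (q - 1) : ℕ))))
    (hdv : d * (Q * (q - 1)) + 1 ≤ q * v)
    (hv : Q * (q - 1) * L ≤ v + Q * (q - 1)) :
    p ^ v ≤ c ^ (Q * (q - 1) * (L - 1)) * (n : ℝ) ^ (-(d : ℝ) - 1 / (Q * (q - 1) : ℕ)) := by
  have hn' : (1 : ℝ) ≤ n := by exact_mod_cast hn
  rw [hp, mul_pow, ← Real.rpow_mul_natCast (by positivity)]
  set M := Q * (q - 1)
  have hM' : (0 : ℝ) < (M : ℕ) := by exact_mod_cast hM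
  have h1 : c ^ v ≤ c ^ (M * (L - 1)) := by
    apply pow_le_pow_of_le_one hc.le hc1
    rw [Nat.mul_sub, mul_one]; omega
  have h2 : (n : ℝ) ^ (-((q : ℝ) / (M : ℕ)) * v) ≤ (n : ℝ) ^ (-(d : ℝ) - 1 / (M : ℕ)) := by
    apply Real.rpow_le_rpow_of_exponent_le hn'
    have : (d : ℝ) * M + 1 ≤ q * v := by exact_mod_cast hdv
    have e : -(d : ℝ) - 1 / (M : ℕ) - (-((q : ℝ) / (M : ℕ)) * v) =
      (q * v - (d * M + 1)) / M := by field_simp; ring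
    have : 0 ≤ (q * v - (d * M + 1)) / (M : ℝ) := div_nonneg (by linarith) hM'.le
    linarith
  gcongr

/-- The events `A n` have vanishing probability when `p` is a small multiple of the threshold. -/
def Rare (q Q : ℕ) (A : ℕ → Set (Set ℕ)) : Prop :=
  ∃ c₀ : ℝ, 0 < c₀ ∧ ∀ c : ℝ, 0 < c → c ≤ c₀ → ∀ p : ℕ → unitInterval,
    (∀ᶠ n : ℕ in atTop,
      (p n : ℝ) = c * (n : ℝ) ^ (-((q : ℝ) / ((Q : ℝ) * ((q : ℝ) - 1))))) →
    Tendsto (fun n : ℕ => setBernoulli (Set.Icc 1 n) (p n) (A n)) atTop (𝓝 0)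

lemma Rare.mono {q Q : ℕ} {A B : ℕ → Set (Set ℕ)} (hB : Rare q Q B) (h : ∀ n, A n ⊆ B n) :
    Rare q Q A := by
  obtain ⟨c₀, h0, hc⟩ := hB
  exact ⟨c₀, h0, fun c hc0 hcc p hp => tendsto_of_tendsto_of_tendsto_of_le_of_le tendsto_const_nhds
    (hc c hc0 hcc p hp) (fun _ => zero_le) fun n => MeasureTheory.measure_mono (h n)⟩

lemma Rare.union {q Q : ℕ} {A B : ℕ → Set (Set ℕ)} (hA : Rare q Q A) (hB : Rare q Q B) :
    Rare q Q fun n => A n ∪ B n := by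
  obtain ⟨a, ha, hA⟩ := hA
  obtain ⟨b, hb, hB⟩ := hB
  refine ⟨min a b, lt_min ha hb, fun c hc0 hcc p hp => ?_⟩
  have := (hA c hc0 (hcc.trans (min_le_left _ _)) p hp).add
    (hB c hc0 (hcc.trans (min_le_right _ _)) p hp)
  rw [add_zero] at this
  exact tendsto_of_tendsto_of_tendsto_of_le_of_le tendsto_const_nhds this (fun _ => zero_le)
    fun n => MeasureTheory.measure_union_le _ _

open MeasureTheory in
/-- First moment method for vertex sets which, for each pattern `θ`, are coded by the values of few
parameters. -/
theorem rare_of_code (q Q : ℕ) (hq : 3 ≤ q) (hqQ : q < Q) {Θ : ℕ → Type}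
    [∀ L, Fintype (Θ L)] (a K : ℕ) (hcard : ∀ L, Fintype.card (Θ L) ≤ a * K ^ L)
    (D : ∀ L, Θ L → Finset ℕ) (hD : ∀ L θ, (D L θ).card ≤ q * L + 2)
    (R : ∀ _n L, Θ L → Finset ℕ → (ℕ → ℕ) → Prop)
    (hle : ∀ n L θ V z, R n L θ V z → ∀ i ∈ D L θ, z i ≤ n)
    (hdim : ∀ n L θ V z, R n L θ V z → (D L θ).card * (Q * (q - 1)) + 1 ≤ q * V.card)
    (hlen : ∀ n L θ V z, R n L θ V z → Q * (q - 1) * L ≤ V.card + Q * (q - 1))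
    (huniq : ∀ n L θ V V' z z', R n L θ V z → R n L θ V' z' → (∀ i ∈ D L θ, z i = z' i) → V = V') :
    Rare q Q fun n => {S : Set ℕ | ∃ L θ V z, R n L θ V z ∧ (V : Set ℕ) ⊆ S} := by
  set M := Q * (q - 1) with hMdef
  have hM : 0 < M := Nat.mul_pos (by omega) (by omega)
  have hMcast : ((M : ℕ) : ℝ) = (Q : ℝ) * ((q : ℝ) - 1) := by
    rw [hMdef]; push_cast [Nat.cast_sub (show 1 ≤ q by omega)]; ring
  -- Chosen so that K·2^q ≤ A/2, where 2^q is the price per unit of length for replacing n + 1 by n.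
  -- Together with c^M ≤ 1/A this makes the contribution of length L at most a constant times
  -- A·2^(-L).
  set A : ℝ := 2 * (K + 1) * 2 ^ q with hA
  have hA1 : 1 ≤ A := by
    have : (1 : ℝ) ≤ 2 ^ q := one_le_pow₀ (by norm_num)
    have : (0 : ℝ) ≤ K := by positivity
    nlinarith
  refine ⟨1 / A, by positivity, fun c hc hcA p hp => ?_⟩
  have hc1 : c ≤ 1 := hcA.trans (by rw [div_le_one (by positivity)]; exact hA1)
  have hcM : c ^ M ≤ 1 / A := (pow_le_of_le_one hc.le hc1 hM.ne').trans hcA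
  have key : ∀ᶠ n : ℕ in atTop, setBernoulli (Set.Icc 1 n) (p n)
        {S : Set ℕ | ∃ L θ V z, R n L θ V z ∧ (V : Set ℕ) ⊆ S} ≤
      ENNReal.ofReal ((a * 4 * A * 2) * (n : ℝ) ^ (-(1 / (M : ℝ)))) := by
    filter_upwards [hp, eventually_ge_atTop 1] with n hpn hn
    rw [← hMcast] at hpn
    have hn' : (1 : ℝ) ≤ n := by exact_mod_cast hn
    have hn0 : (0 : ℝ) < n := by linarith
    set η : ℝ := (n : ℝ) ^ (-(1 / (M : ℝ))) with hη
    have hη0 : 0 ≤ η := by positivity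
    have hθ : ∀ L (θ : Θ L), setBernoulli (Set.Icc 1 n) (p n)
        {S : Set ℕ | ∃ V z, R n L θ V z ∧ (V : Set ℕ) ⊆ S} ≤
        ENNReal.ofReal (2 ^ (q * L + 2) * c ^ (M * (L - 1)) * η) := by
      intro L θ
      obtain ⟨hf, hcd⟩ := finite_and_ncard_le_of_code (𝒱 := {V | ∃ z, R n L θ V z})
        (R := R n L θ) (D := D L θ) (n := n)
        (fun V ⟨z, hz⟩ => ⟨z, hz, hle n L θ V z hz⟩) (huniq n L θ)
      have hset : {S : Set ℕ | ∃ V z, R n L θ V z ∧ (V : Set ℕ) ⊆ S} =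
          {S : Set ℕ | ∃ V ∈ {V | ∃ z, R n L θ V z}, (V : Set ℕ) ⊆ S} := by
        ext S
        simp only [Set.mem_ofPred_eq]
        exact ⟨fun ⟨V, z, h1, h2⟩ => ⟨V, ⟨z, h1⟩, h2⟩, fun ⟨V, ⟨z, h1⟩, h2⟩ => ⟨V, z, h1, h2⟩⟩
      rw [hset]
      refine (measure_exists_subset_le hf _ _
        (c ^ (M * (L - 1)) * (n : ℝ) ^ (-((D L θ).card : ℝ) - 1 / (M : ℕ))) ?_ hcd
        (by positivity)).trans (ENNReal.ofReal_le_ofReal ?_)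
      · rintro V ⟨z, hz⟩
        exact count_mul_prob_le hM hn hc hc1 hpn (hdim _ _ _ _ _ hz) (hlen _ _ _ _ _ hz)
      · have e1 : (n : ℝ) ^ (-((D L θ).card : ℝ) - 1 / (M : ℕ)) =
            ((n : ℝ) ^ (D L θ).card)⁻¹ * η := by
          rw [sub_eq_add_neg, Real.rpow_add hn0, Real.rpow_neg hn0.le, Real.rpow_natCast]
        have e2 : (((n + 1) ^ (D L θ).card : ℕ) : ℝ) ≤ 2 ^ (q * L + 2) * (n : ℝ) ^ (D L θ).card := by
          push_cast
          calc ((n : ℝ) + 1) ^ (D L θ).card ≤ (2 * n) ^ (D L θ).card := by gcongr; linarith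
            _ = 2 ^ (D L θ).card * (n : ℝ) ^ (D L θ).card := mul_pow _ _ _
            _ ≤ _ := by gcongr; · norm_num
                        · exact hD L θ
        rw [e1]
        calc _ ≤ 2 ^ (q * L + 2) * (n : ℝ) ^ (D L θ).card *
              (c ^ (M * (L - 1)) * (((n : ℝ) ^ (D L θ).card)⁻¹ * η)) := by gcongr
          _ = _ := by
            field_simp
    have hL : ∀ L, setBernoulli (Set.Icc 1 n) (p n)
        {S : Set ℕ | ∃ θ V z, R n L θ V z ∧ (V : Set ℕ) ⊆ S} ≤
        ENNReal.ofReal ((a * 4 * A * η) * (1 / 2) ^ L) := by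
      intro L
      have hset : {S : Set ℕ | ∃ θ V z, R n L θ V z ∧ (V : Set ℕ) ⊆ S} =
          ⋃ θ ∈ (Finset.univ : Finset (Θ L)), {S : Set ℕ | ∃ V z, R n L θ V z ∧ (V : Set ℕ) ⊆ S} := by
        ext S; simp
      rw [hset]
      refine (measure_biUnion_finset_le _ _).trans ((Finset.sum_le_sum fun θ _ => hθ L θ).trans ?_)
      rw [Finset.sum_const, nsmul_eq_mul, ← ENNReal.ofReal_natCast,
        ← ENNReal.ofReal_mul (by positivity)]
      apply ENNReal.ofReal_le_ofReal
      have h1 : ((Finset.univ : Finset (Θ L)).card : ℝ) ≤ a * K ^ L := by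
        exact_mod_cast hcard L
      have h2 : ((K : ℝ) * 2 ^ q) ^ L * c ^ (M * (L - 1)) ≤ A * (1 / 2) ^ L := by
        have hb : (K : ℝ) * 2 ^ q ≤ A / 2 := by
          rw [hA]; have : (0 : ℝ) ≤ 2 ^ q := by positivity
          nlinarith
        rcases L with _ | L
        · simpa using hA1
        · rw [Nat.add_sub_cancel, pow_mul]
          calc ((K : ℝ) * 2 ^ q) ^ (L + 1) * (c ^ M) ^ L ≤ (A / 2) ^ (L + 1) * (1 / A) ^ L := by gcongr
            _ = A * (1 / 2) ^ (L + 1) := by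
              have : A ≠ 0 := by positivity
              rw [pow_succ, pow_succ, mul_right_comm, ← mul_pow,
                show A / 2 * (1 / A) = 1 / 2 by field_simp]
              ring
      calc ((Finset.univ : Finset (Θ L)).card : ℝ) * (2 ^ (q * L + 2) * c ^ (M * (L - 1)) * η)
          ≤ (a * K ^ L) * (2 ^ (q * L + 2) * c ^ (M * (L - 1)) * η) := by gcongr
        _ = a * 4 * η * (((K : ℝ) * 2 ^ q) ^ L * c ^ (M * (L - 1))) := by
          rw [pow_add, pow_mul, mul_pow]; ring
        _ ≤ a * 4 * η * (A * (1 / 2) ^ L) := by gcongr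
        _ = _ := by ring
    have hset : {S : Set ℕ | ∃ L θ V z, R n L θ V z ∧ (V : Set ℕ) ⊆ S} =
        ⋃ L, {S : Set ℕ | ∃ θ V z, R n L θ V z ∧ (V : Set ℕ) ⊆ S} := by
      ext S; simp
    rw [hset]
    refine (measure_iUnion_le _).trans ((ENNReal.tsum_le_tsum hL).trans ?_)
    rw [← ENNReal.ofReal_tsum_of_nonneg (fun _ => by positivity)
      ((summable_geometric_of_lt_one (by norm_num) (by norm_num)).mul_left _), tsum_mul_left,
      tsum_geometric_of_lt_one (by norm_num) (by norm_num)]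
    apply ENNReal.ofReal_le_ofReal
    rw [show (1 - 1 / 2 : ℝ)⁻¹ = 2 by norm_num]
    apply le_of_eq; ring
  refine tendsto_of_tendsto_of_tendsto_of_le_of_le' tendsto_const_nhds ?_
    (Eventually.of_forall fun _ => zero_le) key
  rw [← ENNReal.ofReal_zero]
  apply ENNReal.tendsto_ofReal
  rw [show (0 : ℝ) = (a * 4 * A * 2) * 0 by ring]
  apply Tendsto.const_mul
  exact (tendsto_rpow_neg_atTop (by positivity)).comp tendsto_natCast_atTop_atTop


/-! ### Trees of progressions and their vertices as linear forms. -/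

/-- The edges of a path of length `L` are indexed by `k ≤ q * L`: the indices `k ≡ 1 [MOD q]` stand
for the short edges, the index `0` for the first long edge; every other edge `k` meets an
earlier edge, its parent. -/
def parent (q k : ℕ) : ℕ := if k % q = 1 then k - 1 else q * ((k - 1) / q) + 1

/-- The size of the edge with index `k`. -/
def edgeLen (q Q k : ℕ) : ℕ := if k % q = 1 then q else Q

lemma parent_lt {q k : ℕ} (hq : 3 ≤ q) (hk : 1 ≤ k) : parent q k < k := by
  unfold parent
  split_ifs with h
  · omega
  · have h1 : q * ((k - 1) / q) ≤ k - 1 := Nat.mul_div_le _ _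
    rcases Nat.lt_or_ge (q * ((k - 1) / q) + 1) k with h2 | h2
    · exact h2
    · exfalso; apply h
      have : k = q * ((k - 1) / q) + 1 := by omega
      rw [this, Nat.mul_add_mod, Nat.mod_eq_of_lt (by omega)]

lemma parent_one {q : ℕ} (hq : 3 ≤ q) : parent q 1 = 0 := by
  have := parent_lt hq (le_refl 1); omega

lemma one_le_parent {q k : ℕ} (hk : 2 ≤ k) : 1 ≤ parent q k := by
  unfold parent; split_ifs <;> omega

lemma edgeLen_short {q Q k : ℕ} (h : k % q = 1) : edgeLen q Q k = q := by simp [edgeLen, h]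

lemma edgeLen_long {q Q k : ℕ} (h : k % q ≠ 1) : edgeLen q Q k = Q := by simp [edgeLen, h]

lemma edgeLen_le {q Q k : ℕ} (hqQ : q < Q) : edgeLen q Q k ≤ Q := by
  unfold edgeLen; split_ifs <;> omega

lemma le_edgeLen {q Q k : ℕ} (hqQ : q < Q) : q ≤ edgeLen q Q k := by
  unfold edgeLen; split_ifs <;> omega

/-- The point in which the edge `k` is attached to its parent, as a linear form in the parameters:
parameter `0` is the common point of the edges `0` and `1`, parameter `k + 1` is the common
difference of the edge `k`. The edge `k` is attached with its point at position `τ k` to the point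
at position `π k` of its parent. -/
noncomputable def base (q : ℕ) (π τ : ℕ → ℕ) (k : ℕ) : (ℕ → ℚ) →ₗ[ℚ] ℚ :=
  if _h : 1 ≤ k ∧ parent q k < k then
    base q π τ (parent q k) + ((π k : ℚ) - τ (parent q k)) • LinearMap.proj (parent q k + 1)
  else LinearMap.proj 0
termination_by k

/-- The point at position `s` of the edge `k`. -/
noncomputable def vert (q : ℕ) (π τ : ℕ → ℕ) (k s : ℕ) : (ℕ → ℚ) →ₗ[ℚ] ℚ :=
  base q π τ k + ((s : ℚ) - τ k) • LinearMap.proj (k + 1)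

lemma vert_apply (q : ℕ) (π τ : ℕ → ℕ) (k s : ℕ) (z : ℕ → ℚ) :
    vert q π τ k s z = base q π τ k z + ((s : ℚ) - τ k) * z (k + 1) := by
  simp [vert]

lemma base_zero (q : ℕ) (π τ : ℕ → ℕ) (z : ℕ → ℚ) : base q π τ 0 z = z 0 := by
  rw [base]; simp

lemma base_eq_vert {q : ℕ} (hq : 3 ≤ q) (π τ : ℕ → ℕ) {k : ℕ} (hk : 1 ≤ k) (z : ℕ → ℚ) :
    base q π τ k z = vert q π τ (parent q k) (π k) z := by
  rw [base, dif_pos ⟨hk, parent_lt hq hk⟩, vert]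

/-- Triangularity: parents have smaller indices, so the attachment point of edge `k` only sees
differences of earlier edges, which are the parameters up to `k`. -/
lemma base_congr {q : ℕ} (hq : 3 ≤ q) (π τ : ℕ → ℕ) {z z' : ℕ → ℚ} :
    ∀ k, (∀ i ≤ k, z i = z' i) → base q π τ k z = base q π τ k z' := by
  intro k
  induction k using Nat.strong_induction_on with
  | _ k ih =>
    intro h
    rcases Nat.eq_zero_or_pos k with rfl | hk
    · simp [base_zero, h 0]
    · have hp := parent_lt hq hk
      rw [base_eq_vert hq _ _ hk, base_eq_vert hq _ _ hk, vert_apply, vert_apply,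
        ih _ hp (fun i hi => h i (by omega)), h _ (by omega)]

lemma vert_congr {q : ℕ} (hq : 3 ≤ q) (π τ : ℕ → ℕ) {z z' : ℕ → ℚ} (k s : ℕ)
    (h : ∀ i ≤ k + 1, z i = z' i) : vert q π τ k s z = vert q π τ k s z' := by
  rw [vert_apply, vert_apply, base_congr hq π τ k (fun i hi => h i (by omega)), h _ le_rfl]

/-- The edges 0 and 1 are attached to each other in the point given by parameter 0. The condition π
1 = τ 0 expresses this and removes the difference of edge 0 from all later edges. -/
lemma base_one {q : ℕ} (hq : 3 ≤ q) {π τ : ℕ → ℕ} (hπ : π 1 = τ 0) (z : ℕ → ℚ) :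
    base q π τ 1 z = z 0 := by
  rw [base_eq_vert hq _ _ le_rfl, parent_one hq, vert_apply, base_zero, hπ]; simp

/-- No edge except the edge `0` depends on the difference of the edge `0`. -/
lemma base_congr_of_ne_one {q : ℕ} (hq : 3 ≤ q) {π τ : ℕ → ℕ} (hπ : π 1 = τ 0) {z z' : ℕ → ℚ}
    (h : ∀ i, i ≠ 1 → z i = z' i) : ∀ k, base q π τ k z = base q π τ k z' := by
  intro k
  induction k using Nat.strong_induction_on with
  | _ k ih =>
    rcases Nat.lt_or_ge k 2 with hk | hk
    · interval_cases k
      · simp [base_zero, h 0]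
      · rw [base_one hq hπ, base_one hq hπ, h 0 (by omega)]
    · have hp := parent_lt hq (by omega : 1 ≤ k)
      have hp1 := one_le_parent (q := q) hk
      rw [base_eq_vert hq _ _ (by omega), base_eq_vert hq _ _ (by omega), vert_apply, vert_apply,
        ih _ hp, h _ (by omega)]

lemma vert_congr_of_ne_one {q : ℕ} (hq : 3 ≤ q) {π τ : ℕ → ℕ} (hπ : π 1 = τ 0) {z z' : ℕ → ℚ}
    (h : ∀ i, i ≠ 1 → z i = z' i) {k : ℕ} (hk : 1 ≤ k) (s : ℕ) :
    vert q π τ k s z = vert q π τ k s z' := by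
  rw [vert_apply, vert_apply, base_congr_of_ne_one hq hπ h, h _ (by omega)]

/-- The edges `ed k` (`k ≤ m`) form a tree of arithmetic progressions of shape `π, τ` with parameters
`z`; the edge `k` is attached in the point `y k`. -/
structure IsAPTree (q Q m : ℕ) (π τ z : ℕ → ℕ) (ed : ℕ → Set ℕ) (y : ℕ → ℕ) : Prop where
  base_eq : ∀ k ≤ m, base q π τ k (fun i => (z i : ℚ)) = y k
  mem_iff : ∀ k ≤ m, ∀ x, x ∈ ed k ↔
    ∃ s < edgeLen q Q k, (x : ℚ) = vert q π τ k s (fun i => (z i : ℚ))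
  exists_nat : ∀ k ≤ m, ∀ s < edgeLen q Q k, ∃ x : ℕ,
    (x : ℚ) = vert q π τ k s (fun i => (z i : ℚ))
  diff_pos : ∀ k ≤ m, 0 < z (k + 1)
  tau_lt : ∀ k ≤ m, τ k < edgeLen q Q k
  pi_lt : ∀ k ≤ m, 1 ≤ k → π k < edgeLen q Q (parent q k)
  pi_one : π 1 = τ 0

/-- The shapes of trees with edges `0, …, m`. -/
def shapes (Q m : ℕ) : Set (ℕ → ℕ) := {f | (∀ k, f k < Q) ∧ ∀ k, m < k → f k = 0}

/-- The shape records the position of each attachment point in its own edge (`τ`) and in the parent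
edge (`π`). Both functions are set to 0 beyond `m` so that only finitely many shapes exist. -/
lemma exists_isAPTree {q Q m : ℕ} (hq : 3 ≤ q) (hqQ : q < Q) (hm : 1 ≤ m) {ed : ℕ → Set ℕ}
    {y : ℕ → ℕ} (hed : ∀ k ≤ m, IsAP (edgeLen q Q k) (ed k)) (hy : ∀ k ≤ m, y k ∈ ed k)
    (hy' : ∀ k ≤ m, 1 ≤ k → y k ∈ ed (parent q k)) (h01 : y 0 = y 1) :
    ∃ π ∈ shapes Q m, ∃ τ ∈ shapes Q m, ∃ z, IsAPTree q Q m π τ z ed y := by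
  choose! a d hd he using hed
  have hpos : ∀ k ≤ m, ∀ x ∈ ed k, ∃ s < edgeLen q Q k, x = a k + s * d k := by
    intro k hk x hx
    rw [he k hk] at hx; exact hx
  choose! pos hpos1 hpos2 using hpos
  have hQ : 0 < Q := by omega
  let τ : ℕ → ℕ := fun k => if k ≤ m then pos k (y k) else 0
  let π : ℕ → ℕ := fun k => if k ≤ m ∧ 1 ≤ k then pos (parent q k) (y k) else 0
  let z : ℕ → ℕ := fun i => if i = 0 then y 0 else d (i - 1)
  have hτ : ∀ k ≤ m, τ k = pos k (y k) := fun k hk => by simp [τ, hk]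
  have hπ : ∀ k ≤ m, 1 ≤ k → π k = pos (parent q k) (y k) := fun k hk h1 => by simp [π, hk, h1]
  have hz : ∀ k, z (k + 1) = d k := fun k => by simp [z]
  have hpar : ∀ k ≤ m, 1 ≤ k → parent q k ≤ m := fun k hk h1 => by
    have := parent_lt hq h1; omega
  have hbase : ∀ k ≤ m, base q π τ k (fun i => (z i : ℚ)) = y k := by
    intro k
    induction k using Nat.strong_induction_on with
    | _ k ih =>
      intro hk
      rcases Nat.eq_zero_or_pos k with rfl | h1
      · simp [base_zero, z]
      · have hp := hpar k hk h1
        rw [base_eq_vert hq _ _ h1, vert_apply, ih _ (parent_lt hq h1) hp, hz, hπ k hk h1,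
          hτ _ hp]
        have e1 := hpos2 _ hp _ (hy' k hk h1)
        have e2 := hpos2 _ hp _ (hy _ hp)
        have e1' : (y k : ℚ) = a (parent q k) + pos (parent q k) (y k) * d (parent q k) := by
          exact_mod_cast e1
        have e2' : (y (parent q k) : ℚ) =
          a (parent q k) + pos (parent q k) (y (parent q k)) * d (parent q k) := by
          exact_mod_cast e2
        rw [e1', e2']; ring
  have hvert : ∀ k ≤ m, ∀ s : ℕ,
      vert q π τ k s (fun i => (z i : ℚ)) = ((a k + s * d k : ℕ) : ℚ) := by
    intro k hk s
    have e2 : (y k : ℚ) = a k + pos k (y k) * d k := by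
      exact_mod_cast hpos2 _ hk _ (hy k hk)
    rw [vert_apply, hbase k hk, hz, hτ k hk, e2]; push_cast; ring
  refine ⟨π, ⟨fun k => ?_, fun k hk => ?_⟩, τ, ⟨fun k => ?_, fun k hk => ?_⟩, z, hbase, ?_, ?_, ?_,
    ?_, ?_, ?_⟩
  · by_cases h : k ≤ m ∧ 1 ≤ k
    · rw [hπ k h.1 h.2]
      exact (hpos1 _ (hpar k h.1 h.2) _ (hy' k h.1 h.2)).trans_le (edgeLen_le hqQ)
    · simp only [π, h, if_false]; exact hQ
  · have : ¬ (k ≤ m ∧ 1 ≤ k) := by omega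
    simp only [π, this, if_false]
  · by_cases h : k ≤ m
    · rw [hτ k h]; exact (hpos1 _ h _ (hy k h)).trans_le (edgeLen_le hqQ)
    · simp only [τ, h, if_false]; exact hQ
  · have : ¬ k ≤ m := by omega
    simp only [τ, this, if_false]
  · intro k hk x
    constructor
    · intro hx
      refine ⟨pos k x, hpos1 k hk x hx, ?_⟩
      rw [hvert k hk]; exact_mod_cast hpos2 k hk x hx
    · rintro ⟨s, hs, hxs⟩
      rw [hvert k hk] at hxs
      rw [he k hk]
      exact ⟨s, hs, by exact_mod_cast hxs⟩
  · intro k hk s _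
    exact ⟨_, (hvert k hk s).symm⟩
  · intro k hk; rw [hz]; exact hd k hk
  · intro k hk; rw [hτ k hk]; exact hpos1 _ hk _ (hy k hk)
  · intro k hk h1; rw [hπ k hk h1]; exact hpos1 _ (hpar k hk h1) _ (hy' k hk h1)
  · rw [hπ 1 hm le_rfl, hτ 0 (by omega), parent_one hq, h01]

lemma finite_shapes (Q m : ℕ) : (shapes Q m).Finite ∧ (shapes Q m).ncard ≤ Q ^ (m + 1) := by
  rcases Nat.eq_zero_or_pos Q with rfl | hQ
  · have : shapes 0 m = ∅ := by
      ext f; simp [shapes]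
    simp [this]
  obtain ⟨Q, rfl⟩ : ∃ Q', Q = Q' + 1 := ⟨Q - 1, by omega⟩
  let f : (ℕ → ℕ) → (Fin (m + 1) → Fin (Q + 1)) := fun g i => Fin.ofNat (Q + 1) (g i)
  have hf : Set.InjOn f (shapes (Q + 1) m) := by
    intro g hg g' hg' he
    funext k
    rcases Nat.lt_or_ge m k with h | h
    · rw [hg.2 k h, hg'.2 k h]
    · have := congrArg Fin.val (congrFun he ⟨k, by omega⟩)
      simpa [f, Fin.ofNat, Nat.mod_eq_of_lt (hg.1 k), Nat.mod_eq_of_lt (hg'.1 k)] using this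
  refine ⟨Set.Finite.of_injOn (fun _ _ => Set.mem_univ _) hf Set.finite_univ, ?_⟩
  have := Set.ncard_le_ncard_of_injOn f (s := shapes (Q + 1) m) (t := Set.univ)
    (fun _ _ => Set.mem_univ _) hf
  simpa [Set.ncard_univ] using this

namespace IsAPTree

variable {q Q m : ℕ} {π τ z z' : ℕ → ℕ} {ed ed' : ℕ → Set ℕ} {y y' : ℕ → ℕ}

lemma vert_eq (h : IsAPTree q Q m π τ z ed y) {k : ℕ} (hk : k ≤ m) (s : ℕ) :
    vert q π τ k s (fun i => (z i : ℚ)) = y k + ((s : ℚ) - τ k) * z (k + 1) := by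
  rw [vert_apply, h.base_eq k hk]

lemma mem_self (h : IsAPTree q Q m π τ z ed y) {k : ℕ} (hk : k ≤ m) : y k ∈ ed k := by
  rw [h.mem_iff k hk]
  exact ⟨τ k, h.tau_lt k hk, by rw [h.vert_eq hk]; ring⟩

lemma mem_parent (h : IsAPTree q Q m π τ z ed y) (hq : 3 ≤ q) {k : ℕ} (hk : k ≤ m) (h1 : 1 ≤ k) :
    y k ∈ ed (parent q k) := by
  have := parent_lt hq h1
  rw [h.mem_iff _ (by omega)]
  exact ⟨π k, h.pi_lt k hk h1, by rw [← base_eq_vert hq _ _ h1, h.base_eq k hk]⟩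

lemma vert_injective (h : IsAPTree q Q m π τ z ed y) {k : ℕ} (hk : k ≤ m) {s t : ℕ}
    (hst : vert q π τ k s (fun i => (z i : ℚ)) = vert q π τ k t (fun i => (z i : ℚ))) : s = t := by
  rw [h.vert_eq hk, h.vert_eq hk] at hst
  have hz : (z (k + 1) : ℚ) ≠ 0 := by exact_mod_cast (h.diff_pos k hk).ne'
  have : ((s : ℚ) - t) * z (k + 1) = 0 := by linarith
  rcases mul_eq_zero.1 this with h0 | h0
  · exact_mod_cast sub_eq_zero.1 h0
  · exact absurd h0 hz

/-- This is the injectivity of the coding by parameters once the shape is fixed. -/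
lemma edge_eq (h : IsAPTree q Q m π τ z ed y) (h' : IsAPTree q Q m π τ z' ed' y') (hq : 3 ≤ q)
    (hz : ∀ i ≤ m + 1, z i = z' i) {k : ℕ} (hk : k ≤ m) : ed k = ed' k := by
  ext x
  rw [h.mem_iff k hk, h'.mem_iff k hk]
  simp only [vert_congr hq π τ (z := fun i => (z i : ℚ)) (z' := fun i => (z' i : ℚ)) k _
    (fun i hi => by rw [hz i (by omega)])]

/-- Parameter 0 is a vertex. A difference is the distance from the attachment point to its successor
in the edge, or to its predecessor if the attachment point is the last one. -/
lemma le_of_subset (h : IsAPTree q Q m π τ z ed y) (hq : 3 ≤ q) (hqQ : q < Q) {n : ℕ}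
    (hn : ∀ k ≤ m, ed k ⊆ Set.Icc 1 n) {i : ℕ} (hi : i ≤ m + 1) : z i ≤ n := by
  rcases i with _ | k
  · have := hn 0 (by omega) (h.mem_self (by omega))
    have e := h.base_eq 0 (by omega)
    rw [base_zero] at e
    have : z 0 = y 0 := by exact_mod_cast e
    rw [this]; exact (hn 0 (by omega) (h.mem_self (by omega))).2
  · have hk : k ≤ m := by omega
    have hlen := le_edgeLen (k := k) hqQ
    obtain ⟨x, hx⟩ : ∃ x, x ∈ ed k ∧ (x = y k + z (k + 1) ∨ y k = x + z (k + 1)) := by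
      rcases Nat.lt_or_ge (τ k + 1) (edgeLen q Q k) with h1 | h1
      · refine ⟨y k + z (k + 1), ?_, Or.inl rfl⟩
        rw [h.mem_iff k hk]
        exact ⟨τ k + 1, h1, by rw [h.vert_eq hk]; push_cast; ring⟩
      · obtain ⟨x, hx⟩ := h.exists_nat k hk (τ k - 1) (by have := h.tau_lt k hk; omega)
        refine ⟨x, (h.mem_iff k hk x).2 ⟨_, by have := h.tau_lt k hk; omega, hx⟩, Or.inr ?_⟩
        rw [h.vert_eq hk, Nat.cast_sub (by omega)] at hx
        have : (y k : ℚ) = x + z (k + 1) := by rw [hx]; push_cast; ring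
        exact_mod_cast this
    have h2 := hn k hk hx.1
    have h3 := hn k hk (h.mem_self hk)
    simp only [Set.mem_Icc] at h2 h3
    omega

lemma edge_eq_image (h : IsAPTree q Q m π τ z ed y) {k : ℕ} (hk : k ≤ m) :
    ∃ f : ℕ → ℕ, Set.InjOn f (Set.Iio (edgeLen q Q k)) ∧ ed k = f '' Set.Iio (edgeLen q Q k) ∧
      ∀ s < edgeLen q Q k, (f s : ℚ) = vert q π τ k s (fun i => (z i : ℚ)) := by
  choose! f hf using h.exists_nat k hk
  refine ⟨f, fun s hs t ht hst => h.vert_injective hk ?_, ?_, hf⟩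
  · rw [← hf s hs, ← hf t ht, hst]
  · ext x
    rw [h.mem_iff k hk]
    constructor
    · rintro ⟨s, hs, hx⟩
      exact ⟨s, hs, by have := hf s hs; rw [← hx] at this; exact_mod_cast this⟩
    · rintro ⟨s, hs, rfl⟩
      exact ⟨s, hs, hf s hs⟩

lemma edge_finite (h : IsAPTree q Q m π τ z ed y) {k : ℕ} (hk : k ≤ m) : (ed k).Finite := by
  obtain ⟨f, -, h2, -⟩ := h.edge_eq_image hk
  rw [h2]; exact (Set.finite_Iio _).image _

lemma edge_ncard (h : IsAPTree q Q m π τ z ed y) {k : ℕ} (hk : k ≤ m) :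
    (ed k).ncard = edgeLen q Q k := by
  obtain ⟨f, h1, h2, -⟩ := h.edge_eq_image hk
  rw [h2, h1.ncard_image, ← Finset.coe_Iio, Set.ncard_coe_finset, Nat.card_Iio]

end IsAPTree


/-! ### Counting shapes and vertices of trees in the random set. -/

noncomputable instance (Q m : ℕ) : Fintype (shapes Q m) := (finite_shapes Q m).1.fintype

lemma card_shapes_le (Q m : ℕ) : Fintype.card (shapes Q m) ≤ Q ^ (m + 1) := by
  rw [← Nat.card_eq_fintype_card, Nat.card_coe_set_eq]; exact (finite_shapes Q m).2

/-- The vertices of the edges `ed 0, …, ed m`. -/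
def verts (m : ℕ) (ed : ℕ → Set ℕ) : Set ℕ := {x | ∃ k ≤ m, x ∈ ed k}

/-- A tree of arithmetic progressions in `[n] ∩ S` which comes from a path of length `L`. -/
structure IsTreeIn (q Q L n : ℕ) (S : Set ℕ) (π τ z : ℕ → ℕ) (ed : ℕ → Set ℕ) (y : ℕ → ℕ) : Prop
    extends IsAPTree q Q (q * L) π τ z ed y where
  one_le : 1 ≤ L
  pi_mem : π ∈ shapes Q (q * L)
  tau_mem : τ ∈ shapes Q (q * L)
  subset_Icc : ∀ k ≤ q * L, ed k ⊆ Set.Icc 1 n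
  subset_set : ∀ k ≤ q * L, ed k ⊆ S

/-- The long edges among `ed 0, …, ed m` are pairwise disjoint. -/
def LongDisjoint (q m : ℕ) (ed : ℕ → Set ℕ) : Prop :=
  ∀ k ≤ m, ∀ k' ≤ m, k % q ≠ 1 → k' % q ≠ 1 → k ≠ k' → Disjoint (ed k) (ed k')

lemma IsAPTree.verts_finite {q Q m : ℕ} {π τ z y : ℕ → ℕ} {ed : ℕ → Set ℕ}
    (h : IsAPTree q Q m π τ z ed y) : (verts m ed).Finite := by
  have : verts m ed = ⋃ k ∈ Set.Iic m, ed k := by ext x; simp [verts]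
  rw [this]
  exact (Set.finite_Iic m).biUnion fun k hk => h.edge_finite hk

lemma card_long {q L : ℕ} (hq : 3 ≤ q) :
    ((Finset.range (q * L + 1)).filter (fun k => k % q ≠ 1)).card = (q - 1) * L + 1 := by
  have h1 : ((Finset.range (q * L + 1)).filter (fun k => k % q = 1)).card = L := by
    have := Nat.count_modEq_card (r := q) (b := q * L + 1) (by omega) 1
    rw [Nat.count_eq_card_filter_range] at this
    have e : ∀ k, (k ≡ 1 [MOD q]) ↔ k % q = 1 := fun k => by
      rw [Nat.ModEq, Nat.mod_eq_of_lt (by omega : 1 < q)]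
    simp only [e] at this
    rw [this, Nat.mul_add_mod, Nat.mod_eq_of_lt (by omega : 1 < q), if_neg (by omega),
      Nat.mul_add_div (by omega), Nat.div_eq_of_lt (by omega)]
    rfl
  have h2 := Finset.card_filter_add_card_filter_not (s := Finset.range (q * L + 1))
    (fun k => k % q = 1)
  rw [h1, Finset.card_range] at h2
  have : q * L = (q - 1) * L + L := by
    obtain ⟨r, rfl⟩ : ∃ r, q = r + 1 := ⟨q - 1, by omega⟩
    rw [Nat.add_sub_cancel]; ring
  simp only [ne_eq]
  omega

lemma sum_ncard_le_ncard {β : Type*} (I : Finset β) (B : β → Set ℕ) (U : Set ℕ) (hU : U.Finite)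
    (hB : ∀ k ∈ I, B k ⊆ U) (hd : ∀ k ∈ I, ∀ k' ∈ I, k ≠ k' → Disjoint (B k) (B k')) :
    ∑ k ∈ I, (B k).ncard ≤ U.ncard := by
  classical
  induction I using Finset.induction_on generalizing U with
  | empty => simp
  | insert a I ha ih =>
    rw [Finset.sum_insert ha]
    have h1 := ih (U \ B a) (hU.subset Set.sdiff_subset)
      (fun k hk => Set.subset_sdiff.2 ⟨hB k (by simp [hk]), hd k (by simp [hk]) a (by simp) (by
        rintro rfl; exact ha hk)⟩)
      (fun k hk k' hk' => hd k (by simp [hk]) k' (by simp [hk']))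
    have h2 := Set.ncard_sdiff_add_ncard_of_subset (hB a (by simp)) hU
    omega

/-- The (q-1)L + 1 long edges are disjoint; vertices of short edges are not needed for the bound. -/
lemma le_ncard_verts {q Q L : ℕ} (hq : 3 ≤ q) {π τ z y : ℕ → ℕ} {ed : ℕ → Set ℕ}
    (h : IsAPTree q Q (q * L) π τ z ed y) (hd : LongDisjoint q (q * L) ed) :
    Q * ((q - 1) * L + 1) ≤ (verts (q * L) ed).ncard := by
  set I := (Finset.range (q * L + 1)).filter (fun k => k % q ≠ 1) with hI
  have hIm : ∀ k ∈ I, k ≤ q * L ∧ k % q ≠ 1 := by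
    intro k hk; simp [hI] at hk; exact ⟨by omega, hk.2⟩
  have h1 := sum_ncard_le_ncard I ed (verts (q * L) ed) h.verts_finite
    (fun k hk x hx => ⟨k, (hIm k hk).1, hx⟩)
    (fun k hk k' hk' hne => hd k (hIm k hk).1 k' (hIm k' hk').1 (hIm k hk).2 (hIm k' hk').2 hne)
  have h2 : ∀ k ∈ I, (ed k).ncard = Q := fun k hk => by
    rw [h.edge_ncard (hIm k hk).1, edgeLen_long (hIm k hk).2]
  rw [Finset.sum_congr rfl h2, Finset.sum_const, hI, card_long hq, smul_eq_mul, mul_comm] at h1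
  exact h1

/-! ### Nontrivial linear relations among vertices of a path are rare. -/

/-- The linear form `∑ i, c i • vert (k i) (s i)` vanishes at every parameter vector, if it does so
at the first unit vectors. -/
lemma exists_single_of_sum_vert_ne {q m r : ℕ} (hq : 3 ≤ q) {π τ : ℕ → ℕ} {c : Fin r → ℚ}
    {k s : Fin r → ℕ} (hk : ∀ i, k i ≤ m) {z : ℕ → ℚ}
    (h : ∑ i, c i * vert q π τ (k i) (s i) z ≠ 0) :
    ∃ κ < m + 2, ∑ i, c i * vert q π τ (k i) (s i) (Pi.single κ 1) ≠ 0 := by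
  by_contra! hcon
  apply h
  -- The forms only see the first m + 2 coordinates, so the parameter vector may be replaced by a
  -- finite combination of unit vectors.
  let z' : ℕ → ℚ := ∑ κ ∈ Finset.range (m + 2), z κ • Pi.single κ 1
  have hz' : ∀ i ≤ m + 1, z i = z' i := by
    intro i hi
    simp only [z', Finset.sum_apply, Pi.smul_apply, Pi.single_apply, smul_eq_mul, mul_ite, mul_one,
      mul_zero, Finset.sum_ite_eq, Finset.mem_range]
    rw [if_pos (by omega)]
  have e : ∀ i, vert q π τ (k i) (s i) z =
      ∑ κ ∈ Finset.range (m + 2), z κ * vert q π τ (k i) (s i) (Pi.single κ 1) := by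
    intro i
    rw [vert_congr hq π τ (k i) (s i) (fun j hj => hz' j (by have := hk i; omega))]
    simp only [z', map_sum, map_smul, smul_eq_mul]
  simp only [e, Finset.mul_sum]
  rw [Finset.sum_comm]
  refine Finset.sum_eq_zero fun κ hκ => ?_
  have := hcon κ (Finset.mem_range.1 hκ)
  calc _ = z κ * ∑ i, c i * vert q π τ (k i) (s i) (Pi.single κ 1) := by
        rw [Finset.mul_sum]; exact Finset.sum_congr rfl fun i _ => by ring
    _ = 0 := by rw [this, mul_zero]

/-- The two values of a linear form with nonzero coefficient at `κ` determine parameter `κ`. -/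
lemma eq_of_form_eq {f : (ℕ → ℚ) →ₗ[ℚ] ℚ} {κ m : ℕ}
    (hf : ∀ z z' : ℕ → ℚ, (∀ i ≤ m, z i = z' i) → f z = f z') (hκ : f (Pi.single κ 1) ≠ 0)
    {z z' : ℕ → ℚ} (h : ∀ i ≤ m, i ≠ κ → z i = z' i) (hz : f z = f z') : z κ = z' κ := by
  have h1 : f z = f (z' + (z κ - z' κ) • Pi.single κ 1) := by
    apply hf
    intro i hi
    rcases eq_or_ne i κ with rfl | hne
    · simp
    · simp [h i hi hne, hne]
  rw [map_add, map_smul, hz, smul_eq_mul, left_eq_add] at h1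
  rcases mul_eq_zero.1 h1 with h2 | h2
  · linarith
  · exact absurd h2 hκ

/-- The choice of an edge of the path contributes a factor linear in `L`; bounding it exponentially
brings the number of patterns into the form a·K^L. -/
lemma mul_add_one_le_pow (q L : ℕ) : q * L + 1 ≤ (q + 1) ^ L := by
  induction L with
  | zero => simp
  | succ L ih =>
    rw [pow_succ]
    nlinarith [Nat.zero_le (q * L), Nat.zero_le (q * (q * L))]

/-- It is rare that a simple path satisfies a linear relation that does not follow from its shape. -/
theorem rare_relation (q Q : ℕ) (hq : 3 ≤ q) (hqQ : q < Q) {P : Type} [Fintype P] (r : ℕ)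
    (coef : P → Fin r → ℚ) :
    Rare q Q fun n => {S | ∃ L π τ z ed y, IsTreeIn q Q L n S π τ z ed y ∧
      LongDisjoint q (q * L) ed ∧ ∃ (ρ : P) (k s : Fin r → ℕ), (∀ i, k i ≤ q * L) ∧
      (∀ i, s i < Q) ∧ ∑ i, coef ρ i * vert q π τ (k i) (s i) (fun j => (z j : ℚ)) = 0 ∧
      ∃ z' : ℕ → ℚ, ∑ i, coef ρ i * vert q π τ (k i) (s i) z' ≠ 0} := by
  let Θ : ℕ → Type := fun L => shapes Q (q * L) × shapes Q (q * L) × P ×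
    (Fin r → Fin (q * L + 1)) × (Fin r → Fin Q) × Fin (q * L + 2)
  let R : ∀ _n L, Θ L → Finset ℕ → (ℕ → ℕ) → Prop := fun n L θ V z =>
    ∃ S ed y, IsTreeIn q Q L n S θ.1 θ.2.1 z ed y ∧ LongDisjoint q (q * L) ed ∧
      (V : Set ℕ) = verts (q * L) ed ∧
      ∑ i, coef θ.2.2.1 i * vert q θ.1 θ.2.1 (θ.2.2.2.1 i) (θ.2.2.2.2.1 i) (fun j => (z j : ℚ)) = 0 ∧
      ∑ i, coef θ.2.2.1 i * vert q θ.1 θ.2.1 (θ.2.2.2.1 i) (θ.2.2.2.2.1 i)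
        (Pi.single θ.2.2.2.2.2.val 1) ≠ 0
  -- The last entry of the pattern is a parameter with nonzero coefficient in the relation. The
  -- relation recovers it from the other parameters, so it is dropped from the code.
  let D : ∀ L, Θ L → Finset ℕ := fun L θ => (Finset.range (q * L + 2)).erase θ.2.2.2.2.2
  have hDcard : ∀ L θ, (D L θ).card = q * L + 1 := by
    intro L θ
    simp only [D]
    rw [Finset.card_erase_of_mem (Finset.mem_range.2 θ.2.2.2.2.2.2), Finset.card_range]
    omega
  have hV : ∀ n L θ V z, R n L θ V z → Q * ((q - 1) * L + 1) ≤ V.card := by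
    rintro n L θ V z ⟨S, ed, y, h1, h2, h3, -⟩
    rw [← Set.ncard_coe_finset, h3]
    exact le_ncard_verts hq h1.toIsAPTree h2
  refine (rare_of_code q Q hq hqQ (Θ := Θ)
    (Q * Q * Fintype.card P * Q ^ r * 2) (Q ^ q * Q ^ q * (q + 1) ^ r * (q + 1)) ?_ D
    (fun L θ => by rw [hDcard]; omega) R ?_ ?_ ?_ ?_).mono ?_
  · intro L
    have hb := mul_add_one_le_pow q L
    simp only [Θ, Fintype.card_prod, Fintype.card_fun, Fintype.card_fin]
    calc _ ≤ Q ^ (q * L + 1) * (Q ^ (q * L + 1) * (Fintype.card P * (((q + 1) ^ L) ^ r *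
          (Q ^ r * (2 * (q + 1) ^ L))))) := by
          have := card_shapes_le Q (q * L)
          gcongr
          omega
      _ = _ := by
          rw [mul_pow, mul_pow, mul_pow, ← pow_mul, ← pow_mul (q + 1) r, ← pow_mul, pow_add, mul_comm r L]
          ring
  · rintro n L θ V z ⟨S, ed, y, h1, -⟩ i hi
    simp only [D, Finset.mem_erase, Finset.mem_range] at hi
    exact h1.le_of_subset hq hqQ h1.subset_Icc (by omega)
  · intro n L θ V z h
    have := hV n L θ V z h
    rw [hDcard]
    obtain ⟨t, rfl⟩ : ∃ t, q = t + 1 := ⟨q - 1, by omega⟩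
    rw [Nat.add_sub_cancel] at *
    -- With one parameter fewer, (qL+1)·Q(q-1) falls short of qQ((q-1)L+1) by exactly Q, which
    -- leaves room for the required 1.
    calc _ = (t + 1) * L * (Q * t) + Q * t + 1 := by ring
      _ ≤ (t + 1) * L * (Q * t) + Q * t + Q := by omega
      _ = (t + 1) * (Q * (t * L + 1)) := by ring
      _ ≤ _ := by gcongr
  · intro n L θ V z h
    have := hV n L θ V z h
    calc _ = Q * ((q - 1) * L) := by ring
      _ ≤ Q * ((q - 1) * L + 1) := by gcongr; omega
      _ ≤ _ := by omega
  · rintro n L θ V V' z z' ⟨S, ed, y, h1, h2, h3, h4, h5⟩ ⟨S', ed', y', h1', h2', h3', h4', h5'⟩ hz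
    let f : (ℕ → ℚ) →ₗ[ℚ] ℚ :=
      ∑ i, coef θ.2.2.1 i • vert q θ.1 θ.2.1 (θ.2.2.2.1 i) (θ.2.2.2.2.1 i)
    have hf : ∀ z, f z = ∑ i, coef θ.2.2.1 i *
        vert q θ.1 θ.2.1 (θ.2.2.2.1 i) (θ.2.2.2.2.1 i) z := by
      intro z; simp [f]
    rw [← hf] at h4 h4' h5
    have hκ : (z θ.2.2.2.2.2 : ℚ) = z' θ.2.2.2.2.2 := by
      refine eq_of_form_eq (f := f) (m := q * L + 1) (fun w w' hw => ?_) h5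
        (z := fun j => (z j : ℚ)) (z' := fun j => (z' j : ℚ)) (fun i hi hne => ?_)
        (by rw [h4, h4'])
      · rw [hf, hf]
        refine Finset.sum_congr rfl fun i _ => ?_
        rw [vert_congr hq _ _ _ _ (fun j hj => hw j (by have := (θ.2.2.2.1 i).2; omega))]
      · have := hz i (by simp only [D, Finset.mem_erase, Finset.mem_range]; exact ⟨hne, by omega⟩)
        simp [this]
    have hall : ∀ i ≤ q * L + 1, z i = z' i := by
      intro i hi
      by_cases hne : i = (θ.2.2.2.2.2 : ℕ)
      · rw [hne]; exact_mod_cast hκ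
      · exact hz i (by simp only [D, Finset.mem_erase, Finset.mem_range]; exact ⟨hne, by omega⟩)
    apply Finset.coe_injective
    rw [h3, h3']
    ext x
    simp only [verts, Set.mem_ofPred_eq]
    refine exists_congr fun k => and_congr_right fun hk => ?_
    rw [h1.edge_eq h1'.toIsAPTree hq hall hk]
  · rintro n S ⟨L, π, τ, z, ed, y, h1, h2, ρ, k, s, hk, hs, h3, z', h4⟩
    obtain ⟨κ, hκ, h5⟩ := exists_single_of_sum_vert_ne hq hk h4
    have hfin := h1.verts_finite
    refine ⟨L, (⟨π, h1.pi_mem⟩, ⟨τ, h1.tau_mem⟩, ρ, fun i => ⟨k i, by have := hk i; omega⟩,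
      fun i => ⟨s i, hs i⟩, ⟨κ, hκ⟩), hfin.toFinset, z, ⟨S, ed, y, h1, h2, by simp, h3, h5⟩, ?_⟩
    rintro x hx
    rw [Set.Finite.coe_toFinset] at hx
    obtain ⟨k, hk, hxk⟩ := hx
    exact h1.subset_set k hk hxk


/-! ### From simple paths to trees of progressions. -/

/-- A simple path without the disjointness conditions. -/
structure IsCoveredChain (q Q L : ℕ) (E : ℕ → Set ℕ) (C : ℕ → ℕ → Set ℕ) : Prop where
  one_le : 1 ≤ L
  short : ∀ i ∈ Set.Icc 1 L, (E i).ncard = q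
  long : ∀ i ∈ Set.Icc 1 L, ∀ j ∈ Set.Icc 1 q, (C i j).ncard = Q
  cover : ∀ i ∈ Set.Icc 1 L, IsCover (E i) (C i)
  shared : ∀ i ∈ Set.Icc 1 L, i < L → C (i + 1) 1 = C i q

lemma IsSimplePath.isCoveredChain {q Q L : ℕ} {E : ℕ → Set ℕ} {C : ℕ → ℕ → Set ℕ}
    (h : IsSimplePath Q q L E C) : IsCoveredChain q Q L E C :=
  ⟨h.one_le, h.short, h.long, h.cover, h.shared⟩

/-- The edges of a path as a sequence. -/
def edgeSeq (q : ℕ) (E : ℕ → Set ℕ) (C : ℕ → ℕ → Set ℕ) (k : ℕ) : Set ℕ :=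
  if k % q = 1 then E (k / q + 1) else if k = 0 then C 1 1 else C ((k - 1) / q + 1) ((k - 1) % q + 1)

lemma index_cases {q L k : ℕ} (hq : 3 ≤ q) (hk : k ≤ q * L) (h1 : 1 ≤ k) :
    ∃ i < L, ∃ j, 1 ≤ j ∧ j ≤ q ∧ k = q * i + j := by
  refine ⟨(k - 1) / q, ?_, (k - 1) % q + 1, by omega, ?_, ?_⟩
  · rw [Nat.div_lt_iff_lt_mul (by omega), mul_comm]; omega
  · have := Nat.mod_lt (k - 1) (by omega : 0 < q); omega
  · have := Nat.div_add_mod (k - 1) q; omega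

lemma index_mod_eq_one_iff {q i j : ℕ} (hq : 3 ≤ q) (hj : j ≤ q) :
    (q * i + j) % q = 1 ↔ j = 1 := by
  rw [Nat.mul_add_mod]
  rcases hj.lt_or_eq with h | rfl
  · rw [Nat.mod_eq_of_lt h]
  · simp; omega

lemma index_sub_div {q i j : ℕ} (h1 : 1 ≤ j) (hj : j ≤ q) :
    (q * i + j - 1) / q = i ∧ (q * i + j - 1) % q = j - 1 := by
  rw [Nat.add_sub_assoc h1, Nat.mul_add_mod, Nat.mul_add_div (by omega),
    Nat.mod_eq_of_lt (by omega), Nat.div_eq_of_lt (by omega)]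
  simp

lemma parent_short {q i : ℕ} (hq : 3 ≤ q) : parent q (q * i + 1) = q * i := by
  unfold parent
  rw [if_pos ((index_mod_eq_one_iff hq (by omega)).2 rfl), Nat.add_sub_cancel]

lemma parent_long {q i j : ℕ} (hq : 3 ≤ q) (h1 : 2 ≤ j) (hj : j ≤ q) :
    parent q (q * i + j) = q * i + 1 := by
  unfold parent
  rw [if_neg (by rw [index_mod_eq_one_iff hq hj]; omega),
    (index_sub_div (i := i) (by omega) hj).1]

lemma edgeSeq_short {q : ℕ} (hq : 3 ≤ q) (E : ℕ → Set ℕ) (C : ℕ → ℕ → Set ℕ) (i : ℕ) :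
    edgeSeq q E C (q * i + 1) = E (i + 1) := by
  unfold edgeSeq
  rw [if_pos ((index_mod_eq_one_iff hq (by omega)).2 rfl), Nat.mul_add_div (by omega),
    Nat.div_eq_of_lt (by omega), add_zero]

lemma edgeSeq_long {q : ℕ} (hq : 3 ≤ q) (E : ℕ → Set ℕ) (C : ℕ → ℕ → Set ℕ) (i : ℕ) {j : ℕ}
    (h1 : 2 ≤ j) (hj : j ≤ q) : edgeSeq q E C (q * i + j) = C (i + 1) j := by
  unfold edgeSeq
  rw [if_neg (by rw [index_mod_eq_one_iff hq hj]; omega), if_neg (by omega),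
    (index_sub_div (i := i) (by omega) hj).1, (index_sub_div (i := i) (by omega) hj).2]
  congr 1; omega

lemma edgeSeq_zero {q : ℕ} (E : ℕ → Set ℕ) (C : ℕ → ℕ → Set ℕ) :
    edgeSeq q E C 0 = C 1 1 := by
  simp [edgeSeq]

namespace IsCoveredChain

variable {q Q L : ℕ} {E : ℕ → Set ℕ} {C : ℕ → ℕ → Set ℕ}

/-- The long edge common to two consecutive covers is listed only once, as the last edge of the
earlier cover. It is therefore also the parent of the next short edge. -/
lemma edgeSeq_first (h : IsCoveredChain q Q L E C) (hq : 3 ≤ q) {i : ℕ} (hi : i < L) :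
    edgeSeq q E C (q * i) = C (i + 1) 1 := by
  rcases i with _ | i
  · rw [mul_zero, edgeSeq_zero]
  · rw [mul_add, mul_one, edgeSeq_long hq _ _ _ (by omega) le_rfl,
      h.shared (i + 1) ⟨by omega, by omega⟩ hi]

lemma exists_edgeSeq_eq (h : IsCoveredChain q Q L E C) (hq : 3 ≤ q) {i j : ℕ} (hi : i < L)
    (h1 : 1 ≤ j) (hj : j ≤ q) : ∃ k ≤ q * L, k % q ≠ 1 ∧ edgeSeq q E C k = C (i + 1) j := by
  have hle : q * i + q ≤ q * L := by
    calc q * i + q = q * (i + 1) := by ring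
      _ ≤ _ := by gcongr; omega
  rcases h1.lt_or_eq with h2 | rfl
  · exact ⟨q * i + j, by omega, by rw [ne_eq, index_mod_eq_one_iff hq hj]; omega,
      edgeSeq_long hq _ _ _ h2 hj⟩
  · exact ⟨q * i, by omega, by simp, h.edgeSeq_first hq hi⟩

lemma index_le {i j : ℕ} (hi : i < L) (hj : j ≤ q) : q * i + j ≤ q * L := by
  calc q * i + j ≤ q * (i + 1) := by rw [mul_add, mul_one]; omega
    _ ≤ _ := by gcongr; omega

lemma edgeSeq_mem (h : IsCoveredChain q Q L E C) (hq : 3 ≤ q) {k : ℕ} (hk : k ≤ q * L) :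
    edgeSeq q E C k ∈ pathEdges q L E C ∧ (edgeSeq q E C k).ncard = edgeLen q Q k := by
  have hL := h.one_le
  rcases Nat.eq_zero_or_pos k with rfl | h1
  · rw [edgeSeq_zero, edgeLen_long (by simp)]
    exact ⟨⟨1, ⟨le_rfl, hL⟩, Or.inr ⟨1, ⟨le_rfl, by omega⟩, rfl⟩⟩,
      h.long 1 ⟨le_rfl, hL⟩ 1 ⟨le_rfl, by omega⟩⟩
  · obtain ⟨i, hi, j, hj1, hjq, rfl⟩ := index_cases hq hk h1
    rcases hj1.lt_or_eq with h2 | rfl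
    · rw [edgeSeq_long hq _ _ _ h2 hjq,
        edgeLen_long (by rw [ne_eq, index_mod_eq_one_iff hq hjq]; omega)]
      exact ⟨⟨i + 1, ⟨by omega, by omega⟩, Or.inr ⟨j, ⟨hj1, hjq⟩, rfl⟩⟩,
        h.long (i + 1) ⟨by omega, by omega⟩ j ⟨hj1, hjq⟩⟩
    · rw [edgeSeq_short hq, edgeLen_short ((index_mod_eq_one_iff hq hjq).2 rfl)]
      exact ⟨⟨i + 1, ⟨by omega, by omega⟩, Or.inl rfl⟩, h.short (i + 1) ⟨by omega, by omega⟩⟩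

lemma verts_eq (h : IsCoveredChain q Q L E C) (hq : 3 ≤ q) :
    verts (q * L) (edgeSeq q E C) = pathVerts q L E C := by
  ext x
  constructor
  · rintro ⟨k, hk, hx⟩
    exact ⟨_, (h.edgeSeq_mem hq hk).1, hx⟩
  · rintro ⟨e, ⟨i, ⟨hi1, hi⟩, he⟩, hx⟩
    obtain ⟨i, rfl⟩ : ∃ i', i = i' + 1 := ⟨i - 1, by omega⟩
    rcases he with rfl | ⟨j, ⟨hj1, hj⟩, rfl⟩
    · exact ⟨q * i + 1, index_le (by omega) (by omega), by rwa [edgeSeq_short hq]⟩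
    · obtain ⟨k, hk, -, he⟩ := h.exists_edgeSeq_eq hq (by omega : i < L) hj1 hj
      exact ⟨k, hk, by rwa [he]⟩

/-- A covered chain of arithmetic progressions is a tree. -/
lemma exists_isTreeIn (h : IsCoveredChain q Q L E C) (hq : 3 ≤ q) (hqQ : q < Q) {n : ℕ} {S : Set ℕ}
    (hS : ∀ e ∈ pathEdges q L E C, e ⊆ S ∧ e ⊆ Set.Icc 1 n ∧ IsAP e.ncard e) :
    ∃ π τ z y, IsTreeIn q Q L n S π τ z (edgeSeq q E C) y ∧ y 0 = y 1 ∧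
      (∀ k ≤ q * L, 1 ≤ k → edgeSeq q E C k ∩ edgeSeq q E C (parent q k) = {y k}) ∧
      ∀ i < L, Set.BijOn (fun j => y (q * i + j)) (Set.Icc 1 q) (E (i + 1)) := by
  have hL := h.one_le
  have hc := h.cover
  unfold IsCover at hc
  choose! a ha ha' using hc
  let y : ℕ → ℕ := fun k => if k = 0 then a 1 1 else a ((k - 1) / q + 1) ((k - 1) % q + 1)
  have hy : ∀ i j, 1 ≤ j → j ≤ q → y (q * i + j) = a (i + 1) j := by
    intro i j h1 hj
    simp only [y]
    rw [if_neg (by omega), (index_sub_div (i := i) h1 hj).1, (index_sub_div (i := i) h1 hj).2]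
    congr 1; omega
  have hy0 : y 0 = a 1 1 := by simp [y]
  have hac : ∀ i < L, ∀ j, 1 ≤ j → j ≤ q → E (i + 1) ∩ C (i + 1) j = {a (i + 1) j} := by
    intro i hi j h1 hj
    exact (ha' (i + 1) ⟨by omega, by omega⟩ j
      ⟨h1, by rw [h.short (i + 1) ⟨by omega, by omega⟩]; exact hj⟩).1
  have hinter : ∀ k ≤ q * L, 1 ≤ k →
      edgeSeq q E C k ∩ edgeSeq q E C (parent q k) = {y k} := by
    intro k hk h1
    obtain ⟨i, hi, j, hj1, hjq, rfl⟩ := index_cases hq hk h1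
    rw [hy i j hj1 hjq]
    rcases hj1.lt_or_eq with h2 | rfl
    · rw [parent_long hq h2 hjq, edgeSeq_long hq _ _ _ h2 hjq, edgeSeq_short hq, Set.inter_comm]
      exact hac i hi j hj1 hjq
    · rw [parent_short hq, edgeSeq_short hq, h.edgeSeq_first hq hi]
      exact hac i hi 1 le_rfl hjq
  have h01 : y 0 = y 1 := by
    rw [hy0]; exact (hy 0 1 le_rfl (by omega)).symm
  have hmem : ∀ k ≤ q * L, 1 ≤ k → y k ∈ edgeSeq q E C k ∧ y k ∈ edgeSeq q E C (parent q k) := by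
    intro k hk h1
    have : y k ∈ edgeSeq q E C k ∩ edgeSeq q E C (parent q k) := by rw [hinter k hk h1]; rfl
    exact this
  have hm : 1 ≤ q * L := Nat.mul_pos (by omega) hL
  obtain ⟨π, hπ, τ, hτ, z, ht⟩ := exists_isAPTree hq hqQ hm (ed := edgeSeq q E C) (y := y)
    (fun k hk => by
      have := h.edgeSeq_mem hq hk
      rw [← this.2]; exact (hS _ this.1).2.2)
    (fun k hk => by
      rcases Nat.eq_zero_or_pos k with rfl | h1
      · rw [h01]; have := (hmem 1 hm le_rfl).2; rwa [parent_one hq] at this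
      · exact (hmem k hk h1).1)
    (fun k hk h1 => (hmem k hk h1).2) h01
  refine ⟨π, τ, z, y, ⟨ht, hL, hπ, hτ, fun k hk => (hS _ (h.edgeSeq_mem hq hk).1).2.1,
    fun k hk => (hS _ (h.edgeSeq_mem hq hk).1).1⟩, h01, hinter, fun i hi => ?_⟩
  have h2 := ha (i + 1) ⟨by omega, by omega⟩
  rw [h.short (i + 1) ⟨by omega, by omega⟩] at h2
  exact h2.congr fun j hj => (hy i j hj.1 hj.2).symm

end IsCoveredChain

/-- The pairs exempted in `long_disjoint` are the two names of a shared edge, and the sequence lists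
such an edge under a single index. -/
lemma IsSimplePath.longDisjoint {q Q L : ℕ} {E : ℕ → Set ℕ} {C : ℕ → ℕ → Set ℕ}
    (h : IsSimplePath Q q L E C) (hq : 3 ≤ q) : LongDisjoint q (q * L) (edgeSeq q E C) := by
  have hL := h.one_le
  have hcase : ∀ k ≤ q * L, k % q ≠ 1 → ∃ i ∈ Set.Icc 1 L, ∃ j ∈ Set.Icc 1 q,
      edgeSeq q E C k = C i j ∧ ((k = 0 ∧ i = 1 ∧ j = 1) ∨ (2 ≤ j ∧ k = q * (i - 1) + j)) := by
    intro k hk hm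
    rcases Nat.eq_zero_or_pos k with rfl | h1
    · exact ⟨1, ⟨le_rfl, hL⟩, 1, ⟨le_rfl, by omega⟩, edgeSeq_zero _ _, Or.inl ⟨rfl, rfl, rfl⟩⟩
    · obtain ⟨i, hi, j, hj1, hjq, rfl⟩ := index_cases hq hk h1
      rw [ne_eq, index_mod_eq_one_iff hq hjq] at hm
      exact ⟨i + 1, ⟨by omega, by omega⟩, j, ⟨hj1, hjq⟩, edgeSeq_long hq _ _ _ (by omega) hjq,
        Or.inr ⟨by omega, by simp⟩⟩
  intro k hk k' hk' hm hm' hne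
  obtain ⟨i, hi, j, hj, he, h1⟩ := hcase k hk hm
  obtain ⟨i', hi', j', hj', he', h1'⟩ := hcase k' hk' hm'
  rw [he, he']
  apply h.long_disjoint i hi j hj i' hi' j' hj'
  · intro heq
    obtain ⟨rfl, rfl⟩ := Prod.ext_iff.1 heq
    apply hne
    simp only at h1 h1'
    omega
  · rintro ⟨rfl, rfl, rfl⟩
    have := hi.1
    omega
  · rintro ⟨rfl, rfl, rfl⟩
    have := hi'.1
    omega

lemma IsAP.ncard_eq {r : ℕ} {e : Set ℕ} (h : IsAP r e) : e.ncard = r := by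
  obtain ⟨a, d, hd, rfl⟩ := h
  have : {x | ∃ i < r, x = a + i * d} = (fun i => a + i * d) '' Set.Iio r := by
    ext x; simp [eq_comm]
  rw [this, Set.InjOn.ncard_image, ← Finset.coe_Iio, Set.ncard_coe_finset, Nat.card_Iio]
  intro i _ j _ hij
  simpa [hd.ne'] using hij

lemma mem_induce_apHypergraph {q Q n : ℕ} {S e : Set ℕ}
    (h : e ∈ (induce (apHypergraph n Q q) S).edgeSet) :
    e ⊆ S ∧ e ⊆ Set.Icc 1 n ∧ IsAP e.ncard e := by
  obtain ⟨⟨h1, h2⟩, h3⟩ := h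
  refine ⟨h3, h1, ?_⟩
  rcases h2 with h2 | h2 <;> (rw [h2.ncard_eq]; exact h2)


/-! ### Coefficients of the forms, and spoiled paths. -/

lemma base_single_of_lt {q : ℕ} (hq : 3 ≤ q) (π τ : ℕ → ℕ) {k κ : ℕ} (h : k < κ) :
    base q π τ k (Pi.single κ 1) = 0 := by
  rw [base_congr hq π τ k (z' := 0) (fun i hi => by simp [Pi.single_apply]; omega), map_zero]

lemma vert_single_of_lt {q : ℕ} (hq : 3 ≤ q) (π τ : ℕ → ℕ) {k κ : ℕ} (s : ℕ) (h : k + 1 < κ) :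
    vert q π τ k s (Pi.single κ 1) = 0 := by
  rw [vert_congr hq π τ k s (z' := 0) (fun i hi => by simp [Pi.single_apply]; omega), map_zero]

/-- A vertex of edge `k` involves the difference of that edge unless it is the attachment point.
This is the source of all nontriviality statements below. -/
lemma vert_single_self {q : ℕ} (hq : 3 ≤ q) (π τ : ℕ → ℕ) (k s : ℕ) :
    vert q π τ k s (Pi.single (k + 1) 1) = (s : ℚ) - τ k := by
  rw [vert_apply, base_single_of_lt hq π τ (by omega)]; simp

lemma IsAPTree.exists_pos {q Q m : ℕ} {π τ z y : ℕ → ℕ} {ed : ℕ → Set ℕ}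
    (h : IsAPTree q Q m π τ z ed y) (hqQ : q < Q) {k x : ℕ} (hk : k ≤ m) (hx : x ∈ ed k) :
    ∃ s < Q, (x : ℚ) = vert q π τ k s (fun i => (z i : ℚ)) ∧ (x ≠ y k → s ≠ τ k) := by
  obtain ⟨s, hs, e⟩ := (h.mem_iff k hk x).1 hx
  refine ⟨s, hs.trans_le (edgeLen_le hqQ), e, fun hne hst => hne ?_⟩
  rw [h.vert_eq hk, hst, sub_self, zero_mul, add_zero] at e
  exact_mod_cast e

lemma IsAP.exists_pos {r : ℕ} {F : Set ℕ} (h : IsAP r F) :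
    ∃ (a d : ℕ) (pos : ℕ → ℕ), 0 < d ∧ ∀ x ∈ F, pos x < r ∧ x = a + pos x * d := by
  obtain ⟨a, d, hd, rfl⟩ := h
  have : ∀ x ∈ {x | ∃ i < r, x = a + i * d}, ∃ i, i < r ∧ x = a + i * d := fun x hx => hx
  choose! pos hpos using this
  exact ⟨a, d, pos, hd, hpos⟩

lemma IsAP.finite {r : ℕ} {F : Set ℕ} (h : IsAP r F) (hr : 0 < r) : F.Finite :=
  Set.finite_of_ncard_pos (by rw [h.ncard_eq]; exact hr)

/-- The events that some structure `T` occurs as a subhypergraph in the random set. -/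
def occurs (q Q : ℕ) (T : Hypergraph ℕ → Prop) (n : ℕ) : Set (Set ℕ) :=
  {S | ∃ B, (IsUniform Q q B ∧ T B) ∧ IsSubhypergraph B (induce (apHypergraph n Q q) S)}

/-- Besides v, the spoiling edge F contains two more path vertices x, x'; since F meets the last
long edge only in v, they lie on earlier edges. Collinearity of v, x, x' in F is a relation with
coefficients from a finite set. It is nontrivial because v is not the attachment point of the last
edge, while x and x' do not involve the difference of that edge. -/
theorem rare_isSpoiledPath (q Q : ℕ) (hq : 3 ≤ q) (hqQ : q < Q) :
    Rare q Q (occurs q Q (IsSpoiledPath Q q)) := by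
  refine (rare_relation q Q hq hqQ (P := Fin Q × Fin Q × Fin Q) 3 (fun ρ =>
    ![(ρ.2.2 : ℚ) - ρ.2.1, (ρ.1 : ℚ) - ρ.2.2, (ρ.2.1 : ℚ) - ρ.1])).mono ?_
  rintro n S ⟨B, ⟨hu, L, E, C, F, hP, -, h3, ⟨v, hvE, hFv⟩, rfl⟩, -, hsub⟩
  have hch := hP.isCoveredChain
  have hedge : ∀ e ∈ pathEdges q L E C ∪ {F}, e ⊆ S ∧ e ⊆ Set.Icc 1 n ∧ IsAP e.ncard e :=
    fun e he => mem_induce_apHypergraph (hsub he)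
  obtain ⟨π, τ, z, y, ht, -, hinter, -⟩ := hch.exists_isTreeIn hq hqQ
    (fun e he => hedge e (Or.inl he))
  have hL := hP.one_le
  have hK : edgeSeq q E C (q * L) = C L q := by
    obtain ⟨i, rfl⟩ : ∃ i, L = i + 1 := ⟨L - 1, by omega⟩
    rw [mul_add, mul_one, edgeSeq_long hq _ _ _ (by omega) le_rfl]
  have hKpar : edgeSeq q E C (parent q (q * L)) = E L := by
    obtain ⟨i, rfl⟩ : ∃ i, L = i + 1 := ⟨L - 1, by omega⟩
    rw [mul_add, mul_one, parent_long hq (by omega) le_rfl, edgeSeq_short hq]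
  have hFncard : F.ncard = Q ∨ F.ncard = q := hu F (Or.inr rfl)
  have hFAP := (hedge F (Or.inr rfl)).2.2
  have hFQ : F.ncard ≤ Q := by omega
  have hFfin : F.Finite := hFAP.finite (by omega)
  have hv : v ∈ F ∩ C L q := by rw [hFv]; rfl
  have hm1 : 1 ≤ q * L := Nat.mul_pos (by omega) hL
  have hvy : v ≠ y (q * L) := by
    rintro rfl
    apply hvE
    rw [← hKpar]
    exact ht.mem_parent hq le_rfl hm1
  rw [← hch.verts_eq hq] at h3
  obtain ⟨x, hx, x', hx', hxx⟩ : ∃ x ∈ (F ∩ verts (q * L) (edgeSeq q E C)) \ {v},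
      ∃ x' ∈ (F ∩ verts (q * L) (edgeSeq q E C)) \ {v}, x ≠ x' := by
    rw [← Set.one_lt_ncard ((hFfin.inter_of_left _).subset Set.sdiff_subset)]
    have := Set.le_ncard_sdiff {v} (F ∩ verts (q * L) (edgeSeq q E C))
    rw [Set.ncard_singleton] at this
    omega
  have hlast : ∀ x ∈ (F ∩ verts (q * L) (edgeSeq q E C)) \ {v}, ∃ k < q * L, x ∈ edgeSeq q E C k := by
    rintro x ⟨⟨hxF, k, hk, hxk⟩, hxv⟩
    refine ⟨k, lt_of_le_of_ne hk ?_, hxk⟩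
    rintro rfl
    rw [hK] at hxk
    apply hxv
    rw [← hFv]; exact ⟨hxF, hxk⟩
  obtain ⟨k, hk, hxk⟩ := hlast x hx
  obtain ⟨k', hk', hxk'⟩ := hlast x' hx'
  obtain ⟨s, hs, es, -⟩ := ht.exists_pos hqQ hk.le hxk
  obtain ⟨s', hs', es', -⟩ := ht.exists_pos hqQ hk'.le hxk'
  obtain ⟨t, htQ, et, htt⟩ := ht.exists_pos hqQ le_rfl (show v ∈ edgeSeq q E C (q * L) by
    rw [hK]; exact hv.2)
  obtain ⟨a, d, pos, hd, hpos⟩ := hFAP.exists_pos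
  have h1 := hpos v hv.1
  have h2 := hpos x hx.1.1
  have h3 := hpos x' hx'.1.1
  refine ⟨L, π, τ, z, _, y, ht, hP.longDisjoint hq,
    (⟨pos v, by omega⟩, ⟨pos x, by omega⟩, ⟨pos x', by omega⟩),
    ![q * L, k, k'], ![t, s, s'], ?_, ?_, ?_, Pi.single (q * L + 1) 1, ?_⟩
  · intro i; fin_cases i <;> simp <;> omega
  · intro i; fin_cases i <;> simpa
  · simp only [Fin.sum_univ_three, Matrix.cons_val]
    rw [← es, ← es', ← et]
    have e1 : (v : ℚ) = a + pos v * d := by exact_mod_cast h1.2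
    have e2 : (x : ℚ) = a + pos x * d := by exact_mod_cast h2.2
    have e3 : (x' : ℚ) = a + pos x' * d := by exact_mod_cast h3.2
    rw [e1, e2, e3]; ring
  · simp only [Fin.sum_univ_three, Matrix.cons_val]
    rw [vert_single_self hq, vert_single_of_lt hq _ _ _ (by omega),
      vert_single_of_lt hq _ _ _ (by omega)]
    have hne : (pos x' : ℚ) - pos x ≠ 0 := by
      intro h0
      have : pos x' = pos x := by exact_mod_cast sub_eq_zero.1 h0
      exact hxx (by rw [h2.2, h3.2, this])
    have hne' : (t : ℚ) - τ (q * L) ≠ 0 := by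
      intro h0
      exact htt hvy (by exact_mod_cast sub_eq_zero.1 h0)
    simpa using mul_ne_zero hne hne'


/-! ### Paths with a saw. -/

/-- Either edge `k` or its parent is a long edge different from edge 0. It contains `y k` and is
disjoint from edge 0, which contains `y 0`. -/
lemma IsTreeIn.attach_ne {q Q L n : ℕ} {S : Set ℕ} {π τ z y : ℕ → ℕ} {ed : ℕ → Set ℕ}
    (ht : IsTreeIn q Q L n S π τ z ed y) (hd : LongDisjoint q (q * L) ed) (hq : 3 ≤ q) {k : ℕ}
    (hk : k ≤ q * L) (h2 : 2 ≤ k) : y k ≠ y 0 := by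
  have h0 := ht.mem_self (k := 0) (by omega)
  intro he
  by_cases hm : k % q = 1
  · have hp : parent q k = k - 1 := by simp [parent, hm]
    have h1 := ht.mem_parent hq hk (by omega)
    rw [hp, he] at h1
    refine Set.disjoint_left.1 (hd (k - 1) (by omega) 0 (by omega) ?_ (by simp) (by omega)) h1 h0
    have hdm := Nat.div_add_mod k q
    rw [hm] at hdm
    rw [← hdm, Nat.add_sub_cancel]
    simp
  · have h1 := ht.mem_self hk
    rw [he] at h1
    exact Set.disjoint_left.1 (hd k hk 0 (by omega) hm (by simp) (by omega)) h1 h0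

/-- The first edge which contains a given vertex outside of the edge `0`. -/
lemma IsTreeIn.exists_first {q Q L n : ℕ} {S : Set ℕ} {π τ z y : ℕ → ℕ} {ed : ℕ → Set ℕ}
    (ht : IsTreeIn q Q L n S π τ z ed y) (hq : 3 ≤ q) (hqQ : q < Q) {w : ℕ}
    (hw : w ∈ verts (q * L) ed) (hw0 : w ∉ ed 0) : ∃ k ≤ q * L, 1 ≤ k ∧ w ∈ ed k ∧
      ∃ s < Q, (w : ℚ) = vert q π τ k s (fun i => (z i : ℚ)) ∧ s ≠ τ k := by
  classical
  have hex : ∃ k, k ≤ q * L ∧ w ∈ ed k := hw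
  obtain ⟨hk, hwk⟩ := Nat.find_spec hex
  set k := Nat.find hex with hkdef
  have h1 : 1 ≤ k := by
    rcases Nat.eq_zero_or_pos k with h | h
    · rw [h] at hwk; exact absurd hwk hw0
    · exact h
  obtain ⟨s, hs, e, hne⟩ := ht.exists_pos hqQ hk hwk
  refine ⟨k, hk, h1, hwk, s, hs, e, hne ?_⟩
  intro hwy
  have h2 := ht.mem_parent hq hk h1
  rw [← hwy] at h2
  have h3 := parent_lt hq h1
  exact Nat.find_min hex h3 ⟨by omega, h2⟩

/-- Here av + (1-a)w and bv' + (1-b)w' are the same point on two teeth, and by `H` their equality is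
an identity of forms. Locate w and w' on the first edges k, k' containing them, where they are not
attachment points. The difference of edge 0 occurs only in v and v', and its coefficient forces a ≠
b, as v ≠ v'. If k ≠ k', the coefficient at the later of the two edges cannot vanish. If k = k',
what remains after the two differences are cancelled is (a-b)(y 0 - y k) = 0, which leaves only k =
1. Finally w = w' would give a = b. -/
lemma mem_edge_one_of_trivial_relation {q Q L n : ℕ} {S : Set ℕ} {π τ z y : ℕ → ℕ} {ed : ℕ → Set ℕ}
    (ht : IsTreeIn q Q L n S π τ z ed y) (hd : LongDisjoint q (q * L) ed) (hq : 3 ≤ q)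
    (hqQ : q < Q) {v v' w w' : ℕ} (hv : v ∈ ed 0)
    (hv' : v' ∈ ed 0) (hvv : v ≠ v')
    (hw : w ∈ verts (q * L) ed) (hw0 : w ∉ ed 0) (hw' : w' ∈ verts (q * L) ed) (hw0' : w' ∉ ed 0)
    {a b : ℚ} (ha : a ≠ 0) (ha1 : 1 - a ≠ 0) (hb1 : 1 - b ≠ 0)
    (hrel : a * v + (1 - a) * w + -b * v' + -(1 - b) * w' = 0)
    (H : ∀ k ≤ q * L, ∀ k' ≤ q * L, ∀ s < Q, ∀ s' < Q, ∀ t < Q, ∀ t' < Q,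
      a * vert q π τ 0 t (fun i => (z i : ℚ)) + (1 - a) * vert q π τ k s (fun i => (z i : ℚ)) +
        -b * vert q π τ 0 t' (fun i => (z i : ℚ)) +
        -(1 - b) * vert q π τ k' s' (fun i => (z i : ℚ)) = 0 →
      ∀ z', a * vert q π τ 0 t z' + (1 - a) * vert q π τ k s z' +
        -b * vert q π τ 0 t' z' + -(1 - b) * vert q π τ k' s' z' = 0) :
    w ∈ ed 1 ∧ w' ∈ ed 1 ∧ w ≠ w' := by
  obtain ⟨t, ht1, et, -⟩ := ht.exists_pos hqQ (by omega) hv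
  obtain ⟨t', ht1', et', -⟩ := ht.exists_pos hqQ (by omega) hv'
  obtain ⟨k, hk, hk1, hwk, s, hs, es, hsτ⟩ := ht.exists_first hq hqQ hw hw0
  obtain ⟨k', hk', hk1', hwk', s', hs', es', hsτ'⟩ := ht.exists_first hq hqQ hw' hw0'
  have hf := H k hk k' hk' s hs s' hs' t ht1 t' ht1' (by
    rw [← et, ← et', ← es, ← es']; exact hrel)
  have e0 := ht.vert_eq (k := 0) (by omega) t
  have e0' := ht.vert_eq (k := 0) (by omega) t'
  rw [← et] at e0
  rw [← et'] at e0'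
  have hS : (s : ℚ) - τ k ≠ 0 := sub_ne_zero.2 (by exact_mod_cast hsτ)
  have hS' : (s' : ℚ) - τ k' ≠ 0 := sub_ne_zero.2 (by exact_mod_cast hsτ')
  have hvan : ∀ k, 1 ≤ k → ∀ s, vert q π τ k s (Pi.single (0 + 1) 1) = 0 := by
    intro k hk s
    rw [vert_congr_of_ne_one hq ht.pi_one (z' := 0) (fun i hi => by simp [hi]) hk, map_zero]
  have h1 := hf (Pi.single (0 + 1) 1)
  rw [vert_single_self hq, vert_single_self hq, hvan k hk1, hvan k' hk1'] at h1
  have hab : a ≠ b := by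
    rintro rfl
    have h2 : a * ((t : ℚ) - t') = 0 := by linarith
    have h3 := sub_eq_zero.1 ((mul_eq_zero.1 h2).resolve_left ha)
    apply hvv
    have h4 : (v : ℚ) = v' := by rw [e0, e0', h3]
    exact_mod_cast h4
  rcases lt_trichotomy k k' with hlt | rfl | hlt
  · have h2 := hf (Pi.single (k' + 1) 1)
    rw [vert_single_self hq, vert_single_of_lt hq _ _ _ (by omega),
      vert_single_of_lt hq _ _ _ (by omega), vert_single_of_lt hq _ _ _ (by omega)] at h2
    have h3 : (1 - b) * ((s' : ℚ) - τ k') = 0 := by linarith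
    exact absurd h3 (mul_ne_zero hb1 hS')
  · have h2 := hf (Pi.single (k + 1) 1)
    rw [vert_single_self hq, vert_single_self hq, vert_single_of_lt hq _ _ _ (by omega),
      vert_single_of_lt hq _ _ _ (by omega)] at h2
    have h2' : (1 - a) * ((s : ℚ) - τ k) = (1 - b) * ((s' : ℚ) - τ k) := by linarith
    have ew := ht.vert_eq hk s
    have ew' := ht.vert_eq hk s'
    rw [← es] at ew
    rw [← es'] at ew'
    rcases hk1.lt_or_eq with h | rfl
    · exfalso
      have h3 : (a - b) * ((y 0 : ℚ) - y k) = 0 := by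
        rw [e0, e0', ew, ew'] at hrel
        linear_combination hrel - z (0 + 1) * h1 - z (k + 1) * h2
      rcases mul_eq_zero.1 h3 with h4 | h4
      · exact hab (sub_eq_zero.1 h4)
      · exact ht.attach_ne hd hq hk h (by exact_mod_cast (sub_eq_zero.1 h4).symm)
    · refine ⟨hwk, hwk', ?_⟩
      rintro rfl
      have hss : s = s' := ht.vert_injective hk (by rw [← es, ← es'])
      subst hss
      apply hab
      have := mul_right_cancel₀ hS h2'
      linarith
  · have h2 := hf (Pi.single (k + 1) 1)
    rw [vert_single_self hq, vert_single_of_lt hq _ _ _ (by omega),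
      vert_single_of_lt hq _ _ _ (by omega), vert_single_of_lt hq _ _ _ (by omega)] at h2
    have h3 : (1 - a) * ((s : ℚ) - τ k) = 0 := by linarith
    exact absurd h3 (mul_ne_zero ha1 hS)

/-- It is rare that a simple path has, for every vertex `v ≠ y 0` of its first edge, a short edge
through `v` and another vertex of the path, such that these edges have many vertices. -/
theorem rare_saw (q Q : ℕ) (hq : 3 ≤ q) (hqQ : q < Q) :
    Rare q Q fun n => {S | ∃ L π τ z ed y, IsTreeIn q Q L n S π τ z ed y ∧
      LongDisjoint q (q * L) ed ∧ ∃ Sw : ℕ → Set ℕ,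
      (∀ v ∈ ed 0 \ {y 0}, Sw v ⊆ S ∧ IsAP q (Sw v) ∧ v ∈ Sw v ∧
        ∃ w ∈ Sw v, w ≠ v ∧ w ∈ verts (q * L) ed) ∧
      (q * L + 2) * (Q * (q - 1)) + 1 ≤
        q * (verts (q * L) ed ∪ ⋃ v ∈ ed 0 \ {y 0}, Sw v).ncard} := by
  let Θ : ℕ → Type := fun L => shapes Q (q * L) × shapes Q (q * L) ×
    (Fin Q → Fin (q * L + 1) × Fin Q × Fin Q × Fin Q)
  let R : ∀ _n L, Θ L → Finset ℕ → (ℕ → ℕ) → Prop := fun n L θ V z =>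
    ∃ S ed y, IsTreeIn q Q L n S θ.1 θ.2.1 z ed y ∧ LongDisjoint q (q * L) ed ∧
      (∃ Sw : Fin Q → Set ℕ, (V : Set ℕ) = verts (q * L) ed ∪ ⋃ t ∈ {t : Fin Q | (t : ℕ) ≠ θ.2.1.1 0}, Sw t ∧
        ∀ t : Fin Q, (t : ℕ) ≠ θ.2.1.1 0 → ∃ a d : ℕ, Sw t = {x | ∃ i < q, x = a + i * d} ∧
          (θ.2.2 t).2.2.1 ≠ (θ.2.2 t).2.2.2 ∧
          vert q θ.1 θ.2.1 0 t (fun i => (z i : ℚ)) = a + ((θ.2.2 t).2.2.1 : ℕ) * d ∧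
          vert q θ.1 θ.2.1 (θ.2.2 t).1 (θ.2.2 t).2.1 (fun i => (z i : ℚ)) =
            a + ((θ.2.2 t).2.2.2 : ℕ) * d) ∧
      (q * L + 2) * (Q * (q - 1)) + 1 ≤ q * V.card
  -- All qL + 2 parameters are kept here. Each tooth is recovered from the positions of two distinct
  -- path vertices on it, so the teeth contribute to the pattern but not to the code.
  refine (rare_of_code q Q hq hqQ (Θ := Θ)
    (Q * Q * (Q * Q * Q) ^ Q) (Q ^ q * Q ^ q * (q + 1) ^ Q) ?_ (fun L _ => Finset.range (q * L + 2))
    (fun L θ => by simp) R ?_ ?_ ?_ ?_).mono ?_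
  · intro L
    have hb := mul_add_one_le_pow q L
    simp only [Θ, Fintype.card_prod, Fintype.card_fun, Fintype.card_fin]
    calc _ ≤ Q ^ (q * L + 1) * (Q ^ (q * L + 1) * ((q + 1) ^ L * (Q * (Q * Q))) ^ Q) := by
          have := card_shapes_le Q (q * L)
          gcongr
      _ = _ := by
          simp only [mul_pow, ← pow_mul, pow_add, pow_one]
          rw [mul_comm L Q]
          ring
  · rintro n L θ V z ⟨S, ed, y, h1, -⟩ i hi
    simp only [Finset.mem_range] at hi
    exact h1.le_of_subset hq hqQ h1.subset_Icc (by omega)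
  · rintro n L θ V z ⟨S, ed, y, h1, -, -, h2⟩
    simpa using h2
  · rintro n L θ V z ⟨S, ed, y, h1, h2, ⟨Sw, h3, -⟩, -⟩
    have h4 := le_ncard_verts hq h1.toIsAPTree h2
    have h5 : (verts (q * L) ed).ncard ≤ V.card := by
      rw [← Set.ncard_coe_finset]
      exact Set.ncard_le_ncard (by rw [h3]; exact Set.subset_union_left) V.finite_toSet
    calc _ = Q * ((q - 1) * L) := by ring
      _ ≤ Q * ((q - 1) * L + 1) := by gcongr; omega
      _ ≤ _ := by omega
  · rintro n L θ V V' z z' ⟨S, ed, y, h1, h2, ⟨Sw, h3, h4⟩, -⟩ ⟨S', ed', y', h1', h2', ⟨Sw', h3', h4'⟩, -⟩ hz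
    have hall : ∀ i ≤ q * L + 1, z i = z' i := fun i hi => hz i (by simp; omega)
    have hvert : ∀ k ≤ q * L, ∀ s, vert q θ.1 θ.2.1 k s (fun i => (z i : ℚ)) =
        vert q θ.1 θ.2.1 k s (fun i => (z' i : ℚ)) := fun k hk s =>
      vert_congr hq _ _ _ _ fun i hi => by rw [hall i (by omega)]
    have hV : verts (q * L) ed = verts (q * L) ed' := by
      ext x
      simp only [verts, Set.mem_ofPred_eq]
      refine exists_congr fun k => and_congr_right fun hk => ?_
      rw [h1.edge_eq h1'.toIsAPTree hq hall hk]
    have hSw : ∀ t : Fin Q, (t : ℕ) ≠ θ.2.1.1 0 → Sw t = Sw' t := by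
      intro t htne
      obtain ⟨a, d, e1, e2, e3, e4⟩ := h4 t htne
      obtain ⟨a', d', e1', e2', e3', e4'⟩ := h4' t htne
      rw [hvert _ (by omega)] at e3
      rw [hvert _ (by have := (θ.2.2 t).1.2; omega)] at e4
      rw [e3] at e3'
      rw [e4] at e4'
      have h5 : (((θ.2.2 t).2.2.1 : ℕ) : ℚ) - ((θ.2.2 t).2.2.2 : ℕ) ≠ 0 := by
        intro h0
        exact e2 (Fin.ext (by exact_mod_cast sub_eq_zero.1 h0))
      have h6 : ((((θ.2.2 t).2.2.1 : ℕ) : ℚ) - ((θ.2.2 t).2.2.2 : ℕ)) * d =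
          ((((θ.2.2 t).2.2.1 : ℕ) : ℚ) - ((θ.2.2 t).2.2.2 : ℕ)) * d' := by linarith
      have h7 := mul_left_cancel₀ h5 h6
      have h8 : (a : ℚ) = a' := by rw [h7] at e3'; linarith
      have h7' : d = d' := by exact_mod_cast h7
      have h8' : a = a' := by exact_mod_cast h8
      rw [e1, e1', h7', h8']
    apply Finset.coe_injective
    rw [h3, h3', hV]
    congr 1
    exact Set.iUnion₂_congr hSw
  · rintro n S ⟨L, π, τ, z, ed, y, h1, h2, Sw, h3, h4⟩
    obtain ⟨f, hf1, hf2, hf3⟩ := h1.edge_eq_image (k := 0) (by omega)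
    have hQ0 : edgeLen q Q 0 = Q := edgeLen_long (by simp)
    rw [hQ0] at hf1 hf2 hf3
    have hτ0 : τ 0 < Q := by have := h1.tau_lt 0 (by omega); rwa [hQ0] at this
    have hfτ : f (τ 0) = y 0 := by
      have := hf3 (τ 0) hτ0
      rw [h1.vert_eq (by omega), sub_self, zero_mul, add_zero] at this
      exact_mod_cast this
    have hft : ∀ t : Fin Q, (t : ℕ) ≠ τ 0 → f t ∈ ed 0 \ {y 0} := by
      intro t htne
      refine ⟨by rw [hf2]; exact ⟨t, t.2, rfl⟩, fun h => htne (hf1 t.2 hτ0 ?_)⟩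
      rw [hfτ]; exact h
    have hun : (⋃ v ∈ ed 0 \ {y 0}, Sw v) = ⋃ t ∈ {t : Fin Q | (t : ℕ) ≠ τ 0}, Sw (f t) := by
      ext x
      simp only [Set.mem_iUnion, exists_prop]
      constructor
      · rintro ⟨v, ⟨hv, hvy⟩, hx⟩
        rw [hf2] at hv
        obtain ⟨t, htQ, rfl⟩ := hv
        refine ⟨⟨t, htQ⟩, fun h => hvy ?_, hx⟩
        simp only at h
        rw [h, hfτ]; rfl
      · rintro ⟨t, htne, hx⟩
        exact ⟨f t, hft t htne, hx⟩
    have hpat : ∀ t : Fin Q, ∃ ψ : Fin (q * L + 1) × Fin Q × Fin Q × Fin Q, (t : ℕ) ≠ τ 0 →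
        ∃ a d : ℕ, Sw (f t) = {x | ∃ i < q, x = a + i * d} ∧ ψ.2.2.1 ≠ ψ.2.2.2 ∧
          vert q π τ 0 t (fun i => (z i : ℚ)) = a + (ψ.2.2.1 : ℕ) * d ∧
          vert q π τ ψ.1 ψ.2.1 (fun i => (z i : ℚ)) = a + (ψ.2.2.2 : ℕ) * d := by
      intro t
      by_cases htne : (t : ℕ) ≠ τ 0
      · obtain ⟨-, ⟨a, d, hd, e⟩, hv, w, hw, hwv, k, hk, hwk⟩ := h3 _ (hft t htne)
        obtain ⟨s, hs, es, -⟩ := h1.exists_pos hqQ hk hwk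
        have hv' := hv
        have hw' := hw
        rw [e] at hv' hw'
        obtain ⟨i, hi, ei⟩ := hv'
        obtain ⟨j, hj, ej⟩ := hw'
        refine ⟨(⟨k, by omega⟩, ⟨s, hs⟩, ⟨i, by omega⟩, ⟨j, by omega⟩), fun _ => ⟨a, d, e, ?_, ?_, ?_⟩⟩
        · intro hij
          have : i = j := congrArg Fin.val hij
          rw [ej, ei, this] at hwv
          exact hwv rfl
        · rw [← hf3 t t.2]; exact_mod_cast ei
        · simp only
          rw [← es]; exact_mod_cast ej
      · exact ⟨(⟨0, by omega⟩, ⟨0, by omega⟩, ⟨0, by omega⟩, ⟨0, by omega⟩), fun h => absurd h htne⟩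
    choose ψ hψ using hpat
    have hfin : (verts (q * L) ed ∪ ⋃ v ∈ ed 0 \ {y 0}, Sw v).Finite :=
      Set.finite_of_ncard_pos (by
        rcases Nat.eq_zero_or_pos (verts (q * L) ed ∪ ⋃ v ∈ ed 0 \ {y 0}, Sw v).ncard with h | h
        · rw [h] at h4; omega
        · exact h)
    refine ⟨L, (⟨π, h1.pi_mem⟩, ⟨τ, h1.tau_mem⟩, ψ), hfin.toFinset, z, ⟨S, ed, y, h1, h2,
      ⟨fun t => Sw (f t), ?_, hψ⟩, ?_⟩, ?_⟩
    · rw [Set.Finite.coe_toFinset, hun]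
    · rwa [← Set.ncard_eq_toFinset_card _ hfin]
    · rw [Set.Finite.coe_toFinset]
      refine Set.union_subset ?_ (Set.iUnion₂_subset fun v hv => (h3 v hv).1)
      rintro x ⟨k, hk, hxk⟩
      exact h1.subset_set k hk hxk


/-- A point of a progression as an affine combination of two others. -/
lemma IsAP.affine_combination {r : ℕ} {F : Set ℕ} (h : IsAP r F) {v w u : ℕ} (hv : v ∈ F)
    (hw : w ∈ F) (hu : u ∈ F) (hvw : v ≠ w) : ∃ i < r, ∃ j < r, ∃ l < r, ∃ a : ℚ,
    a = ((l : ℚ) - j) / ((i : ℚ) - j) ∧ (u : ℚ) = a * v + (1 - a) * w := by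
  obtain ⟨b, d, pos, hd, hpos⟩ := h.exists_pos
  refine ⟨pos v, (hpos v hv).1, pos w, (hpos w hw).1, pos u, (hpos u hu).1, _, rfl, ?_⟩
  have e1 : (v : ℚ) = b + pos v * d := by exact_mod_cast (hpos v hv).2
  have e2 : (w : ℚ) = b + pos w * d := by exact_mod_cast (hpos w hw).2
  have e3 : (u : ℚ) = b + pos u * d := by exact_mod_cast (hpos u hu).2
  have hne : (pos v : ℚ) - pos w ≠ 0 := by
    intro h0
    have h1 : pos v = pos w := by exact_mod_cast sub_eq_zero.1 h0
    exact hvw (by rw [(hpos v hv).2, (hpos w hw).2, h1])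
  rw [e1, e2, e3]
  field_simp
  ring

/-- If two teeth sharing a new vertex give a nontrivial relation, `rare_relation` applies. Otherwise
the teeth through a common new vertex, if there are several, have distinct second ends on the first
short edge minus `y 0`. There are thus at most q-1 of them, and the new vertices are numerous enough
for `rare_saw`. -/
theorem rare_isPathWithSaw (q Q : ℕ) (hq : 3 ≤ q) (hqQ : q < Q) :
    Rare q Q (occurs q Q (IsPathWithSaw Q q)) := by
  let lam : (Fin 6 → Fin Q) → ℚ := fun ρ => ((ρ 2 : ℚ) - ρ 1) / ((ρ 0 : ℚ) - ρ 1)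
  let lam' : (Fin 6 → Fin Q) → ℚ := fun ρ => ((ρ 5 : ℚ) - ρ 4) / ((ρ 3 : ℚ) - ρ 4)
  refine ((rare_relation q Q hq hqQ (P := Fin 6 → Fin Q) 4 (fun ρ =>
    ![lam ρ, 1 - lam ρ, -lam' ρ, -(1 - lam' ρ)])).union (rare_saw q Q hq hqQ)).mono ?_
  rintro n S ⟨B, ⟨-, L, E, C, Sw, hP, hsaw, rfl⟩, -, hsub⟩
  have hch := hP.isCoveredChain
  have hedge : ∀ e ∈ pathEdges q L E C ∪ Sw '' (C 1 1 \ E 1), e ⊆ S ∧ e ⊆ Set.Icc 1 n ∧ IsAP e.ncard e :=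
    fun e he => mem_induce_apHypergraph (hsub he)
  obtain ⟨π, τ, z, y, ht, h01, hinter, -⟩ := hch.exists_isTreeIn hq hqQ
    (fun e he => hedge e (Or.inl he))
  have hL := hP.one_le
  have hm : 1 ≤ q * L := Nat.mul_pos (by omega) hL
  have hd := hP.longDisjoint hq
  have hle := le_ncard_verts hq ht.toIsAPTree hd
  have hvfin := ht.verts_finite
  rw [← hch.verts_eq hq] at hsaw
  have h0 : C 1 1 = edgeSeq q E C 0 := (edgeSeq_zero E C).symm
  have h1 : E 1 = edgeSeq q E C 1 := by simpa using (edgeSeq_short hq E C 0).symm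
  have hdiff : C 1 1 \ E 1 = edgeSeq q E C 0 \ {y 0} := by
    have := hinter 1 hm le_rfl
    rw [parent_one hq, ← h01] at this
    rw [h0, h1, ← this, Set.sdiff_inter_self_eq_sdiff]
  rw [hdiff] at hsaw hedge
  rw [h0] at hsaw
  set ed := edgeSeq q E C with hed
  have hv0 : ∀ v ∈ ed 0, v ∈ verts (q * L) ed := fun v hv => ⟨0, by omega, hv⟩
  have hSw : ∀ v ∈ ed 0 \ {y 0}, Sw v ⊆ S ∧ IsAP q (Sw v) ∧ v ∈ Sw v := by
    intro v hv
    have h2 := hedge (Sw v) (Or.inr ⟨v, hv, rfl⟩)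
    refine ⟨h2.1, ?_, ?_⟩
    · have := h2.2.2
      rwa [(hsaw v hv).1] at this
    · have : v ∈ Sw v ∩ ed 0 := by rw [(hsaw v hv).2.1]; rfl
      exact this.1
  have hw : ∀ v ∈ ed 0 \ {y 0}, ∃ w ∈ Sw v, w ≠ v ∧ w ∈ verts (q * L) ed := by
    intro v hv
    have h3 : 1 < (Sw v ∩ verts (q * L) ed).ncard := by rw [(hsaw v hv).2.2]; omega
    obtain ⟨w, ⟨hw1, hw2⟩, hw3⟩ := Set.exists_ne_of_one_lt_ncard h3 v
    exact ⟨w, hw1, hw3, hw2⟩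
  by_cases hlin : ∃ (ρ : Fin 6 → Fin Q) (k s : Fin 4 → ℕ), (∀ i, k i ≤ q * L) ∧
      (∀ i, s i < Q) ∧ ∑ i, (![lam ρ, 1 - lam ρ, -lam' ρ, -(1 - lam' ρ)] : Fin 4 → ℚ) i *
        vert q π τ (k i) (s i) (fun j => (z j : ℚ)) = 0 ∧
      ∃ z' : ℕ → ℚ, ∑ i, (![lam ρ, 1 - lam ρ, -lam' ρ, -(1 - lam' ρ)] : Fin 4 → ℚ) i *
        vert q π τ (k i) (s i) z' ≠ 0
  · exact Or.inl ⟨L, π, τ, z, ed, y, ht, hd, hlin⟩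
  refine Or.inr ⟨L, π, τ, z, ed, y, ht, hd, Sw,
    fun v hv => ⟨(hSw v hv).1, (hSw v hv).2.1, (hSw v hv).2.2, hw v hv⟩, ?_⟩
  push Not at hlin
  choose! w hw1 hw2 hw3 using hw
  have hw0 : ∀ v ∈ ed 0 \ {y 0}, w v ∉ ed 0 := by
    intro v hv hwv
    have : w v ∈ Sw v ∩ ed 0 := ⟨hw1 v hv, hwv⟩
    rw [(hsaw v hv).2.1] at this
    exact hw2 v hv this
  have hpair : ∀ v ∈ ed 0 \ {y 0}, ∀ v' ∈ ed 0 \ {y 0}, v ≠ v' → ∀ u ∉ verts (q * L) ed,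
      u ∈ Sw v → u ∈ Sw v' → w v ∈ ed 1 ∧ w v' ∈ ed 1 ∧ w v ≠ w v' := by
    intro v hv v' hv' hvv u hu huv huv'
    have huw : ∀ x ∈ verts (q * L) ed, (u : ℚ) ≠ x := by
      intro x hx he
      have : u = x := by exact_mod_cast he
      exact hu (this ▸ hx)
    obtain ⟨i, hi, j, hj, l, hl, a, ha, hua⟩ := (hSw v hv).2.1.affine_combination (hSw v hv).2.2
      (hw1 v hv) huv (hw2 v hv).symm
    obtain ⟨i', hi', j', hj', l', hl', b, hb, hub⟩ := (hSw v' hv').2.1.affine_combination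
      (hSw v' hv').2.2 (hw1 v' hv') huv' (hw2 v' hv').symm
    refine mem_edge_one_of_trivial_relation ht hd hq hqQ hv.1 hv'.1 hvv (hw3 v hv) (hw0 v hv)
      (hw3 v' hv') (hw0 v' hv') (a := a) (b := b) ?_ ?_ ?_ (by linarith) ?_
    · rintro rfl
      exact huw _ (hw3 v hv) (by rw [hua]; ring)
    · intro h
      have : a = 1 := by linarith
      exact huw _ (hv0 v hv.1) (by rw [hua, this]; ring)
    · intro h
      have : b = 1 := by linarith
      exact huw _ (hv0 v' hv'.1) (by rw [hub, this]; ring)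
    · intro k hk k' hk' s hs s' hs' t ht t' ht' hz z'
      have := hlin ![⟨i, by omega⟩, ⟨j, by omega⟩, ⟨l, by omega⟩, ⟨i', by omega⟩, ⟨j', by omega⟩,
        ⟨l', by omega⟩] ![0, k, 0, k'] ![t, s, t', s'] (by intro i; fin_cases i <;> simp [hk, hk'])
        (by intro i; fin_cases i <;> simpa) (by
          simp only [lam, lam', Fin.sum_univ_four, Matrix.cons_val]
          rw [← ha, ← hb]; exact hz) z'
      simp only [lam, lam', Fin.sum_univ_four, Matrix.cons_val] at this
      rw [← ha, ← hb] at this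
      exact this
  classical
  have hed0 : (ed 0).Finite := ht.edge_finite (by omega)
  have hed1 : (ed 1).Finite := ht.edge_finite hm
  have hSwfin : ∀ v ∈ ed 0 \ {y 0}, (Sw v).Finite := fun v hv =>
    (hSw v hv).2.1.finite (by omega)
  have hVfin : (ed 0 \ {y 0}).Finite := hed0.subset Set.sdiff_subset
  set X := ⋃ v ∈ ed 0 \ {y 0}, Sw v with hX
  have hXfin : X.Finite := hVfin.biUnion hSwfin
  have hUfin : (X \ verts (q * L) ed).Finite := hXfin.subset Set.sdiff_subset
  -- Double counting of incidences: there are Q-1 teeth with q-2 new vertices each, and every new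
  -- vertex lies on at most q-1 teeth.
  have hcount : (Q - 1) * (q - 2) ≤ (X \ verts (q * L) ed).ncard * (q - 1) := by
    have h5 := Finset.card_mul_le_card_mul (s := hVfin.toFinset) (t := hUfin.toFinset)
      (fun v u => u ∈ Sw v) (m := q - 2) (n := q - 1) ?_ ?_
    · rwa [← Set.ncard_eq_toFinset_card _ hVfin, ← Set.ncard_eq_toFinset_card _ hUfin,
        Set.ncard_sdiff_singleton_of_mem (ht.mem_self (by omega)), ht.edge_ncard (by omega),
        edgeLen_long (by simp)] at h5
    · intro v hv
      rw [Set.Finite.mem_toFinset] at hv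
      have h6 : ((Sw v \ verts (q * L) ed)).ncard = q - 2 := by
        have := Set.ncard_inter_add_ncard_sdiff_eq_ncard (Sw v) (verts (q * L) ed) (hSwfin v hv)
        rw [(hsaw v hv).2.2, (hsaw v hv).1] at this
        omega
      rw [← h6, ← Set.ncard_coe_finset]
      apply Set.ncard_le_ncard _ (Finset.finite_toSet _)
      rintro u ⟨hu1, hu2⟩
      simp only [Finset.coe_bipartiteAbove, Set.Finite.mem_toFinset, Set.mem_ofPred_eq]
      exact ⟨⟨Set.mem_biUnion hv hu1, hu2⟩, hu1⟩
    · intro u hu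
      rw [Set.Finite.mem_toFinset] at hu
      rcases Nat.lt_or_ge 1 (Finset.bipartiteBelow (fun v u => u ∈ Sw v) hVfin.toFinset u).card
        with hlt | hle1
      · have h7 : ∀ v ∈ Finset.bipartiteBelow (fun v u => u ∈ Sw v) hVfin.toFinset u,
            v ∈ ed 0 \ {y 0} ∧ u ∈ Sw v := by
          intro v hv
          simpa [Finset.bipartiteBelow] using hv
        have h8 : (hed1.toFinset.erase (y 0)).card = q - 1 := by
          rw [Finset.card_erase_of_mem, ← Set.ncard_eq_toFinset_card _ hed1, ht.edge_ncard hm,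
            edgeLen_short (Nat.mod_eq_of_lt (by omega))]
          rw [Set.Finite.mem_toFinset, h01]; exact ht.mem_self hm
        rw [← h8]
        apply Finset.card_le_card_of_injOn w
        · intro v hv
          obtain ⟨v', hv', hne⟩ := Finset.exists_mem_ne hlt v
          have h9 := hpair v (h7 v hv).1 v' (h7 v' hv').1 hne.symm u hu.2 (h7 v hv).2 (h7 v' hv').2
          simp only [Finset.coe_erase, Set.Finite.coe_toFinset]
          refine ⟨h9.1, ?_⟩
          intro he
          exact hw0 v (h7 v hv).1 (by rw [he]; exact ht.mem_self (by omega))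
        · intro v hv v' hv' he
          by_contra hne
          exact (hpair v (h7 v hv).1 v' (h7 v' hv').1 hne u hu.2 (h7 v hv).2 (h7 v' hv').2).2.2 he
      · omega
  have hcard : (verts (q * L) ed ∪ X).ncard = (verts (q * L) ed).ncard +
      (X \ verts (q * L) ed).ncard := by
    rw [← Set.union_sdiff_self, Set.ncard_union_eq Set.disjoint_sdiff_right hvfin hUfin]
  rw [hcard]
  set N := (X \ verts (q * L) ed).ncard
  obtain ⟨t, rfl⟩ : ∃ t, q = t + 3 := ⟨q - 3, by omega⟩
  obtain ⟨r, rfl⟩ : ∃ r, Q = r + 1 := ⟨Q - 1, by omega⟩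
  simp only [Nat.add_sub_cancel, show t + 3 - 1 = t + 2 by omega, show t + 3 - 2 = t + 1 by omega] at *
  -- In the original notation this is Q(q-2) + 1 ≤ qN, which is exactly what the path lacks: 2Q(q-1)
  -- + 1 against qQ. If it failed, double counting would give q(Q-1) ≤ Q(q-1), that is Q ≤ q.
  have hN : (r + 1) * (t + 1) + 1 ≤ (t + 3) * N := by
    by_contra! hcon
    have h10 : (t + 3) * N ≤ (r + 1) * (t + 1) := by omega
    have h11 : (t + 3) * (r * (t + 1)) ≤ (t + 3) * (N * (t + 2)) := Nat.mul_le_mul_left _ hcount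
    have h12 : (t + 3) * N * (t + 2) ≤ (r + 1) * (t + 1) * (t + 2) := Nat.mul_le_mul_right _ h10
    nlinarith
  calc _ = (t + 3) * ((r + 1) * ((t + 2) * L + 1)) + ((r + 1) * (t + 1) + 1) := by ring
    _ ≤ (t + 3) * (verts ((t + 3) * L) ed).ncard + (t + 3) * N := by gcongr
    _ = _ := by ring


/-! ### Paths with a spoiled extension. -/

/-- The free parameters of a path of length `L`, if the last but one short edge is not free when
`b ≠ 0`, and the edges with number `j ∈ J` in the last cover are not free. -/
def freeParams (q L : ℕ) (J : Finset ℕ) (b : ℕ) : Finset ℕ :=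
  Finset.range (q * L + 2) \
    (J.image (fun j => q * (L - 1) + j + 1) ∪ if b = 0 then ∅ else {q * (L - 1) + 2})

lemma card_freeParams {q L : ℕ} (hL : 1 ≤ L) {J : Finset ℕ} (hq : 3 ≤ q)
    (hJ : ∀ j ∈ J, 2 ≤ j ∧ j ≤ q) (b : ℕ) :
    (freeParams q L J b).card + J.card + (if b = 0 then 0 else 1) = q * L + 2 := by
  have hqL : q * L = q * (L - 1) + q := by
    obtain ⟨l, rfl⟩ : ∃ l, L = l + 1 := ⟨L - 1, by omega⟩
    rw [Nat.add_sub_cancel]; ring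
  unfold freeParams
  rw [Finset.card_sdiff_of_subset, Finset.card_union_of_disjoint, Finset.card_image_of_injective,
    Finset.card_range]
  · have h1 : J.card ≤ q - 1 := by
      have : J ⊆ Finset.Icc 2 q := fun j hj => Finset.mem_Icc.2 (hJ j hj)
      have := Finset.card_le_card this
      rw [Nat.card_Icc] at this
      omega
    split_ifs <;> simp <;> omega
  · intro i j hij; simpa using hij
  · split_ifs
    · simp
    · rw [Finset.disjoint_singleton_right, Finset.mem_image]
      rintro ⟨j, hj, e⟩
      have := hJ j hj
      omega
  · intro i hi
    rw [Finset.mem_union, Finset.mem_image] at hi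
    rw [Finset.mem_range]
    rcases hi with ⟨j, hj, rfl⟩ | hi
    · have := hJ j hj; omega
    · split_ifs at hi
      · simp at hi
      · rw [Finset.mem_singleton] at hi; omega

lemma mem_freeParams {q L : ℕ} {J : Finset ℕ} {b i : ℕ} : i ∈ freeParams q L J b ↔
    i < q * L + 2 ∧ (∀ j ∈ J, q * (L - 1) + j + 1 ≠ i) ∧ (b = 0 ∨ i ≠ q * (L - 1) + 2) := by
  unfold freeParams
  rw [Finset.mem_sdiff, Finset.mem_union, Finset.mem_range, Finset.mem_image]
  split_ifs with h <;> simp [h]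

/-- For j in `J`, edge qL+j meets the old path in a point other than its attachment point, so its
difference follows from the old path and the new short edge. Edge `b`, when present (b ≠ 0), meets
the old path twice, is thereby determined by it, and in turn determines the difference of the short
edge. The new long edges need not be disjoint from the path, so the vertex count is a hypothesis. -/
theorem rare_extension (q Q : ℕ) (hq : 3 ≤ q) (hqQ : q < Q) :
    Rare q Q fun n => {S | ∃ L π τ z ed y, IsTreeIn q Q (L + 1) n S π τ z ed y ∧
      ∃ (J : Finset ℕ) (b : ℕ), (∀ j ∈ J, 2 ≤ j ∧ j ≤ q) ∧
      (∀ j ∈ J, ∃ x ∈ ed (q * L + j), x ≠ y (q * L + j) ∧ x ∈ verts (q * L) ed) ∧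
      (b ≠ 0 → b ∈ J ∧ y (q * L + b) ≠ y (q * L + 1) ∧ ∃ x ∈ ed (q * L + b),
        ∃ x' ∈ ed (q * L + b), x ≠ y (q * L + b) ∧ x ≠ x' ∧
        x ∈ verts (q * L) ed ∧ x' ∈ verts (q * L) ed) ∧
      (freeParams q (L + 1) J b).card * (Q * (q - 1)) + 1 ≤ q * (verts (q * (L + 1)) ed).ncard ∧
      Q * (q - 1) * L ≤ (verts (q * (L + 1)) ed).ncard} := by
  let Θ : ℕ → Type := fun L => shapes Q (q * L) × shapes Q (q * L) × Finset (Fin (q + 1)) ×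
    Fin (q + 1) × (Fin (q + 1) → Fin Q × Fin (q * L + 1) × Fin Q) ×
    (Fin Q × Fin (q * L + 1) × Fin Q)
  let J : ∀ L, Θ L → Finset ℕ := fun L θ => θ.2.2.1.map Fin.valEmbedding
  let R : ∀ _n L, Θ L → Finset ℕ → (ℕ → ℕ) → Prop := fun n L θ V z =>
    ∃ S ed y, IsTreeIn q Q L n S θ.1 θ.2.1 z ed y ∧ (V : Set ℕ) = verts (q * L) ed ∧
      (∀ j ∈ J L θ, 2 ≤ j ∧ j ≤ q) ∧
      (∀ j ∈ θ.2.2.1, ((θ.2.2.2.2.1 j).1 : ℕ) ≠ θ.2.1.1 (q * (L - 1) + j) ∧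
        ((θ.2.2.2.2.1 j).2.1 : ℕ) ≤ q * (L - 1) ∧
        vert q θ.1 θ.2.1 (q * (L - 1) + j) (θ.2.2.2.2.1 j).1 (fun i => (z i : ℚ)) =
        vert q θ.1 θ.2.1 (θ.2.2.2.2.1 j).2.1 (θ.2.2.2.2.1 j).2.2 (fun i => (z i : ℚ))) ∧
      ((θ.2.2.2.1 : ℕ) ≠ 0 → θ.2.2.2.1 ∈ θ.2.2.1 ∧
        θ.1.1 (q * (L - 1) + θ.2.2.2.1) ≠ θ.2.1.1 (q * (L - 1) + 1) ∧
        θ.2.2.2.2.2.1 ≠ (θ.2.2.2.2.1 θ.2.2.2.1).1 ∧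
        (θ.2.2.2.2.2.2.1 : ℕ) ≤ q * (L - 1) ∧
        vert q θ.1 θ.2.1 (q * (L - 1) + θ.2.2.2.1) θ.2.2.2.2.2.1 (fun i => (z i : ℚ)) =
        vert q θ.1 θ.2.1 θ.2.2.2.2.2.2.1 θ.2.2.2.2.2.2.2 (fun i => (z i : ℚ))) ∧
      (freeParams q L (J L θ) θ.2.2.2.1).card * (Q * (q - 1)) + 1 ≤ q * V.card ∧
      Q * (q - 1) * L ≤ V.card + Q * (q - 1)
  refine (rare_of_code q Q hq hqQ (Θ := Θ)
    (Q * Q * 2 ^ (q + 1) * (q + 1) * (Q * Q) ^ (q + 1) * (Q * Q))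
    (Q ^ q * Q ^ q * (q + 1) ^ (q + 1) * (q + 1)) ?_
    (fun L θ => freeParams q L (J L θ) θ.2.2.2.1)
    (fun L θ => ?_) R ?_ ?_ ?_ ?_).mono ?_
  · intro L
    have hb := mul_add_one_le_pow q L
    simp only [Θ, Fintype.card_prod, Fintype.card_fun, Fintype.card_fin, Fintype.card_finset]
    calc _ ≤ Q ^ (q * L + 1) * (Q ^ (q * L + 1) * (2 ^ (q + 1) * ((q + 1) *
          ((Q * ((q + 1) ^ L * Q)) ^ (q + 1) * (Q * ((q + 1) ^ L * Q)))))) := by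
          have := card_shapes_le Q (q * L)
          gcongr
      _ = _ := by
          have e : ((q + 1) ^ (q + 1)) ^ L = ((q + 1) ^ L) ^ (q + 1) := by
            rw [← pow_mul, ← pow_mul, mul_comm]
          rw [mul_pow (Q ^ q * Q ^ q * (q + 1) ^ (q + 1)), mul_pow (Q ^ q * Q ^ q),
            mul_pow (Q ^ q) (Q ^ q), e, ← pow_mul Q q L, pow_succ Q (q * L), mul_pow, mul_pow,
            mul_pow]
          generalize (q + 1) ^ L = X
          ring
  · exact (Finset.card_le_card Finset.sdiff_subset).trans (by simp)
  · rintro n L θ V z ⟨S, ed, y, h1, -⟩ i hi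
    rw [mem_freeParams] at hi
    exact h1.le_of_subset hq hqQ h1.subset_Icc (by omega)
  · rintro n L θ V z ⟨S, ed, y, -, -, -, -, -, h, -⟩
    exact h
  · rintro n L θ V z ⟨S, ed, y, -, -, -, -, -, -, h⟩
    exact h
  · rintro n L θ V V' z z' ⟨S, ed, y, h1, h2, h3, h4, h5, -⟩ ⟨S', ed', y', h1', h2', -, h4', h5', -⟩ hz
    have hL := h1.one_le
    have hqL : q * L = q * (L - 1) + q := by
      obtain ⟨l, rfl⟩ : ∃ l, L = l + 1 := ⟨L - 1, by omega⟩
      rw [Nat.add_sub_cancel]; ring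
    have hJ : ∀ j, j ∈ J L θ ↔ ∃ j' ∈ θ.2.2.1, (j' : ℕ) = j := by
      intro j; simp [J]
    generalize hM : q * (L - 1) = M at *
    have hlow : ∀ i ≤ M + 1, z i = z' i := by
      intro i hi
      apply hz
      rw [mem_freeParams, hM]
      exact ⟨by omega, fun j hj => by have := h3 j hj; omega, by omega⟩
    have hvert : ∀ k ≤ M, ∀ s, vert q θ.1 θ.2.1 k s (fun i => (z i : ℚ)) =
        vert q θ.1 θ.2.1 k s (fun i => (z' i : ℚ)) := fun k hk s =>
      vert_congr hq _ _ _ _ fun i hi => by rw [hlow i (by omega)]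
    have hbase : base q θ.1 θ.2.1 (M + 1) (fun i => (z i : ℚ)) =
        base q θ.1 θ.2.1 (M + 1) (fun i => (z' i : ℚ)) :=
      base_congr hq _ _ _ fun i hi => by rw [hlow i hi]
    have hpar : ∀ j, 2 ≤ j → j ≤ q → ∀ w : ℕ → ℚ, base q θ.1 θ.2.1 (M + j) w =
        base q θ.1 θ.2.1 (M + 1) w + ((θ.1.1 (M + j) : ℚ) - θ.2.1.1 (M + 1)) * w (M + 2) := by
      intro j hj2 hjq w
      rw [base_eq_vert hq _ _ (by omega), ← hM, parent_long hq hj2 hjq, vert_apply]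
    -- For b ≠ 0, subtracting the two coincidences on edge `b` isolates its difference. Substituting
    -- this into one of them isolates the difference of the short edge, whose coefficient is nonzero
    -- because edge `b` and the old path are attached to it in different points.
    have hF : z (M + 2) = z' (M + 2) := by
      by_cases hb : (θ.2.2.2.1 : ℕ) = 0
      · apply hz
        rw [mem_freeParams, hM]
        exact ⟨by omega, fun j hj => by have := h3 j hj; omega, Or.inl hb⟩
      · obtain ⟨e1, e2, e3, e4, e5⟩ := h5 hb
        obtain ⟨-, -, -, -, e5'⟩ := h5' hb
        obtain ⟨e6, e7, e8⟩ := h4 _ e1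
        obtain ⟨-, -, e8'⟩ := h4' _ e1
        have hbJ := h3 _ ((hJ _).2 ⟨_, e1, rfl⟩)
        rw [hvert _ e4, ← e5', vert_apply, vert_apply] at e5
        rw [hvert _ e7, ← e8', vert_apply, vert_apply] at e8
        have hne : ((θ.2.2.2.2.2.1 : ℕ) : ℚ) - ((θ.2.2.2.2.1 θ.2.2.2.1).1 : ℕ) ≠ 0 := by
          intro h0
          exact e3 (Fin.ext (by exact_mod_cast sub_eq_zero.1 h0))
        have hd : (z (M + θ.2.2.2.1 + 1) : ℚ) = z' (M + θ.2.2.2.1 + 1) :=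
          mul_left_cancel₀ hne (by linear_combination e5 - e8)
        rw [hd, hpar _ hbJ.1 hbJ.2, hpar _ hbJ.1 hbJ.2, hbase] at e8
        have hne' : (θ.1.1 (M + θ.2.2.2.1) : ℚ) - θ.2.1.1 (M + 1) ≠ 0 := by
          intro h0
          exact e2 (by exact_mod_cast sub_eq_zero.1 h0)
        have : (z (M + 2) : ℚ) = z' (M + 2) :=
          mul_left_cancel₀ hne' (by linear_combination e8)
        exact_mod_cast this
    have hall : ∀ i ≤ q * L + 1, z i = z' i := by
      intro i hi
      rcases Nat.lt_or_ge (M + 2) i with hlt | hge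
      · by_cases hiJ : ∃ j ∈ θ.2.2.1, M + (j : ℕ) + 1 = i
        · obtain ⟨j, hj, rfl⟩ := hiJ
          obtain ⟨e6, e7, e8⟩ := h4 _ hj
          obtain ⟨-, -, e8'⟩ := h4' _ hj
          have hbJ := h3 _ ((hJ _).2 ⟨_, hj, rfl⟩)
          rw [hvert _ e7, ← e8', vert_apply, vert_apply, hpar _ hbJ.1 hbJ.2, hpar _ hbJ.1 hbJ.2,
            hbase, hF] at e8
          have hne : (((θ.2.2.2.2.1 j).1 : ℕ) : ℚ) - θ.2.1.1 (M + j) ≠ 0 := by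
            intro h0
            exact e6 (by exact_mod_cast sub_eq_zero.1 h0)
          have : (z (M + j + 1) : ℚ) = z' (M + j + 1) :=
            mul_left_cancel₀ hne (by linear_combination e8)
          exact_mod_cast this
        · apply hz
          rw [mem_freeParams, hM]
          refine ⟨by omega, fun j hj he => hiJ ?_, Or.inr (by omega)⟩
          obtain ⟨j', hj', rfl⟩ := (hJ _).1 hj
          exact ⟨j', hj', he⟩
      · rcases hge.lt_or_eq with h | rfl
        · exact hlow i (by omega)
        · exact hF
    apply Finset.coe_injective
    rw [h2, h2']
    ext x
    simp only [verts, Set.mem_ofPred_eq]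
    refine exists_congr fun k => and_congr_right fun hk => ?_
    rw [h1.edge_eq h1'.toIsAPTree hq hall hk]
  · rintro n S ⟨L, π, τ, z, ed, y, h1, J', b, h2, h3, h4, h5, h6⟩
    have hfin := h1.verts_finite
    have hqL : q * (L + 1) = q * L + q := by ring
    have hrep : ∀ x ∈ verts (q * L) ed, ∃ k ≤ q * L, ∃ s < Q,
        (x : ℚ) = vert q π τ k s (fun i => (z i : ℚ)) := by
      rintro x ⟨k, hk, hx⟩
      obtain ⟨s, hs, e, -⟩ := h1.exists_pos hqQ (by omega) hx
      exact ⟨k, hk, s, hs, e⟩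
    have hg : ∀ j : Fin (q + 1), ∃ g : Fin Q × Fin (q * (L + 1) + 1) × Fin Q, (j : ℕ) ∈ J' →
        ((g.1 : ℕ) ≠ τ (q * L + j) ∧ (g.2.1 : ℕ) ≤ q * L ∧
        vert q π τ (q * L + j) g.1 (fun i => (z i : ℚ)) =
          vert q π τ g.2.1 g.2.2 (fun i => (z i : ℚ))) ∧
        (b = j → ∃ g' : Fin Q × Fin (q * (L + 1) + 1) × Fin Q, g'.1 ≠ g.1 ∧ (g'.2.1 : ℕ) ≤ q * L ∧
        vert q π τ (q * L + j) g'.1 (fun i => (z i : ℚ)) =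
          vert q π τ g'.2.1 g'.2.2 (fun i => (z i : ℚ))) := by
      intro j
      by_cases hj : (j : ℕ) ∈ J'
      · have hj2 := h2 _ hj
        by_cases hb : b = j
        · obtain ⟨-, -, x, hx, x', hx', hxy, hxx, hxv, hxv'⟩ := h4 (by omega)
          rw [hb] at hx hx' hxy
          obtain ⟨s, hs, e, hne⟩ := h1.exists_pos hqQ (by omega) hx
          obtain ⟨s', hs', e', -⟩ := h1.exists_pos hqQ (by omega) hx'
          obtain ⟨k, hk, t, ht, e2⟩ := hrep x hxv
          obtain ⟨k', hk', t', ht', e2'⟩ := hrep x' hxv'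
          refine ⟨(⟨s, hs⟩, ⟨k, by omega⟩, ⟨t, ht⟩), fun _ => ⟨⟨hne hxy, hk, ?_⟩, fun _ =>
            ⟨(⟨s', hs'⟩, ⟨k', by omega⟩, ⟨t', ht'⟩), ?_, hk', ?_⟩⟩⟩
          · simp only; rw [← e, ← e2]
          · intro h0
            have : s' = s := congrArg Fin.val h0
            rw [this, ← e] at e'
            exact hxx (by exact_mod_cast e'.symm)
          · simp only; rw [← e', ← e2']
        · obtain ⟨x, hx, hxy, hxv⟩ := h3 _ hj
          obtain ⟨s, hs, e, hne⟩ := h1.exists_pos hqQ (by omega) hx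
          obtain ⟨k, hk, t, ht, e2⟩ := hrep x hxv
          refine ⟨(⟨s, hs⟩, ⟨k, by omega⟩, ⟨t, ht⟩), fun _ => ⟨⟨hne hxy, hk, ?_⟩,
            fun h => absurd h hb⟩⟩
          simp only; rw [← e, ← e2]
      · exact ⟨(⟨0, by omega⟩, ⟨0, by omega⟩, ⟨0, by omega⟩), fun h => absurd h hj⟩
    choose g hg1 using hg
    have hbq : b < q + 1 := by
      by_cases hb : b = 0
      · omega
      · have := h2 b (h4 hb).1; omega
    have hg' : ∃ g' : Fin Q × Fin (q * (L + 1) + 1) × Fin Q, b ≠ 0 → g'.1 ≠ (g ⟨b, hbq⟩).1 ∧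
        (g'.2.1 : ℕ) ≤ q * L ∧ vert q π τ (q * L + b) g'.1 (fun i => (z i : ℚ)) =
          vert q π τ g'.2.1 g'.2.2 (fun i => (z i : ℚ)) := by
      by_cases hb : b = 0
      · exact ⟨(⟨0, by omega⟩, ⟨0, by omega⟩, ⟨0, by omega⟩), fun h => absurd hb h⟩
      · obtain ⟨g', h7⟩ := (hg1 ⟨b, hbq⟩ (h4 hb).1).2 rfl
        exact ⟨g', fun _ => h7⟩
    obtain ⟨g', hg'⟩ := hg'
    let J1 : Finset (Fin (q + 1)) := Finset.univ.filter (fun j => (j : ℕ) ∈ J')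
    have hJ1 : J1.map Fin.valEmbedding = J' := by
      ext j
      simp only [J1, Finset.mem_map, Finset.mem_filter, Finset.mem_univ, true_and,
        Fin.valEmbedding_apply]
      constructor
      · rintro ⟨i, hi, rfl⟩; exact hi
      · intro hj; exact ⟨⟨j, by have := h2 j hj; omega⟩, hj, rfl⟩
    refine ⟨L + 1, (⟨π, h1.pi_mem⟩, ⟨τ, h1.tau_mem⟩, J1, ⟨b, hbq⟩, g, g'), hfin.toFinset, z,
      ⟨S, ed, y, h1, by simp, ?_, ?_, ?_, ?_, ?_⟩, ?_⟩
    · simp only [J, hJ1]; exact h2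
    · intro j hj
      rw [Nat.add_sub_cancel]
      exact (hg1 j (by simpa [J1] using hj)).1
    · intro hb
      have hb' := h4 hb
      have hb2 := h2 b hb'.1
      rw [Nat.add_sub_cancel]
      refine ⟨by simpa [J1] using hb'.1, fun he => hb'.2.1 ?_, hg' hb⟩
      have e1 := h1.base_eq (q * L + b) (by omega)
      rw [base_eq_vert hq _ _ (by omega), parent_long hq hb2.1 hb2.2] at e1
      simp only at he
      rw [he, h1.vert_eq (by omega), sub_self, zero_mul, add_zero] at e1
      exact_mod_cast e1.symm
    · simp only [J, hJ1]
      rwa [← Set.ncard_eq_toFinset_card _ hfin]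
    · rw [← Set.ncard_eq_toFinset_card _ hfin]
      calc _ = Q * (q - 1) * L + Q * (q - 1) := by ring
        _ ≤ _ := by omega
    · rw [Set.Finite.coe_toFinset]
      rintro x ⟨k, hk, hxk⟩
      exact h1.subset_set k hk hxk


/-- A lost parameter gains Q(q-1), a lost vertex costs q. In the critical case A = 1, b = 0 the
claim reduces to q + 1 ≤ Q; for b ≠ 0 the up to Q-2 additional lost vertices are paid for by the
second lost parameter. -/
lemma extension_inequality {q Q L N A l f : ℕ} (hq : 3 ≤ q) (hqQ : q < Q) (b : ℕ) (hA : 1 ≤ A)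
    (hf : f + A + (if b = 0 then 0 else 1) = q * (L + 1) + 2)
    (hl : l ≤ A + if b = 0 then 0 else Q - 2)
    (hN : Q * ((q - 1) * (L + 1) + 1) ≤ N + l) : f * (Q * (q - 1)) + 1 ≤ q * N := by
  obtain ⟨t, rfl⟩ : ∃ t, q = t + 1 := ⟨q - 1, by omega⟩
  obtain ⟨A, rfl⟩ : ∃ a, A = a + 1 := ⟨A - 1, by omega⟩
  obtain ⟨r, rfl⟩ : ∃ r, Q = t + 2 + r := ⟨Q - (t + 2), by omega⟩
  rw [Nat.add_sub_cancel] at *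
  have h1 := Nat.mul_le_mul_left (t + 1) hN
  split_ifs at hf hl with hb
  · have hf' : f = (t + 1) * (L + 1) + 2 - (A + 1) := by omega
    have hl' := Nat.mul_le_mul_left (t + 1) hl
    have e : (f + (A + 1)) * ((t + 2 + r) * t) = ((t + 1) * (L + 1) + 2) * ((t + 2 + r) * t) := by
      rw [← hf]; ring
    nlinarith [Nat.zero_le (A * (t * t)), Nat.zero_le (A * (r * t)), mul_le_mul' (by omega : 2 ≤ t) (le_refl (A * t))]
  · have hl' := Nat.mul_le_mul_left (t + 1) hl
    have e2 : (t + 2 + r - 2) = t + r := by omega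
    rw [e2] at hl'
    have e : (f + (A + 1) + 1) * ((t + 2 + r) * t) = ((t + 1) * (L + 1) + 2) * ((t + 2 + r) * t) := by
      rw [← hf]
    nlinarith [Nat.zero_le (A * (t * t)), Nat.zero_le (A * (r * t)), mul_le_mul' (by omega : 2 ≤ t) (le_refl (A * t))]

lemma edgeSeq_congr {q L : ℕ} (hq : 3 ≤ q) (hL : 1 ≤ L) {E E' : ℕ → Set ℕ} {C C' : ℕ → ℕ → Set ℕ}
    (hE : ∀ i ≤ L, E i = E' i) (hC : ∀ i ≤ L, C i = C' i) {k : ℕ} (hk : k ≤ q * L) :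
    edgeSeq q E C k = edgeSeq q E' C' k := by
  rcases Nat.eq_zero_or_pos k with rfl | h1
  · rw [edgeSeq_zero, edgeSeq_zero, hC 1 hL]
  · obtain ⟨i, hi, j, hj1, hjq, rfl⟩ := index_cases hq hk h1
    rcases hj1.lt_or_eq with h2 | rfl
    · rw [edgeSeq_long hq _ _ _ h2 hjq, edgeSeq_long hq _ _ _ h2 hjq, hC _ (by omega)]
    · rw [edgeSeq_short hq, edgeSeq_short hq, hE _ (by omega)]

lemma edgeSeq_last {q L : ℕ} (hq : 3 ≤ q) (hL : 1 ≤ L) (E : ℕ → Set ℕ) (C : ℕ → ℕ → Set ℕ) :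
    edgeSeq q E C (q * L) = C L q ∧ edgeSeq q E C (parent q (q * L)) = E L := by
  obtain ⟨i, rfl⟩ : ∃ i, L = i + 1 := ⟨L - 1, by omega⟩
  rw [mul_add, mul_one, edgeSeq_long hq _ _ _ (by omega) le_rfl, parent_long hq (by omega) le_rfl,
    edgeSeq_short hq]
  exact ⟨rfl, rfl⟩

/-- The coefficients of the relation between a point of an edge `F` and four vertices which
determine two other points of `F`. -/
def doubleCoef {Q : ℕ} (ρ : Fin 9 → Fin Q) : Fin 5 → ℚ :=
  let a : ℚ := ((ρ 2 : ℚ) - ρ 1) / ((ρ 0 : ℚ) - ρ 1)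
  let b : ℚ := ((ρ 5 : ℚ) - ρ 4) / ((ρ 3 : ℚ) - ρ 4)
  let e : ℚ := ((ρ 8 : ℚ) - ρ 7) / ((ρ 6 : ℚ) - ρ 7)
  ![1, -(e * a), -(e * (1 - a)), -((1 - e) * b), -((1 - e) * (1 - b))]

/-- If two of the new long edges meet the old path twice, their attachment points on F are affine
combinations of old vertices, and so is v, which lies on the line through them. This relates v to
four old vertices outside the last long edge and is nontrivial at the difference of that edge.
Otherwise at most one new long edge meets the path more than once, and the parameter count of
`rare_extension` applies. -/
theorem rare_isPathWithSpoiledExtension (q Q : ℕ) (hq : 3 ≤ q) (hqQ : q < Q) :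
    Rare q Q (occurs q Q (IsPathWithSpoiledExtension Q q)) := by
  refine ((rare_relation q Q hq hqQ (P := Fin 9 → Fin Q) 5 doubleCoef).union
    (rare_extension q Q hq hqQ)).mono ?_
  rintro n S ⟨B, ⟨hu, L, E, C, F, W, hP, hF, hW, ⟨v, ⟨hvC, hvE⟩, hFv⟩, hW1, hWi, rfl⟩, -, hsub⟩
  have hch := hP.isCoveredChain
  have hedge : ∀ e ∈ pathEdges q L E C ∪ ({F} ∪ W '' Set.Icc 1 q),
      e ⊆ S ∧ e ⊆ Set.Icc 1 n ∧ IsAP e.ncard e :=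
    fun e he => mem_induce_apHypergraph (hsub he)
  have hL := hP.one_le
  have hWE : ∀ j ∈ Set.Icc 1 q, W j ∈ pathEdges q L E C ∪ ({F} ∪ W '' Set.Icc 1 q) :=
    fun j hj => Or.inr (Or.inr ⟨j, hj, rfl⟩)
  have hFE : F ∈ pathEdges q L E C ∪ ({F} ∪ W '' Set.Icc 1 q) := Or.inr (Or.inl rfl)
  have hWQ : ∀ j ∈ Set.Icc 1 q, (W j).ncard = Q := by
    intro j hj
    obtain ⟨⟨a, -, ha⟩, -⟩ := hW
    have h1 := (ha j (by rwa [hF])).2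
    have h2 := hu _ (hWE j hj)
    rw [hF] at h1
    exact h2.resolve_right h1
  have hWAP : ∀ j ∈ Set.Icc 1 q, IsAP Q (W j) := by
    intro j hj
    have := (hedge _ (hWE j hj)).2.2
    rwa [hWQ j hj] at this
  have hFAP : IsAP q F := by
    have := (hedge _ hFE).2.2
    rwa [hF] at this
  have hWdisj : ∀ i ∈ Set.Icc 1 q, ∀ j ∈ Set.Icc 1 q, i ≠ j → Disjoint (W i) (W j) := by
    intro i hi j hj hij
    have h1 := hW.2 i (by rwa [hF])
    rw [Set.disjoint_iff_inter_eq_empty, Set.eq_empty_iff_forall_notMem]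
    rintro x ⟨hx1, hx2⟩
    have : x ∈ W i ∩ ⋃ j ∈ Set.Icc 1 F.ncard \ {i}, W j :=
      ⟨hx1, Set.mem_biUnion (x := j) ⟨by rwa [hF], hij.symm⟩ hx2⟩
    rw [h1] at this
    exact this
  have hWfin : ∀ j ∈ Set.Icc 1 q, (W j).Finite := fun j hj => (hWAP j hj).finite (by omega)
  let E' : ℕ → Set ℕ := fun i => if i ≤ L then E i else F
  let C' : ℕ → ℕ → Set ℕ := fun i => if i ≤ L then C i else W
  have hE' : ∀ i ≤ L, E' i = E i := fun i hi => by simp [E', hi]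
  have hC' : ∀ i ≤ L, C' i = C i := fun i hi => by simp [C', hi]
  have hE'L : E' (L + 1) = F := by simp [E']
  have hC'L : C' (L + 1) = W := by simp [C']
  -- The extended path is in general not simple, since its new edges may meet the old ones; only the
  -- chain structure is needed for coding it as a tree.
  have hchain : IsCoveredChain q Q (L + 1) E' C' := by
    refine ⟨by omega, ?_, ?_, ?_, ?_⟩
    · rintro i ⟨hi1, hi2⟩
      rcases hi2.lt_or_eq with h | rfl
      · rw [hE' i (by omega)]; exact hP.short i ⟨hi1, by omega⟩
      · rw [hE'L, hF]
    · rintro i ⟨hi1, hi2⟩ j hj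
      rcases hi2.lt_or_eq with h | rfl
      · rw [hC' i (by omega)]; exact hP.long i ⟨hi1, by omega⟩ j hj
      · rw [hC'L, hWQ j hj]
    · rintro i ⟨hi1, hi2⟩
      rcases hi2.lt_or_eq with h | rfl
      · rw [hE' i (by omega), hC' i (by omega)]; exact hP.cover i ⟨hi1, by omega⟩
      · rw [hE'L, hC'L]; exact hW.1
    · rintro i ⟨hi1, hi2⟩ hi
      rcases (Nat.lt_succ_iff.1 hi).lt_or_eq with h | rfl
      · rw [hC' i (by omega), hC' (i + 1) (by omega)]; exact hP.shared i ⟨hi1, by omega⟩ h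
      · rw [hC'L, hC' i le_rfl, hW1]
  have hedges' : ∀ e ∈ pathEdges q (L + 1) E' C', e ⊆ S ∧ e ⊆ Set.Icc 1 n ∧ IsAP e.ncard e := by
    rintro e ⟨i, ⟨hi1, hi2⟩, he⟩
    rcases hi2.lt_or_eq with h | rfl
    · rw [hE' i (by omega), hC' i (by omega)] at he
      exact hedge e (Or.inl ⟨i, ⟨hi1, by omega⟩, he⟩)
    · rw [hE'L, hC'L] at he
      rcases he with rfl | ⟨j, hj, rfl⟩
      · exact hedge _ hFE
      · exact hedge _ (hWE j hj)
  obtain ⟨π, τ, z, y, ht, -, hinter, hbij⟩ := hchain.exists_isTreeIn hq hqQ hedges'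
  have hqL : q * (L + 1) = q * L + q := by ring
  have hbijF := hbij L (by omega)
  rw [hE'L] at hbijF
  have hedF : edgeSeq q E' C' (q * L + 1) = F := by rw [edgeSeq_short hq, hE'L]
  have hedW : ∀ j, 2 ≤ j → j ≤ q → edgeSeq q E' C' (q * L + j) = W j := fun j h1 h2 => by
    rw [edgeSeq_long hq _ _ _ h1 h2, hC'L]
  have hedlow : ∀ k ≤ q * L, edgeSeq q E' C' k = edgeSeq q E C k := fun k hk =>
    edgeSeq_congr hq hL hE' hC' hk
  have hverts : verts (q * L) (edgeSeq q E' C') = verts (q * L) (edgeSeq q E C) := by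
    ext x
    exact exists_congr fun k => and_congr_right fun hk => by rw [hedlow k hk]
  rw [← hch.verts_eq hq] at hFv hWi
  have hyv : y (q * L + 1) = v := by
    have h1 := hinter (q * L + 1) (by omega) (by omega)
    rw [parent_short hq, hedF, hedlow _ le_rfl, (edgeSeq_last hq hL E C).1] at h1
    have h2 : v ∈ F ∩ verts (q * L) (edgeSeq q E C) := by rw [hFv]; rfl
    have h3 : v ∈ F ∩ C L q := ⟨h2.1, hvC⟩
    rw [h1] at h3
    exact h3.symm
  have hyF : ∀ j, 1 ≤ j → j ≤ q → y (q * L + j) ∈ F := fun j h1 h2 => hbijF.mapsTo ⟨h1, h2⟩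
  have hyinj : ∀ i j, 1 ≤ i → i ≤ q → 1 ≤ j → j ≤ q → i ≠ j → y (q * L + i) ≠ y (q * L + j) :=
    fun i j h1 h2 h3 h4 hij he => hij (hbijF.injOn ⟨h1, h2⟩ ⟨h3, h4⟩ he)
  have hyW : ∀ j, 2 ≤ j → j ≤ q → F ∩ W j = {y (q * L + j)} := by
    intro j h1 h2
    have h3 := hinter (q * L + j) (by omega) (by omega)
    rwa [parent_long hq h1 h2, hedF, hedW j h1 h2, Set.inter_comm] at h3
  have hyW' : ∀ j, 2 ≤ j → j ≤ q → y (q * L + j) ∈ W j := by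
    intro j h1 h2
    have : y (q * L + j) ∈ F ∩ W j := by rw [hyW j h1 h2]; rfl
    exact this.2
  set PV := verts (q * L) (edgeSeq q E C) with hPV
  have hyPV : ∀ j, 2 ≤ j → j ≤ q → y (q * L + j) ∉ PV := by
    intro j h1 h2 h3
    have h4 : y (q * L + j) ∈ F ∩ PV := ⟨hyF j (by omega) h2, h3⟩
    rw [hFv] at h4
    exact hyinj j 1 (by omega) h2 le_rfl (by omega) (by omega) (by rw [hyv]; exact h4)
  by_cases hdouble : ∃ i j, 2 ≤ i ∧ i ≤ q ∧ 2 ≤ j ∧ j ≤ q ∧ i ≠ j ∧ 1 < (W i ∩ PV).ncard ∧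
      1 < (W j ∩ PV).ncard
  · left
    obtain ⟨i, j, hi2, hiq, hj2, hjq, hij, hWi2, hWj2⟩ := hdouble
    obtain ⟨π', τ', z', y', ht', -, hinter', -⟩ := hch.exists_isTreeIn hq hqQ
      (fun e he => hedge e (Or.inl he))
    have hm : 1 ≤ q * L := Nat.mul_pos (by omega) hL
    have hpts : ∀ i, 2 ≤ i → i ≤ q → 1 < (W i ∩ PV).ncard → ∃ i1 < Q, ∃ i2 < Q, ∃ i3 < Q, ∃ a : ℚ,
        a = ((i3 : ℚ) - i2) / ((i1 : ℚ) - i2) ∧ ∃ k < q * L, ∃ k' < q * L, ∃ s < Q, ∃ s' < Q,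
        (y (q * L + i) : ℚ) = a * vert q π' τ' k s (fun i => (z' i : ℚ)) +
          (1 - a) * vert q π' τ' k' s' (fun i => (z' i : ℚ)) := by
      intro i h1 h2 h3
      have hWif := hWfin i ⟨by omega, h2⟩
      obtain ⟨x, hx, x', hx', hxx⟩ := (Set.one_lt_ncard (hWif.inter_of_left _)).1 h3
      obtain ⟨i1, hi1, i2, hi2, i3, hi3, a, ha, hya⟩ :=
        (hWAP i ⟨by omega, h2⟩).affine_combination hx.1 hx'.1 (hyW' i h1 h2) hxx
      have hlast : ∀ x ∈ W i ∩ PV, ∃ k < q * L, x ∈ edgeSeq q E C k := by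
        rintro x ⟨hxW, k, hk, hxk⟩
        refine ⟨k, lt_of_le_of_ne hk ?_, hxk⟩
        rintro rfl
        rw [(edgeSeq_last hq hL E C).1, ← hW1] at hxk
        exact Set.disjoint_left.1 (hWdisj i ⟨by omega, h2⟩ 1 ⟨le_rfl, by omega⟩ (by omega)) hxW hxk
      obtain ⟨k, hk, hxk⟩ := hlast x hx
      obtain ⟨k', hk', hxk'⟩ := hlast x' hx'
      obtain ⟨s, hs, es, -⟩ := ht'.exists_pos hqQ hk.le hxk
      obtain ⟨s', hs', es', -⟩ := ht'.exists_pos hqQ hk'.le hxk'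
      exact ⟨i1, hi1, i2, hi2, i3, hi3, a, ha, k, hk, k', hk', s, hs, s', hs', by rw [hya, es, es']⟩
    obtain ⟨i1, hi1, i2, hi2', i3, hi3, a, ha, k, hk, k', hk', s, hs, s', hs', hya⟩ :=
      hpts i hi2 hiq hWi2
    obtain ⟨j1, hj1, j2, hj2', j3, hj3, b, hb, l, hl, l', hl', r, hr, r', hr', hyb⟩ :=
      hpts j hj2 hjq hWj2
    obtain ⟨m1, hm1, m2, hm2, m3, hm3, e, he, hve⟩ := hFAP.affine_combination
      (hyF i (by omega) hiq) (hyF j (by omega) hjq) (hyF 1 le_rfl (by omega))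
      (hyinj i j (by omega) hiq (by omega) hjq hij)
    have hvK : v ∈ edgeSeq q E C (q * L) := by rw [(edgeSeq_last hq hL E C).1]; exact hvC
    obtain ⟨t, htQ, et, htt⟩ := ht'.exists_pos hqQ le_rfl hvK
    have hvy : v ≠ y' (q * L) := by
      rintro rfl
      apply hvE
      rw [← (edgeSeq_last hq hL E C).2]
      exact ht'.mem_parent hq le_rfl hm
    have hcoef : ∀ x : Fin 5, doubleCoef (Q := Q) ![⟨i1, hi1⟩, ⟨i2, hi2'⟩, ⟨i3, hi3⟩, ⟨j1, hj1⟩, ⟨j2, hj2'⟩,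
        ⟨j3, hj3⟩, ⟨m1, by omega⟩, ⟨m2, by omega⟩, ⟨m3, by omega⟩] x =
        (![1, -(e * a), -(e * (1 - a)), -((1 - e) * b), -((1 - e) * (1 - b))] : Fin 5 → ℚ) x := by
      intro x
      simp only [doubleCoef, Matrix.cons_val]
      rw [ha, hb, he]
    refine ⟨L, π', τ', z', _, y', ht', hP.longDisjoint hq,
      ![⟨i1, hi1⟩, ⟨i2, hi2'⟩, ⟨i3, hi3⟩, ⟨j1, hj1⟩, ⟨j2, hj2'⟩,
        ⟨j3, hj3⟩, ⟨m1, by omega⟩, ⟨m2, by omega⟩, ⟨m3, by omega⟩], ![q * L, k, k', l, l'],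
      ![t, s, s', r, r'], ?_, ?_, ?_, Pi.single (q * L + 1) 1, ?_⟩
    · intro x; fin_cases x <;> simp <;> omega
    · intro x; fin_cases x <;> simpa
    · simp only [hcoef, Fin.sum_univ_five, Matrix.cons_val]
      rw [← et, ← hyv, hve, hya, hyb]
      ring
    · simp only [hcoef, Fin.sum_univ_five, Matrix.cons_val]
      rw [vert_single_self hq, vert_single_of_lt hq _ _ _ (by omega),
        vert_single_of_lt hq _ _ _ (by omega), vert_single_of_lt hq _ _ _ (by omega),
        vert_single_of_lt hq _ _ _ (by omega)]
      have hne' : (t : ℚ) - τ' (q * L) ≠ 0 := by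
        intro h0
        exact htt hvy (by exact_mod_cast sub_eq_zero.1 h0)
      simpa using hne'
  · right
    classical
    obtain ⟨b, hb⟩ : ∃ b, (b ≠ 0 → 2 ≤ b ∧ b ≤ q ∧ 1 < (W b ∩ PV).ncard) ∧
        ∀ j, 2 ≤ j → j ≤ q → j ≠ b → (W j ∩ PV).ncard ≤ 1 := by
      by_cases h : ∃ b, 2 ≤ b ∧ b ≤ q ∧ 1 < (W b ∩ PV).ncard
      · obtain ⟨b, h1, h2, h3⟩ := h
        refine ⟨b, fun _ => ⟨h1, h2, h3⟩, fun j h4 h5 h6 => ?_⟩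
        by_contra! h7
        exact hdouble ⟨b, j, h1, h2, h4, h5, h6.symm, h3, h7⟩
      · push Not at h
        exact ⟨0, fun h => absurd rfl h, fun j h1 h2 _ => h j h1 h2⟩
    let J : Finset ℕ := (Finset.Icc 2 q).filter (fun j => (W j ∩ PV).Nonempty)
    have hJ : ∀ j, j ∈ J ↔ (2 ≤ j ∧ j ≤ q) ∧ (W j ∩ PV).Nonempty := by
      intro j; simp [J]
    have hPVfin : PV.Finite := by
      rw [← hverts]
      exact ht.verts_finite.subset (fun x ⟨k, hk, hx⟩ => ⟨k, by omega, hx⟩)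
    have hPVcard : Q * ((q - 1) * L + 1) ≤ PV.ncard := by
      obtain ⟨π', τ', z', y', ht', -⟩ := hch.exists_isTreeIn hq hqQ
        (fun e he => hedge e (Or.inl he))
      exact le_ncard_verts hq ht'.toIsAPTree (hP.longDisjoint hq)
    have hPVsub : PV ⊆ verts (q * (L + 1)) (edgeSeq q E' C') := by
      rw [← hverts]
      exact fun x ⟨k, hk, hx⟩ => ⟨k, by omega, hx⟩
    have hVfin := ht.verts_finite
    have hdiff := Set.ncard_sdiff_add_ncard_of_subset hPVsub hVfin
    -- Disjoint sets of new vertices: `X 1` collects those of F, and the other `X j` leave out the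
    -- attachment point on F, which is already counted there.
    let X : ℕ → Set ℕ := fun j => if j = 1 then F \ {v} else W j \ (PV ∪ {y (q * L + j)})
    have hX1 : (X 1).ncard = q - 1 := by
      simp only [X, if_true]
      rw [Set.ncard_sdiff_singleton_of_mem (by rw [← hyv]; exact hyF 1 le_rfl (by omega)), hF]
    have hXj : ∀ j ∈ Finset.Icc 2 q, (X j).ncard + ((W j ∩ PV).ncard + 1) = Q := by
      intro j hj
      rw [Finset.mem_Icc] at hj
      have h1 : X j = W j \ (PV ∪ {y (q * L + j)}) := by
        simp only [X]; rw [if_neg (by omega)]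
      have h2 := Set.ncard_inter_add_ncard_sdiff_eq_ncard (W j) (PV ∪ {y (q * L + j)})
        (hWfin j ⟨by omega, hj.2⟩)
      have h3 : W j ∩ (PV ∪ {y (q * L + j)}) = insert (y (q * L + j)) (W j ∩ PV) := by
        rw [Set.inter_union_distrib_left, Set.union_comm,
          Set.inter_eq_right.2 (Set.singleton_subset_iff.2 (hyW' j hj.1 hj.2))]
        rfl
      rw [h3, Set.ncard_insert_of_notMem (fun h => hyPV j hj.1 hj.2 h.2) (hPVfin.inter_of_right _),
        hWQ j ⟨by omega, hj.2⟩] at h2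
      rw [h1]; omega
    have hsum := sum_ncard_le_ncard (Finset.Icc 1 q) X
      (verts (q * (L + 1)) (edgeSeq q E' C') \ PV) (hVfin.subset Set.sdiff_subset) (by
        intro j hj x hx
        rw [Finset.mem_Icc] at hj
        simp only [X] at hx
        split_ifs at hx with h
        · refine ⟨⟨q * L + 1, by omega, by rw [hedF]; exact hx.1⟩, fun hxP => hx.2 ?_⟩
          rw [← hFv]; exact ⟨hx.1, hxP⟩
        · exact ⟨⟨q * L + j, by omega, by rw [hedW j (by omega) hj.2]; exact hx.1⟩,
            fun hxP => hx.2 (Or.inl hxP)⟩) (by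
        have key : ∀ j, 2 ≤ j → j ≤ q → Disjoint (F \ {v}) (W j \ (PV ∪ {y (q * L + j)})) := by
          intro j h2 h3
          rw [Set.disjoint_left]
          rintro x ⟨hxF, -⟩ ⟨hxW, hxn⟩
          apply hxn
          right
          rw [← hyW j h2 h3]
          exact ⟨hxF, hxW⟩
        intro i hi j hj hij
        rw [Finset.mem_Icc] at hi hj
        simp only [X]
        split_ifs with h1 h2 h2
        · omega
        · exact key j (by omega) hj.2
        · exact (key i (by omega) hi.2).symm
        · exact (hWdisj i hi j hj hij).mono Set.sdiff_subset Set.sdiff_subset)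
    rw [← Finset.add_sum_Ioc_eq_sum_Icc (by omega : 1 ≤ q), hX1] at hsum
    have hIoc : Finset.Ioc 1 q = Finset.Icc 2 q := by ext; simp; omega
    rw [hIoc] at hsum
    have hXsum := Finset.sum_congr rfl hXj
    rw [Finset.sum_add_distrib, Finset.sum_const, Nat.card_Icc, Finset.sum_add_distrib,
      Finset.sum_const, Nat.card_Icc, smul_eq_mul, smul_eq_mul] at hXsum
    -- Each edge in `J` loses one vertex. The exceptional edge may lose up to Q-1, since its
    -- attachment point is off the path, hence the additional Q-2.
    have hl : ∑ j ∈ Finset.Icc 2 q, (W j ∩ PV).ncard ≤ J.card + if b = 0 then 0 else Q - 2 := by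
      calc _ ≤ ∑ j ∈ Finset.Icc 2 q, ((if (W j ∩ PV).Nonempty then 1 else 0) +
            (if j = b then Q - 2 else 0)) := by
            refine Finset.sum_le_sum fun j hj => ?_
            rcases Set.eq_empty_or_nonempty (W j ∩ PV) with h | h
            · rw [h]; simp
            · rw [if_pos h]
              have h1 := hXj j hj
              rw [Finset.mem_Icc] at hj
              by_cases hjb : j = b
              · rw [if_pos hjb]; omega
              · have := hb.2 j hj.1 hj.2 hjb; omega
        _ ≤ _ := by
            rw [Finset.sum_add_distrib, Finset.sum_ite_eq', ← Finset.card_filter]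
            gcongr
            split_ifs with h1 h2
            · rw [Finset.mem_Icc] at h1; omega
            all_goals omega
    have hJ1 : 1 ≤ J.card := by
      obtain ⟨i, hi, hi'⟩ := hWi
      exact Finset.card_pos.2 ⟨i, (hJ i).2 ⟨hi, hi'⟩⟩
    have hN : Q * ((q - 1) * (L + 1) + 1) ≤ (verts (q * (L + 1)) (edgeSeq q E' C')).ncard +
        ∑ j ∈ Finset.Icc 2 q, (W j ∩ PV).ncard := by
      have e1 : q + 1 - 2 = q - 1 := by omega
      rw [e1] at hXsum
      have e2 : Q * ((q - 1) * (L + 1) + 1) = Q * ((q - 1) * L + 1) + (q - 1) * Q := by ring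
      omega
    refine ⟨L, π, τ, z, _, y, ht, J, b, fun j hj => ((hJ j).1 hj).1, ?_, ?_, ?_, ?_⟩
    · intro j hj
      obtain ⟨⟨h1, h2⟩, x, hx1, hx2⟩ := (hJ j).1 hj
      refine ⟨x, by rwa [hedW j h1 h2], ?_, by rwa [hverts]⟩
      rintro rfl
      exact hyPV j h1 h2 hx2
    · intro hb0
      obtain ⟨h1, h2, h3⟩ := hb.1 hb0
      obtain ⟨x, hx, x', hx', hxx⟩ :=
        (Set.one_lt_ncard ((hWfin b ⟨by omega, h2⟩).inter_of_left _)).1 h3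
      refine ⟨(hJ b).2 ⟨⟨h1, h2⟩, x, hx⟩, hyinj b 1 (by omega) h2 le_rfl (by omega) (by omega), x,
        by rw [hedW b h1 h2]; exact hx.1, x', by rw [hedW b h1 h2]; exact hx'.1, ?_, hxx,
        by rw [hverts]; exact hx.2, by rw [hverts]; exact hx'.2⟩
      rintro rfl
      exact hyPV b h1 h2 hx.2
    · exact extension_inequality hq hqQ b hJ1
        (card_freeParams (by omega) hq (fun j hj => ((hJ j).1 hj).1) b) hl hN
    · calc Q * (q - 1) * L ≤ Q * ((q - 1) * L + 1) := by rw [mul_assoc]; gcongr; omega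
        _ ≤ PV.ncard := hPVcard
        _ ≤ _ := Set.ncard_le_ncard hPVsub hVfin


/-! ### Unions and intersections of progressions of equal length. -/

/-- The arithmetic progression of length `Q` with first term `x` and common difference `d`. -/
def progression (Q x d : ℕ) : Set ℕ := {y | ∃ i < Q, y = x + i * d}

lemma isAP_progression (Q x : ℕ) {d : ℕ} (hd : 0 < d) : IsAP Q (progression Q x d) :=
  ⟨x, d, hd, rfl⟩

lemma progression_finite (Q x d : ℕ) : (progression Q x d).Finite := by
  have : progression Q x d = (fun i => x + i * d) '' Set.Iio Q := by
    ext y; simp [progression, eq_comm]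
  rw [this]
  exact (Set.finite_Iio Q).image _

/-- Two progressions with differences `a < b` have few common elements. -/
lemma exists_ncard_inter_le {Q x y a b : ℕ} (ha : 0 < a) (hab : a < b) :
    ∃ r c g, 0 < g ∧ 0 < c ∧ c < r ∧ a = c * g ∧ b = r * g ∧
      ((progression Q x a ∩ progression Q y b).ncard - 1) * r ≤ Q - 1 := by
  obtain ⟨g, c, r, hg, hcop, rfl, rfl⟩ := Nat.exists_coprime' (m := a) (n := b)
    (Nat.gcd_pos_of_pos_left _ ha)
  have hcr : c < r := lt_of_mul_lt_mul_right hab (Nat.zero_le g)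
  have hc : 0 < c := Nat.pos_of_mul_pos_right ha
  refine ⟨r, c, g, hg, hc, hcr, rfl, rfl, ?_⟩
  rcases Nat.eq_zero_or_pos Q with rfl | hQ
  · simp [progression]
  have hex : ∀ z ∈ progression Q x (c * g) ∩ progression Q y (r * g), ∃ s < Q, ∃ t,
      z = x + s * (c * g) ∧ z = y + t * (r * g) := by
    rintro z ⟨⟨s, hs, h1⟩, t, -, h2⟩
    exact ⟨s, hs, t, h1, h2⟩
  choose! s hs t h1 h2 using hex
  -- With a : b = c : r in lowest terms, the positions of common elements in the first progression
  -- agree modulo r, so the quotient by r distinguishes them.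
  have hle : (progression Q x (c * g) ∩ progression Q y (r * g)).ncard ≤
      (Set.Iio ((Q - 1) / r + 1)).ncard := by
    refine Set.ncard_le_ncard_of_injOn (fun z => s z / r) (fun z hz => ?_) (fun z hz w hw e => ?_)
      (Set.finite_Iio _)
    · exact Nat.lt_succ_of_le (Nat.div_le_div_right (by have := hs z hz; omega))
    · have e1 := h1 z hz
      have e2 := h2 z hz
      have e3 := h1 w hw
      have e4 := h2 w hw
      have e5 : (g : ℤ) * (c * ((s z : ℤ) - s w)) = g * (r * ((t z : ℤ) - t w)) := by
        have f1 : (z : ℤ) = x + s z * (c * g) := by exact_mod_cast e1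
        have f2 : (z : ℤ) = y + t z * (r * g) := by exact_mod_cast e2
        have f3 : (w : ℤ) = x + s w * (c * g) := by exact_mod_cast e3
        have f4 : (w : ℤ) = y + t w * (r * g) := by exact_mod_cast e4
        linear_combination f2 - f1 + f3 - f4
      have e6 := mul_left_cancel₀ (by exact_mod_cast hg.ne') e5
      have e7 : (r : ℤ) ∣ (s z : ℤ) - s w :=
        (Int.isCoprime_iff_gcd_eq_one.2 (by simpa using hcop.symm)).dvd_of_dvd_mul_left
          (Dvd.intro _ e6.symm)
      have e8 : s w % r = s z % r := (Nat.modEq_iff_dvd.2 e7)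
      have e9 : s z = s w := by
        rw [← Nat.div_add_mod (s z) r, ← Nat.div_add_mod (s w) r, e8]
        simp only at e
        rw [e]
      rw [e1, e3, e9]
  rw [← Finset.coe_Iio, Set.ncard_coe_finset, Nat.card_Iio] at hle
  exact (Nat.mul_le_mul_right _ (Nat.sub_le_of_le_add hle)).trans (Nat.div_mul_le_self _ _)

/-- The denominator r of the reduced ratio a/b is at least 2; it is 2 only for the ratio 1/2, and 3
only for 1/3 and 2/3. -/
lemma ncard_inter_le {Q x y a b : ℕ} (ha : 0 < a) (hab : a < b) :
    2 * ((progression Q x a ∩ progression Q y b).ncard - 1) ≤ Q - 1 ∧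
    (b ≠ 2 * a → 3 * ((progression Q x a ∩ progression Q y b).ncard - 1) ≤ Q - 1) ∧
    (b ≠ 2 * a → b ≠ 3 * a → 2 * b ≠ 3 * a →
      4 * ((progression Q x a ∩ progression Q y b).ncard - 1) ≤ Q - 1) := by
  obtain ⟨r, c, g, hg, hc, hcr, rfl, rfl, h⟩ := exists_ncard_inter_le (Q := Q) (x := x) (y := y) ha hab
  set m := (progression Q x (c * g) ∩ progression Q y (r * g)).ncard - 1
  have key : ∀ k, k ≤ r → k * m ≤ Q - 1 := fun k hk => by
    rw [mul_comm]; exact (Nat.mul_le_mul_left _ hk).trans h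
  refine ⟨key 2 (by omega), fun h1 => key 3 ?_, fun h1 h2 h3 => key 4 ?_⟩
  · by_contra! h4
    obtain rfl : r = 2 := by omega
    obtain rfl : c = 1 := by omega
    apply h1; ring
  · by_contra! h4
    obtain rfl | rfl : r = 2 ∨ r = 3 := by omega
    · obtain rfl : c = 1 := by omega
      apply h1; ring
    · obtain rfl | rfl : c = 1 ∨ c = 2 := by omega
      · apply h2; ring
      · apply h3; ring

/-- At most two of the three pairs have ratio 1/2, and if two do, the third has ratio 1/4. The worst
case is therefore 1/2 + 1/2 + 1/4 = 5/4. -/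
lemma sum_ncard_inter_le {Q x y w a b e : ℕ} (ha : 0 < a) (hab : a < b) (hbe : b < e)
    (hQ : 0 < Q) : 4 * ((progression Q x a ∩ progression Q y b).ncard +
      (progression Q x a ∩ progression Q w e).ncard +
      (progression Q y b ∩ progression Q w e).ncard) ≤ 5 * Q + 7 := by
  obtain ⟨a1, a2, -⟩ := ncard_inter_le (Q := Q) (x := x) (y := y) ha hab
  obtain ⟨b1, b2, -⟩ := ncard_inter_le (Q := Q) (x := y) (y := w) (ha.trans hab) hbe
  obtain ⟨c1, c2, c3⟩ := ncard_inter_le (Q := Q) (x := x) (y := w) ha (hab.trans hbe)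
  generalize (progression Q x a ∩ progression Q y b).ncard = k at *
  generalize (progression Q x a ∩ progression Q w e).ncard = l at *
  generalize (progression Q y b ∩ progression Q w e).ncard = m at *
  by_cases h1 : b = 2 * a
  · have := c2 (by omega)
    by_cases h2 : e = 2 * b
    · have := c3 (by omega) (by omega) (by omega)
      omega
    · have := b2 h2
      omega
  · have := a2 h1
    by_cases h2 : e = 2 * b
    · have := c2 (by omega)
      omega
    · have := b2 h2
      omega

/-- The two alternatives correspond to the fractions 1/3 + 1/3 + 1/3 and 1/4 + 1/2 + 1/4. -/
lemma sum_ncard_inter_le' {Q x y w a b e : ℕ} (ha : 0 < a) (hab : a < b) (hbe : b < e)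
    (h : (e ≠ 2 * a ∧ b ≠ 2 * a ∧ e ≠ 2 * b) ∨ (e = 2 * a ∧ 2 * b ≠ 3 * a ∧ 2 * e ≠ 3 * b))
    (hQ : 0 < Q) :
    (progression Q x a ∩ progression Q y b).ncard +
      (progression Q x a ∩ progression Q w e).ncard +
      (progression Q y b ∩ progression Q w e).ncard ≤ Q + 2 := by
  obtain ⟨-, a2, a3⟩ := ncard_inter_le (Q := Q) (x := x) (y := y) ha hab
  obtain ⟨-, b2, b3⟩ := ncard_inter_le (Q := Q) (x := y) (y := w) (ha.trans hab) hbe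
  obtain ⟨c1, c2, -⟩ := ncard_inter_le (Q := Q) (x := x) (y := w) ha (hab.trans hbe)
  rcases h with ⟨h1, h2, h3⟩ | ⟨h1, h2, h3⟩
  · have := a2 h2
    have := b2 h3
    have := c2 h1
    clear a2 a3 b2 b3 c2 c1
    omega
  · have := a3 (by omega) (by omega) h2
    have := b3 (by omega) (by omega) h3
    clear a2 a3 b2 b3 c2
    omega

/-- Of three progressions with the same difference, which lie in the same residue class and none of
which is covered by the other two, two are disjoint. -/
lemma disjoint_of_same_difference {Q d x y z : ℕ} (hxy : x < y) (hyz : y < z)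
    (h1 : (progression Q x d ∩ progression Q y d).Nonempty)
    {a : ℕ} (ha : a ∈ progression Q y d) (hax : a ∉ progression Q x d)
    (haz : a ∉ progression Q z d) : progression Q x d ∩ progression Q z d = ∅ := by
  rw [Set.eq_empty_iff_forall_notMem]
  rintro w ⟨⟨s, hs, e1⟩, t, ht, e2⟩
  obtain ⟨w', ⟨s', hs', e3⟩, t', ht', e4⟩ := h1
  obtain ⟨u, hu, e5⟩ := ha
  have hz : ∃ m, z = x + m * d ∧ m ≤ s := by
    have : t ≤ s := by
      by_contra! h
      have := Nat.mul_le_mul_right d h.le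
      omega
    refine ⟨s - t, ?_, by omega⟩
    have e6 : s * d = (s - t) * d + t * d := by rw [← add_mul]; congr 1; omega
    omega
  have hy : ∃ m, y = x + m * d := by
    have : t' ≤ s' := by
      by_contra! h
      have := Nat.mul_le_mul_right d h.le
      omega
    refine ⟨s' - t', ?_⟩
    have e6 : s' * d = (s' - t') * d + t' * d := by rw [← add_mul]; congr 1; omega
    omega
  obtain ⟨m, rfl, hm⟩ := hz
  obtain ⟨k, rfl⟩ := hy
  have hkm : k < m := by
    by_contra! h
    have := Nat.mul_le_mul_right d h
    omega
  have e6 : a = x + (k + u) * d := by rw [e5]; ring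
  -- If the outer progressions met, their union would have no gap between them and would contain the
  -- whole middle progression, against the choice of `a`.
  by_cases h : k + u < Q
  · exact hax ⟨_, h, e6⟩
  · refine haz ⟨k + u - m, by omega, ?_⟩
    rw [e6, add_assoc, ← add_mul]; congr 2; omega

lemma le_ncard_union_three {Q : ℕ} {A B C : Set ℕ} (hA : A.ncard = Q) (hB : B.ncard = Q)
    (hC : C.ncard = Q) (hQ : 0 < Q) :
    3 * Q ≤ (A ∪ B ∪ C).ncard + (A ∩ B).ncard + (A ∩ C).ncard + (B ∩ C).ncard := by
  have fA : A.Finite := Set.finite_of_ncard_pos (by omega)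
  have fB : B.Finite := Set.finite_of_ncard_pos (by omega)
  have fC : C.Finite := Set.finite_of_ncard_pos (by omega)
  have h1 := Set.ncard_union_add_ncard_inter A B fA fB
  have h2 := Set.ncard_union_add_ncard_inter (A ∪ B) C (fA.union fB) fC
  have h3 := Set.ncard_union_le (A ∩ C) (B ∩ C)
  rw [Set.union_inter_distrib_right] at h2
  omega

/-- The target ratio (q+t-2)/q is largest at q = t. There it equals 3/2 for t = 4 and 7/4 for t = 8,
just the slopes available, so the additional points in the hypotheses matter. -/
lemma small_union_inequality {q Q t N : ℕ} (htq : t ≤ q) (hQ : 0 < Q)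
    (h : (3 ≤ t ∧ t < 5 ∧ 3 * Q + 2 * t ≤ 2 * N + 5) ∨
      (5 ≤ t ∧ t < 9 ∧ 7 * Q + 4 * t ≤ 4 * N + 19)) : Q * (q + t - 2) + 1 ≤ q * N := by
  obtain ⟨r, rfl⟩ : ∃ r, q = t + r := ⟨q - t, by omega⟩
  rw [show t + r + t - 2 = 2 * (t - 2) + 2 + r by omega]
  rcases h with ⟨h1, h2, h3⟩ | ⟨h1, h2, h3⟩
  all_goals
    have h4 := Nat.mul_le_mul_left r h3
    interval_cases t
    all_goals
      norm_num at h3 h4 ⊢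
      linarith [Nat.zero_le (r * Q)]

/-- `t` progressions of length `Q`, each of which contains a point missing from the others,
have a large union. -/
theorem le_mul_ncard_iUnion {ι : Type*} [DecidableEq ι] {q Q : ℕ} (hqQ : q < Q) (T : Finset ι)
    (hT2 : 2 ≤ T.card) (hTq : T.card ≤ q) (x d a : ι → ℕ) (hd : ∀ i ∈ T, 0 < d i)
    (ha : ∀ i ∈ T, ∀ j ∈ T, a j ∈ progression Q (x i) (d i) ↔ i = j) :
    Q * (q + T.card - 2) + 1 ≤ q * (⋃ i ∈ T, progression Q (x i) (d i)).ncard := by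
  set C : ι → Set ℕ := fun i => progression Q (x i) (d i) with hCdef
  have hQ : 0 < Q := by omega
  have hfin : ∀ i, (C i).Finite := fun i => progression_finite _ _ _
  have hcard : ∀ i ∈ T, (C i).ncard = Q := fun i hi => (isAP_progression Q _ (hd i hi)).ncard_eq
  have hUfin : (⋃ i ∈ T, C i).Finite := T.finite_toSet.biUnion fun i _ => hfin i
  have hamem : ∀ i ∈ T, a i ∈ C i := fun i hi => (ha i hi i hi).2 rfl
  have hanot : ∀ i ∈ T, ∀ j ∈ T, i ≠ j → a j ∉ C i := fun i hi j hj hne h =>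
    hne ((ha i hi j hj).1 h)
  have hainj : Set.InjOn a T := by
    intro i hi j hj e
    by_contra hne
    exact hanot i hi j hj hne (e ▸ hamem i hi)
  -- Each progression outside the subfamily adds at least its private point.
  have hext : ∀ I ⊆ T, ∀ A : Set ℕ, A ⊆ ⋃ i ∈ I, C i → A.ncard + (T.card - I.card) ≤
      (⋃ i ∈ T, C i).ncard := by
    intro I hI A hA
    have h1 : (a '' ((T \ I : Finset ι) : Set ι)).ncard = T.card - I.card := by
      rw [Set.InjOn.ncard_image (hainj.mono (by simp)), Set.ncard_coe_finset,
        Finset.card_sdiff_of_subset hI]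
    have hAU : A ⊆ ⋃ i ∈ T, C i := hA.trans (Set.biUnion_subset_biUnion_left hI)
    rw [← h1, ← Set.ncard_union_eq _ (hUfin.subset hAU) ((Finset.finite_toSet _).image _)]
    · refine Set.ncard_le_ncard (Set.union_subset hAU ?_) hUfin
      rintro _ ⟨i, hi, rfl⟩
      have hiT : i ∈ T := (Finset.mem_sdiff.1 hi).1
      exact Set.mem_biUnion hiT (hamem i hiT)
    · rw [Set.disjoint_left]
      rintro _ hxA ⟨i, hi, rfl⟩
      rw [Finset.mem_coe, Finset.mem_sdiff] at hi
      obtain ⟨j, hj, h⟩ := Set.mem_iUnion₂.1 (hA hxA)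
      exact hanot j (hI hj) i hi.1 (by rintro rfl; exact hi.2 hj) h
  set N := (⋃ i ∈ T, C i).ncard with hN
  set t := T.card with ht
  -- Since t ≤ q, a union of size 2Q is always enough. In particular no two of the progressions may
  -- be assumed disjoint.
  have hbig : 2 * Q ≤ N → Q * (q + t - 2) + 1 ≤ q * N := by
    intro h
    calc Q * (q + t - 2) + 1 ≤ Q * (2 * q - 2) + Q * 2 := by gcongr <;> omega
      _ = q * (2 * Q) := by
        rw [← mul_add, Nat.sub_add_cancel (by omega)]; ring
      _ ≤ _ := by gcongr
  by_cases hdisj : ∃ i ∈ T, ∃ j ∈ T, i ≠ j ∧ C i ∩ C j = ∅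
  · obtain ⟨i, hi, j, hj, hij, h⟩ := hdisj
    apply hbig
    have h1 := Set.ncard_union_add_ncard_inter (C i) (C j) (hfin i) (hfin j)
    have h2 := hext {i, j} (by simp [Finset.insert_subset_iff, hi, hj]) (C i ∪ C j) (by simp)
    rw [h, Set.ncard_empty, hcard i hi, hcard j hj] at h1
    omega
  push Not at hdisj
  have hsame : ∀ i ∈ T, ∀ j ∈ T, ∀ k ∈ T, d i = d j → d j = d k → x i < x j → x j < x k → False := by
    intro i hi j hj k hk e1 e2 h1 h2
    have hij : i ≠ j := by rintro rfl; exact lt_irrefl _ h1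
    have hjk : j ≠ k := by rintro rfl; exact lt_irrefl _ h2
    have hik : i ≠ k := by rintro rfl; omega
    have h3 := hdisj i hi j hj hij
    have h4 := hamem j hj
    have h5 := hanot i hi j hj hij
    have h6 := hanot k hk j hj hjk.symm
    have h7 := hdisj i hi k hk hik
    simp only [hCdef] at h3 h4 h5 h6 h7
    rw [← e2] at h6 h7
    rw [e1] at h3 h5 h7
    exact h7.ne_empty (disjoint_of_same_difference h1 h2 h3 h4 h5 h6)
  have hxne : ∀ i ∈ T, ∀ j ∈ T, d i = d j → i ≠ j → x i ≠ x j := by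
    intro i hi j hj e hij ex
    apply hanot i hi j hj hij
    have := hamem j hj
    simp only [hCdef] at this ⊢
    rwa [e, ex]
  -- Three pairwise intersecting progressions with equal differences are excluded by `hsame`, so
  -- each difference occurs at most twice. Hence there are 2, 3 or 5 distinct differences once t is
  -- at least 3, 5 or 9.
  have himage : t ≤ 2 * (T.image d).card := by
    refine Finset.card_le_mul_card_image T 2 fun b _ => ?_
    by_contra! h
    obtain ⟨i, j, k, hi, hj, hk, hij, hik, hjk⟩ := Finset.two_lt_card_iff.1 h
    rw [Finset.mem_filter] at hi hj hk
    have h1 := hxne i hi.1 j hj.1 (hi.2.trans hj.2.symm) hij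
    have h2 := hxne i hi.1 k hk.1 (hi.2.trans hk.2.symm) hik
    have h3 := hxne j hj.1 k hk.1 (hj.2.trans hk.2.symm) hjk
    have key : ∀ i j k, i ∈ T ∧ d i = b → j ∈ T ∧ d j = b → k ∈ T ∧ d k = b → x i < x j → x j < x k →
        False := fun i j k hi hj hk => hsame i hi.1 j hj.1 k hk.1 (hi.2.trans hj.2.symm)
          (hj.2.trans hk.2.symm)
    rcases h1.lt_or_gt with g1 | g1 <;> rcases h2.lt_or_gt with g2 | g2 <;>
      rcases h3.lt_or_gt with g3 | g3
    · exact key i j k hi hj hk g1 g3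
    · exact key i k j hi hk hj g2 g3
    · omega
    · exact key k i j hk hi hj g2 g1
    · exact key j i k hj hi hk g1 g2
    · omega
    · exact key j k i hj hk hi g3 g2
    · exact key k j i hk hj hi g3 g1
  have hchoose : ∀ k, k ≤ (T.image d).card → ∃ f : Fin k → ι, (∀ i, f i ∈ T) ∧
      ∀ i j, i < j → d (f i) < d (f j) := by
    intro k hk
    let e := (T.image d).orderEmbOfCardLe hk
    have he : ∀ i, ∃ j ∈ T, d j = e i := fun i =>
      Finset.mem_image.1 ((T.image d).orderEmbOfCardLe_mem hk i)
    choose f hf1 hf2 using he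
    exact ⟨f, hf1, fun i j hij => by rw [hf2, hf2]; exact e.strictMono hij⟩
  have hthree : ∀ i ∈ T, ∀ j ∈ T, ∀ k ∈ T, d i < d j → d j < d k →
      3 * Q + (t - 3) ≤ N + (C i ∩ C j).ncard + (C i ∩ C k).ncard + (C j ∩ C k).ncard := by
    intro i hi j hj k hk h1 h2
    have h3 := le_ncard_union_three (hcard i hi) (hcard j hj) (hcard k hk) hQ
    have h4 := hext {i, j, k} (by simp [Finset.insert_subset_iff, hi, hj, hk]) (C i ∪ C j ∪ C k)
      (by simp [Set.union_assoc])
    have h5 := Finset.card_le_three (a := i) (b := j) (c := k)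
    omega
  rcases Nat.lt_or_ge t 3 with h3 | h3
  · obtain ⟨i, hi⟩ : T.Nonempty := Finset.card_pos.1 (by omega)
    have h1 := hext {i} (by simpa) (C i) (by simp)
    rw [hcard i hi, Finset.card_singleton] at h1
    have e : t = 2 := by omega
    rw [e] at h1 ⊢
    calc Q * (q + 2 - 2) + 1 ≤ q * Q + q := by rw [Nat.add_sub_cancel, mul_comm]; omega
      _ = q * (Q + (2 - 1)) := by ring
      _ ≤ _ := by gcongr
  rcases Nat.lt_or_ge t 5 with h5 | h5
  · obtain ⟨f, hf, hlt⟩ := hchoose 2 (by omega)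
    have h01 := hlt 0 1 (by simp)
    have h1 := Set.ncard_union_add_ncard_inter (C (f 0)) (C (f 1)) (hfin _) (hfin _)
    have h2 := hext {f 0, f 1} (by simp [Finset.insert_subset_iff, hf]) (C (f 0) ∪ C (f 1)) (by simp)
    have h4 := Finset.card_le_two (a := f 0) (b := f 1)
    rw [hcard _ (hf _), hcard _ (hf _)] at h1
    have h6 := (ncard_inter_le (Q := Q) (x := x (f 0)) (y := x (f 1)) (hd _ (hf 0)) h01).1
    change 2 * ((C (f 0) ∩ C (f 1)).ncard - 1) ≤ Q - 1 at h6
    have h7 : 3 * Q + 2 * t ≤ 2 * N + 5 := by omega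
    exact small_union_inequality hTq (by omega) (Or.inl ⟨h3, h5, h7⟩)
  rcases Nat.lt_or_ge t 9 with h9 | h9
  · obtain ⟨f, hf, hlt⟩ := hchoose 3 (by omega)
    have h01 := hlt 0 1 (by simp)
    have h12 := hlt 1 2 (by simp)
    have h1 := hthree _ (hf 0) _ (hf 1) _ (hf 2) h01 h12
    have h2 := sum_ncard_inter_le (Q := Q) (x := x (f 0)) (y := x (f 1)) (w := x (f 2))
      (hd _ (hf 0)) h01 h12 hQ
    change 4 * ((C (f 0) ∩ C (f 1)).ncard + (C (f 0) ∩ C (f 2)).ncard +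
      (C (f 1) ∩ C (f 2)).ncard) ≤ 5 * Q + 7 at h2
    clear hchoose himage hthree hext hbig
    have h7 : 7 * Q + 4 * t ≤ 4 * N + 19 := by omega
    exact small_union_inequality hTq (by omega) (Or.inr ⟨h5, h9, h7⟩)
  · apply hbig
    obtain ⟨f, hf, hlt⟩ := hchoose 5 (by omega)
    have l1 := hlt 0 1 (by simp)
    have l2 := hlt 1 2 (by simp)
    have l3 := hlt 2 3 (by simp)
    have l4 := hlt 3 4 (by simp)
    have h0 := hd _ (hf 0)
    -- Between the smallest and the largest of five differences there are three candidates, and in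
    -- either alternative at most two of them are excluded.
    obtain ⟨i, hi, hi1, hi2, hgood⟩ : ∃ i ∈ T, d (f 0) < d i ∧ d i < d (f 4) ∧
        ((d (f 4) ≠ 2 * d (f 0) ∧ d i ≠ 2 * d (f 0) ∧ d (f 4) ≠ 2 * d i) ∨
        (d (f 4) = 2 * d (f 0) ∧ 2 * d i ≠ 3 * d (f 0) ∧ 2 * d (f 4) ≠ 3 * d i)) := by
      by_contra! hcon
      have g1 := hcon _ (hf 1) (by omega) (by omega)
      have g2 := hcon _ (hf 2) (by omega) (by omega)
      have g3 := hcon _ (hf 3) (by omega) (by omega)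
      omega
    have h1 := hthree _ (hf 0) _ hi _ (hf 4) hi1 hi2
    have h2 := sum_ncard_inter_le' (Q := Q) (x := x (f 0)) (y := x i) (w := x (f 4))
      h0 hi1 hi2 hgood (by omega)
    change (C (f 0) ∩ C i).ncard + (C (f 0) ∩ C (f 4)).ncard + (C i ∩ C (f 4)).ncard ≤ Q + 2 at h2
    clear hchoose himage hthree hext
    omega


/-! ### Non-simple covers. -/

/-- Here f, R, t count the free edges, the non-free edges outside the tight family, and the tight
edges. For t ≥ 2 the required bound on M is just what makes the terms without R balance, and R
leaves a gain proportional to Q - q. For t = 0 the critical case R = 1 reduces to q + 1 ≤ Q. -/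
lemma star_inequality {q Q t f R s N M : ℕ} (hq : 3 ≤ q) (hqQ : q < Q) (hf : f + R + t = q)
    (hN : M + (q - t) * Q ≤ N + s)
    (h : (t = 0 ∧ 1 ≤ R ∧ s ≤ 1 + (R - 1) * (q - 1)) ∨
      (2 ≤ t ∧ s ≤ R * (q - 1) ∧ Q * (q + t - 2) + 1 ≤ q * M)) :
    (2 + f) * (Q * (q - 1)) + 1 ≤ q * N := by
  obtain ⟨p, rfl⟩ : ∃ p, q = p + 1 := ⟨q - 1, by omega⟩
  obtain ⟨e, rfl⟩ : ∃ e, Q = p + 2 + e := ⟨Q - (p + 2), by omega⟩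
  rw [Nat.add_sub_cancel] at *
  rcases h with ⟨rfl, h1, h2⟩ | ⟨h1, h2, h3⟩
  · obtain ⟨R, rfl⟩ : ∃ r, R = r + 1 := ⟨R - 1, by omega⟩
    rw [Nat.add_sub_cancel] at h2
    obtain rfl : p = f + R := by omega
    rw [Nat.sub_zero] at hN
    have h4 := Nat.mul_le_mul_left (f + R + 1) hN
    have h5 := Nat.mul_le_mul_left (f + R + 1) h2
    nlinarith [Nat.zero_le (R * (f + R)), Nat.zero_le (e * R * (f + R)), Nat.zero_le M,
      Nat.zero_le (e * (f + R)), Nat.zero_le ((f + R + 1) * M)]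
  · obtain ⟨w, rfl⟩ : ∃ w, t = w + 2 := ⟨t - 2, by omega⟩
    have e1 : p + 1 - (w + 2) = f + R := by omega
    obtain rfl : p = f + R + w + 1 := by omega
    have e2 : f + R + w + 1 + 1 + (w + 2) - 2 = f + R + 2 * w + 2 := by omega
    rw [e1] at hN
    rw [e2] at h3
    have h4 := Nat.mul_le_mul_left (f + R + w + 1 + 1) hN
    have h5 := Nat.mul_le_mul_left (f + R + w + 1 + 1) h2
    nlinarith [Nat.zero_le (R * (f + R + w + 1)), Nat.zero_le (e * (R * (f + R + w + 1)))]

/-- The number of vertices of a cover, if `T` contains the edges which meet another edge in several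
points, and is closed under intersections. -/
lemma le_mul_ncard_cover {q Q : ℕ} (hq : 3 ≤ q) (hqQ : q < Q) (x d a : Fin q → ℕ)
    (hd : ∀ i, 0 < d i) (ha : ∀ i j, a j ∈ progression Q (x i) (d i) ↔ i = j)
    (T : Finset (Fin q)) (hT : ∀ i ∈ T, ∃ j ∈ T, i ≠ j)
    (h1 : ∀ j ∉ T, ∀ i, i ≠ j →
      (progression Q (x i) (d i) ∩ progression Q (x j) (d j)).ncard ≤ 1)
    (h2 : ∀ j ∉ T, ∀ i ∈ T, progression Q (x i) (d i) ∩ progression Q (x j) (d j) = ∅)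
    (h01 : (progression Q (x ⟨0, by omega⟩) (d ⟨0, by omega⟩) ∩
      progression Q (x ⟨1, by omega⟩) (d ⟨1, by omega⟩)).Nonempty) :
    (2 + (Finset.univ.filter (fun j => j ∉ T ∧ ∀ i < j,
      progression Q (x i) (d i) ∩ progression Q (x j) (d j) = ∅)).card) * (Q * (q - 1)) + 1 ≤
      q * (⋃ i, progression Q (x i) (d i)).ncard := by
  classical
  set C : Fin q → Set ℕ := fun i => progression Q (x i) (d i) with hC
  change (2 + (Finset.univ.filter (fun j => j ∉ T ∧ ∀ i < j, C i ∩ C j = ∅)).card) *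
    (Q * (q - 1)) + 1 ≤ q * (⋃ i, C i).ncard
  change ∀ j ∉ T, ∀ i, i ≠ j → (C i ∩ C j).ncard ≤ 1 at h1
  change ∀ j ∉ T, ∀ i ∈ T, C i ∩ C j = ∅ at h2
  change (C ⟨0, by omega⟩ ∩ C ⟨1, by omega⟩).Nonempty at h01
  have hfin : ∀ i, (C i).Finite := fun i => progression_finite _ _ _
  have hcard : ∀ i, (C i).ncard = Q := fun i => (isAP_progression Q _ (hd i)).ncard_eq
  have hU : (⋃ i, C i).Finite := Set.finite_iUnion hfin
  set F := Finset.univ.filter (fun j => j ∉ T ∧ ∀ i < j, C i ∩ C j = ∅) with hF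
  let Dp := Finset.univ.filter (fun j => j ∉ T ∧ ¬ ∀ i < j, C i ∩ C j = ∅)
  have hFD : Tᶜ = F ∪ Dp := by
    ext j; simp only [hF, Dp, Finset.mem_compl, Finset.mem_union, Finset.mem_filter,
      Finset.mem_univ, true_and]; tauto
  have hFDd : Disjoint F Dp := by
    rw [Finset.disjoint_left]; intro j hj hj'
    exact (Finset.mem_filter.1 hj').2.2 (Finset.mem_filter.1 hj).2.2
  have hsize : F.card + Dp.card + T.card = q := by
    rw [← Finset.card_union_of_disjoint hFDd, ← hFD, Finset.card_compl_add_card, Fintype.card_fin]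
  let l : Fin q → ℕ := fun j => ((Finset.univ.filter (· < j)).filter
    (fun i => (C i ∩ C j).Nonempty)).card
  have hlcard : ∀ j : Fin q, (Finset.univ.filter (· < j)).card = j := by
    intro j
    rw [Finset.filter_gt_eq_Iio, Fin.card_Iio]
  have hlle : ∀ j, l j ≤ j := fun j => (Finset.card_filter_le _ _).trans (hlcard j).le
  have hlF : ∀ j ∈ F, l j = 0 := by
    intro j hj
    rw [hF, Finset.mem_filter] at hj
    simp only [l, Finset.card_eq_zero, Finset.filter_eq_empty_iff, Finset.mem_filter,
      Finset.mem_univ, true_and]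
    intro i hi
    rw [hj.2.2 i hi]; exact Set.not_nonempty_empty
  -- The part of edge j not covered by earlier edges. For j outside `T` it misses at most one point
  -- per earlier edge that meets it, and `l j` counts those edges.
  let X : Fin q → Set ℕ := fun j => C j \ ⋃ i ∈ Finset.univ.filter (· < j), C i
  have hX : ∀ j ∉ T, Q ≤ (X j).ncard + l j := by
    intro j hj
    have e1 := Set.ncard_inter_add_ncard_sdiff_eq_ncard (C j)
      (⋃ i ∈ Finset.univ.filter (· < j), C i) (hfin j)
    have e2 : (C j ∩ ⋃ i ∈ Finset.univ.filter (· < j), C i).ncard ≤ l j := by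
      have e3 : C j ∩ ⋃ i ∈ Finset.univ.filter (· < j), C i =
          ⋃ i ∈ Finset.univ.filter (· < j), (C i ∩ C j) := by
        rw [Set.inter_iUnion₂]
        simp only [Set.inter_comm]
      rw [e3]
      refine (Finset.set_ncard_biUnion_le _ _).trans ?_
      simp only [l]
      rw [Finset.card_filter]
      refine Finset.sum_le_sum fun i hi => ?_
      split_ifs with h
      · exact h1 j hj i (Finset.mem_filter.1 hi).2.ne
      · rw [Set.not_nonempty_iff_eq_empty.1 h, Set.ncard_empty]
    rw [hcard] at e1
    simp only [X]
    omega
  have hUT : (⋃ i ∈ T, C i) ⊆ ⋃ i, C i := Set.iUnion₂_subset_iUnion _ _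
  have hsum := sum_ncard_le_ncard Tᶜ X ((⋃ i, C i) \ ⋃ i ∈ T, C i) (hU.subset Set.sdiff_subset)
    (by
      rintro j hj y ⟨hy, -⟩
      rw [Finset.mem_compl] at hj
      refine ⟨Set.mem_iUnion_of_mem j hy, fun hy' => ?_⟩
      obtain ⟨i, hi, h⟩ := Set.mem_iUnion₂.1 hy'
      have : y ∈ C i ∩ C j := ⟨h, hy⟩
      rw [h2 j hj i hi] at this
      exact this)
    (by
      have key : ∀ i j, i < j → Disjoint (X i) (X j) := by
        intro i j hij
        rw [Set.disjoint_left]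
        rintro y ⟨hy, -⟩ ⟨-, hy'⟩
        exact hy' (Set.mem_biUnion (by simpa using hij) hy)
      intro i _ j _ hij
      rcases hij.lt_or_gt with h | h
      · exact key i j h
      · exact (key j i h).symm)
  have hdiff := Set.ncard_sdiff_add_ncard_of_subset hUT hU
  have hXsum : (q - T.card) * Q ≤ ∑ j ∈ Tᶜ, (X j).ncard + ∑ j ∈ Tᶜ, l j := by
    rw [← Finset.sum_add_distrib]
    calc (q - T.card) * Q = ∑ j ∈ Tᶜ, Q := by
          rw [Finset.sum_const, Finset.card_compl, Fintype.card_fin, smul_eq_mul]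
      _ ≤ _ := Finset.sum_le_sum fun j hj => hX j (Finset.mem_compl.1 hj)
  have hlsum : ∑ j ∈ Tᶜ, l j = ∑ j ∈ Dp, l j := by
    rw [hFD, Finset.sum_union hFDd, Finset.sum_eq_zero hlF, zero_add]
  have hlq : ∀ j, l j ≤ q - 1 := fun j => (hlle j).trans (by omega)
  refine star_inequality hq hqQ hsize (s := ∑ j ∈ Tᶜ, l j) (M := (⋃ i ∈ T, C i).ncard)
    (by omega) ?_
  rcases T.eq_empty_or_nonempty with hT0 | ⟨i, hi⟩
  · left
    -- The numbering makes the first two edges meet. So the edge with index 1 is not free, and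
    -- having only one predecessor it loses at most one point; this is the 1 in the bound on `s`.
    have hmem : (⟨1, by omega⟩ : Fin q) ∈ Dp := by
      simp only [Dp, Finset.mem_filter, Finset.mem_univ, true_and, hT0]
      refine ⟨Finset.notMem_empty _, fun h => ?_⟩
      rw [h ⟨0, by omega⟩ (by simp)] at h01
      exact Set.not_nonempty_empty h01
    refine ⟨by rw [hT0, Finset.card_empty], Finset.card_pos.2 ⟨_, hmem⟩, ?_⟩
    rw [hlsum, ← Finset.add_sum_erase _ _ hmem, ← Finset.card_erase_of_mem hmem]
    exact add_le_add (hlle _) (Finset.sum_le_card_nsmul _ _ _ fun j _ => hlq j)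
  · right
    obtain ⟨j, hj, hij⟩ := hT i hi
    have hT2 : 2 ≤ T.card := Finset.one_lt_card.2 ⟨i, hi, j, hj, hij⟩
    refine ⟨hT2, ?_, ?_⟩
    · rw [hlsum]
      exact Finset.sum_le_card_nsmul _ _ _ fun j _ => hlq j
    · exact le_mul_ncard_iUnion hqQ T hT2 (by omega) x d a (fun i _ => hd i) fun i _ j _ => ha i j

/-- The edges of a cover whose difference is determined by the covered edge, if the quadruples
`(i, s, j, t) ∈ W` stand for the coincidence of point `s` of edge `i` with point `t` of edge `j`. -/
inductive Tight {q Q : ℕ} (W : Set (Fin q × Fin Q × Fin q × Fin Q)) : Fin q → Prop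
  | pair {i j : Fin q} {s t s' t' : Fin Q} :
    (i, s, j, t) ∈ W → (i, s', j, t') ∈ W → s ≠ s' → Tight W j
  | step {i j : Fin q} {s t : Fin Q} : Tight W i → (i, s, j, t) ∈ W → Tight W j

/-- The point at position `s` of the edge `j` of a cover; parameters `0` and `1` are the first term
and the difference of the covered edge, parameter `j + 2` is the difference of the edge `j`. -/
def coverPoint {q Q : ℕ} (π : Fin q → Fin q) (τ : Fin q → Fin Q) (j : Fin q) (s : Fin Q) (z : ℕ → ℕ) :
    ℚ :=
  z 0 + (π j : ℕ) * z 1 + (((s : ℕ) : ℚ) - (τ j : ℕ)) * z (j + 2)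

/-- The quadruples in `W` are coincidences of points of a cover. -/
def Realizes {q Q : ℕ} (π : Fin q → Fin q) (τ : Fin q → Fin Q)
    (W : Set (Fin q × Fin Q × Fin q × Fin Q)) (z : ℕ → ℕ) : Prop :=
  Function.Injective π ∧ 0 < z 1 ∧ (∀ j : Fin q, 0 < z (j + 2)) ∧
    ∀ i s j t, (i, s, j, t) ∈ W → i ≠ j ∧ t ≠ τ j ∧ coverPoint π τ i s z = coverPoint π τ j t z

/-- The coincidence is off the attachment point of edge j, so its difference enters the equation
with nonzero coefficient. -/
lemma Realizes.eq_of_step {q Q : ℕ} {π : Fin q → Fin q} {τ : Fin q → Fin Q}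
    {W : Set (Fin q × Fin Q × Fin q × Fin Q)} {z z' : ℕ → ℕ} (h : Realizes π τ W z)
    (h' : Realizes π τ W z') (h0 : z 0 = z' 0) (h1 : z 1 = z' 1) {i j : Fin q} {s t : Fin Q}
    (hW : (i, s, j, t) ∈ W) (hi : z (i + 2) = z' (i + 2)) : z (j + 2) = z' (j + 2) := by
  obtain ⟨-, ht, e⟩ := h.2.2.2 _ _ _ _ hW
  obtain ⟨-, -, e'⟩ := h'.2.2.2 _ _ _ _ hW
  unfold coverPoint at e e'
  rw [h0, h1, hi] at e
  have hne : ((t : ℕ) : ℚ) - (τ j : ℕ) ≠ 0 := by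
    intro hc
    exact ht (Fin.ext (by exact_mod_cast sub_eq_zero.1 hc))
  have : (z (j + 2) : ℚ) = z' (j + 2) := mul_left_cancel₀ hne (by linear_combination e' - e)
  exact_mod_cast this

lemma Realizes.eq_of_tight {q Q : ℕ} {π : Fin q → Fin q} {τ : Fin q → Fin Q}
    {W : Set (Fin q × Fin Q × Fin q × Fin Q)} {z z' : ℕ → ℕ} (h : Realizes π τ W z)
    (h' : Realizes π τ W z') (h0 : z 0 = z' 0) (h1 : z 1 = z' 1) {j : Fin q} (hj : Tight W j) :
    z (j + 2) = z' (j + 2) := by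
  induction hj with
  | step _ hW ih => exact h.eq_of_step h' h0 h1 hW ih
  | @pair i j s t s' t' hW hW' hs =>
    obtain ⟨hij, -, e1⟩ := h.2.2.2 _ _ _ _ hW
    obtain ⟨-, -, e2⟩ := h.2.2.2 _ _ _ _ hW'
    obtain ⟨-, -, e3⟩ := h'.2.2.2 _ _ _ _ hW
    obtain ⟨-, -, e4⟩ := h'.2.2.2 _ _ _ _ hW'
    unfold coverPoint at e1 e2 e3 e4
    rw [h0, h1] at e1 e2
    have hsne : ((s : ℕ) : ℚ) - (s' : ℕ) ≠ 0 := by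
      intro hc
      exact hs (Fin.ext (by exact_mod_cast sub_eq_zero.1 hc))
    have hc : (((π j : ℕ) : ℚ) - (π i : ℕ)) * z' 1 ≠ 0 := by
      refine mul_ne_zero (fun hc => hij (h.1 (Fin.ext ?_)).symm) ?_
      · exact_mod_cast sub_eq_zero.1 hc
      · exact_mod_cast h'.2.1.ne'
    have k1 : ((((s : ℕ) : ℚ) - (τ i : ℕ)) * (((t : ℕ) : ℚ) - (t' : ℕ)) -
        (((t : ℕ) : ℚ) - (τ j : ℕ)) * (((s : ℕ) : ℚ) - (s' : ℕ))) * z (j + 2) =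
        (((π j : ℕ) : ℚ) - (π i : ℕ)) * z' 1 * (((s : ℕ) : ℚ) - (s' : ℕ)) := by
      linear_combination (((s : ℕ) : ℚ) - (s' : ℕ)) * e1 - (((s : ℕ) : ℚ) - (τ i : ℕ)) * (e1 - e2)
    have k2 : ((((s : ℕ) : ℚ) - (τ i : ℕ)) * (((t : ℕ) : ℚ) - (t' : ℕ)) -
        (((t : ℕ) : ℚ) - (τ j : ℕ)) * (((s : ℕ) : ℚ) - (s' : ℕ))) * z' (j + 2) =
        (((π j : ℕ) : ℚ) - (π i : ℕ)) * z' 1 * (((s : ℕ) : ℚ) - (s' : ℕ)) := by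
      linear_combination (((s : ℕ) : ℚ) - (s' : ℕ)) * e3 - (((s : ℕ) : ℚ) - (τ i : ℕ)) * (e3 - e4)
    -- Two coincidences form a linear system for the two differences. Its determinant cannot vanish:
    -- the eliminated equation has nonzero right side, because the two edges are attached to the
    -- covered edge in different points.
    have hne : (((s : ℕ) : ℚ) - (τ i : ℕ)) * (((t : ℕ) : ℚ) - (t' : ℕ)) -
        (((t : ℕ) : ℚ) - (τ j : ℕ)) * (((s : ℕ) : ℚ) - (s' : ℕ)) ≠ 0 := by
      intro hz
      rw [hz, zero_mul] at k1
      exact mul_ne_zero hc hsne k1.symm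
    have : (z (j + 2) : ℚ) = z' (j + 2) := mul_left_cancel₀ hne (k1.trans k2.symm)
    exact_mod_cast this

/-- The edges of a cover which are neither tight nor meet an earlier edge. -/
def IsFreeEdge {q Q : ℕ} (W : Set (Fin q × Fin Q × Fin q × Fin Q)) (j : Fin q) : Prop :=
  ¬ Tight W j ∧ ∀ i < j, ∀ s t, (i, s, j, t) ∉ W

/-- Recover the differences in increasing order of the edges: a tight edge from the covered edge
alone, any other non-free edge from an earlier edge that it meets. -/
lemma Realizes.eq_of_isFreeEdge {q Q : ℕ} {π : Fin q → Fin q} {τ : Fin q → Fin Q}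
    {W : Set (Fin q × Fin Q × Fin q × Fin Q)} {z z' : ℕ → ℕ} (h : Realizes π τ W z)
    (h' : Realizes π τ W z') (h0 : z 0 = z' 0) (h1 : z 1 = z' 1)
    (hfree : ∀ j : Fin q, IsFreeEdge W j → z (j + 2) = z' (j + 2)) (j : Fin q) :
    z (j + 2) = z' (j + 2) := by
  induction j using WellFoundedLT.induction with
  | _ j ih =>
    by_cases hT : Tight W j
    · exact h.eq_of_tight h' h0 h1 hT
    · by_cases hW : ∀ i < j, ∀ s t, (i, s, j, t) ∉ W
      · exact hfree j ⟨hT, hW⟩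
      · push Not at hW
        obtain ⟨i, hi, s, t, hW⟩ := hW
        exact h.eq_of_step h' h0 h1 hW (ih i hi)

/-- The size of the configuration is bounded, so `rare_of_code` is used with the single length 1.
The code consists of the first term and difference of the covered edge and the differences of the
free edges. -/
theorem rare_realizes (q Q : ℕ) (hq : 3 ≤ q) (hqQ : q < Q) :
    Rare q Q fun n => {S | ∃ (π : Fin q → Fin q) (τ : Fin q → Fin Q)
      (W : Set (Fin q × Fin Q × Fin q × Fin Q)) (z : ℕ → ℕ), Realizes π τ W z ∧
      (∀ i < q + 2, z i ≤ n) ∧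
      ∃ V : Finset ℕ, (V : Set ℕ) = {x : ℕ | ∃ j s, (x : ℚ) = coverPoint π τ j s z} ∧
        (V : Set ℕ) ⊆ S ∧
        (2 + {j | IsFreeEdge W j}.ncard) * (Q * (q - 1)) + 1 ≤ q * V.card} := by
  classical
  let Θ : Type := (Fin q → Fin q) × (Fin q → Fin Q) × Set (Fin q × Fin Q × Fin q × Fin Q)
  let D : ℕ → Θ → Finset ℕ := fun L θ => (Finset.range (q * L + 2)).filter
    (fun k => k < 2 ∨ ∃ j : Fin q, IsFreeEdge θ.2.2 j ∧ k = j + 2)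
  let R : ∀ _n _L, Θ → Finset ℕ → (ℕ → ℕ) → Prop := fun n L θ V z => L = 1 ∧
    Realizes θ.1 θ.2.1 θ.2.2 z ∧ (∀ i < q + 2, z i ≤ n) ∧
    (V : Set ℕ) = {x : ℕ | ∃ j s, (x : ℚ) = coverPoint θ.1 θ.2.1 j s z} ∧
    (2 + {j | IsFreeEdge θ.2.2 j}.ncard) * (Q * (q - 1)) + 1 ≤ q * V.card
  refine (rare_of_code q Q hq hqQ (Θ := fun _ => Θ) (Fintype.card Θ) 1 (fun L => by simp) D
    (fun L θ => (Finset.card_filter_le _ _).trans (by simp)) R ?_ ?_ ?_ ?_).mono ?_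
  · rintro n L θ V z ⟨rfl, -, h, -⟩ i hi
    simp only [D, Finset.mem_filter, Finset.mem_range] at hi
    exact h i (by omega)
  · rintro n L θ V z ⟨rfl, -, -, -, h⟩
    refine le_trans ?_ h
    gcongr
    have hsub : D 1 θ ⊆ {0, 1} ∪ (Finset.univ.filter (IsFreeEdge θ.2.2)).image
        (fun j : Fin q => (j : ℕ) + 2) := by
      intro k hk
      simp only [D, Finset.mem_filter] at hk
      simp only [Finset.mem_union, Finset.mem_insert, Finset.mem_singleton, Finset.mem_image,
        Finset.mem_filter, Finset.mem_univ, true_and]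
      rcases hk.2 with hk | ⟨j, hj, rfl⟩
      · left; omega
      · exact Or.inr ⟨j, hj, rfl⟩
    refine (Finset.card_le_card hsub).trans ((Finset.card_union_le _ _).trans ?_)
    refine add_le_add (by simp) (Finset.card_image_le.trans ?_)
    rw [Set.ncard_eq_toFinset_card', Set.toFinset_ofPred]
  · rintro n L θ V z ⟨rfl, -⟩
    simp
  · rintro n L θ V V' z z' ⟨rfl, h1, -, h3, -⟩ ⟨-, h1', -, h3', -⟩ hz
    have h0 : z 0 = z' 0 := hz 0 (by simp [D])
    have hz1 : z 1 = z' 1 := hz 1 (by simp [D])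
    have hall := h1.eq_of_isFreeEdge h1' h0 hz1 fun j hj => hz _ (by
      simp only [D, Finset.mem_filter, Finset.mem_range]
      exact ⟨by omega, Or.inr ⟨j, hj, rfl⟩⟩)
    apply Finset.coe_injective
    rw [h3, h3']
    ext x
    simp only [Set.mem_ofPred_eq, coverPoint, h0, hz1, hall]
  · rintro n S ⟨π, τ, W, z, h1, h2, V, h3, h4, h5⟩
    exact ⟨1, (π, τ, W), V, z, ⟨rfl, h1, h2, h3, h5⟩, h4⟩


lemma exists_perm_zero_one {q : ℕ} (hq : 3 ≤ q) {i j : Fin q} (hij : i ≠ j) :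
    ∃ σ : Equiv.Perm (Fin q), σ ⟨0, by omega⟩ = i ∧ σ ⟨1, by omega⟩ = j := by
  refine ⟨(Equiv.swap ⟨1, by omega⟩ (Equiv.swap ⟨0, by omega⟩ i j)).trans
    (Equiv.swap ⟨0, by omega⟩ i), ?_, ?_⟩
  · have h1 : (⟨0, by omega⟩ : Fin q) ≠ ⟨1, by omega⟩ := by simp
    have h2 : (⟨0, by omega⟩ : Fin q) ≠ Equiv.swap ⟨0, by omega⟩ i j := by
      intro h
      rw [eq_comm, Equiv.swap_apply_eq_iff, Equiv.swap_apply_left] at h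
      exact hij h.symm
    rw [Equiv.trans_apply, Equiv.swap_apply_of_ne_of_ne h1 h2, Equiv.swap_apply_left]
  · rw [Equiv.trans_apply, Equiv.swap_apply_left, Equiv.swap_apply_self]

/-- It suffices to consider the covers in which the first two edges meet. -/
lemma exists_cover_of_not_isSimpleCover {q : ℕ} (hq : 3 ≤ q) {E : Set ℕ} {C : ℕ → Set ℕ}
    (hE : E.ncard = q) (hC : IsCover E C) (hs : ¬ IsSimpleCover E C) :
    ∃ (σ : Fin q → ℕ) (a : Fin q → ℕ), (∀ j, σ j ∈ Set.Icc 1 q) ∧ Function.Injective a ∧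
      (∀ j, E ∩ C (σ j) = {a j}) ∧ (C (σ ⟨0, by omega⟩) ∩ C (σ ⟨1, by omega⟩)).Nonempty := by
  have hs' : ∃ i ∈ Set.Icc 1 q, ∃ j ∈ Set.Icc 1 q, i ≠ j ∧ (C i ∩ C j).Nonempty := by
    by_contra! hcon
    refine hs ⟨hC, fun i hi => ?_⟩
    rw [hE] at hi ⊢
    rw [Set.eq_empty_iff_forall_notMem]
    rintro x ⟨hx, hx'⟩
    obtain ⟨j, hj, hxj⟩ := Set.mem_iUnion₂.1 hx'
    have : x ∈ C i ∩ C j := ⟨hx, hxj⟩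
    rw [hcon i hi j hj.1 (fun h => hj.2 h.symm)] at this
    exact this
  obtain ⟨i, hi, j, hj, hij, hne⟩ := hs'
  obtain ⟨b, hb, hb'⟩ := hC
  rw [hE] at hb hb'
  obtain ⟨σ, h0, h1⟩ := exists_perm_zero_one hq (i := ⟨i - 1, by have := hi.1; have := hi.2; omega⟩)
    (j := ⟨j - 1, by have := hj.1; have := hj.2; omega⟩) (by
      have := hi.1; have := hj.1; simp only [ne_eq, Fin.mk.injEq]; omega)
  have hmem : ∀ j : Fin q, (σ j : ℕ) + 1 ∈ Set.Icc 1 q := fun j => ⟨by omega, by omega⟩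
  refine ⟨fun j => σ j + 1, fun j => b (σ j + 1), hmem, fun k l hkl => ?_,
    fun k => (hb' _ (hmem k)).1, ?_⟩
  · have := hb.injOn (hmem k) (hmem l) hkl
    exact σ.injective (Fin.ext (by omega))
  · simp only [h0, h1]
    rwa [Nat.sub_add_cancel hi.1, Nat.sub_add_cancel hj.1]

/-- Let `W` record all coincidences among distinct cover edges. An edge that is not tight meets
every other edge in at most one point and is disjoint from all tight edges, so `le_mul_ncard_cover`
supplies the vertices required by `rare_realizes`. -/
theorem rare_isNonSimplyCoveredEdge (q Q : ℕ) (hq : 3 ≤ q) (hqQ : q < Q) :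
    Rare q Q (occurs q Q (IsNonSimplyCoveredEdge q)) := by
  classical
  refine (rare_realizes q Q hq hqQ).mono ?_
  rintro n S ⟨B, ⟨hu, E, C, hE, hC, hs, rfl⟩, -, hsub⟩
  have hedge : ∀ e ∈ {E} ∪ C '' Set.Icc 1 q, e ⊆ S ∧ e ⊆ Set.Icc 1 n ∧ IsAP e.ncard e :=
    fun e he => mem_induce_apHypergraph (hsub he)
  have hCQ : ∀ j ∈ Set.Icc 1 q, (C j).ncard = Q := by
    intro j hj
    obtain ⟨a, -, ha⟩ := hC
    have h1 := (ha j (by rwa [hE])).2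
    rw [hE] at h1
    exact (hu _ (Or.inr ⟨j, hj, rfl⟩)).resolve_right h1
  obtain ⟨σ, a, hσ, hainj, hEC, h01⟩ := exists_cover_of_not_isSimpleCover hq hE hC hs
  have hEAP := hedge E (Or.inl rfl)
  rw [hE] at hEAP
  obtain ⟨hES, hEn, x0, d0, hd0, hE'⟩ := hEAP
  have hCAP : ∀ j, ∃ x d, 0 < d ∧ C (σ j) = progression Q x d := by
    intro j
    have := (hedge _ (Or.inr ⟨_, hσ j, rfl⟩)).2.2
    rw [hCQ _ (hσ j)] at this
    exact this
  choose x d hd hCx using hCAP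
  have haE : ∀ j, a j ∈ E ∧ a j ∈ progression Q (x j) (d j) := by
    intro j
    have : a j ∈ E ∩ C (σ j) := by rw [hEC]; rfl
    rwa [hCx] at this
  have ha : ∀ i j, a j ∈ progression Q (x i) (d i) ↔ i = j := by
    refine fun i j => ⟨fun h => ?_, by rintro rfl; exact (haE _).2⟩
    have : a j ∈ E ∩ C (σ i) := ⟨(haE j).1, by rwa [hCx]⟩
    rw [hEC] at this
    exact (hainj this).symm
  have hπ : ∀ j, ∃ k : Fin q, a j = x0 + k * d0 := by
    intro j
    have := (haE j).1
    rw [hE'] at this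
    obtain ⟨k, hk, e⟩ := this
    exact ⟨⟨k, hk⟩, e⟩
  choose π hπ using hπ
  have hτ : ∀ j, ∃ k : Fin Q, a j = x j + k * d j := by
    intro j
    obtain ⟨k, hk, e⟩ := (haE j).2
    exact ⟨⟨k, hk⟩, e⟩
  choose τ hτ using hτ
  let z : ℕ → ℕ := fun k => if k = 0 then x0 else if k = 1 then d0 else
    if h : k - 2 < q then d ⟨k - 2, h⟩ else 0
  have hz0 : z 0 = x0 := by simp [z]
  have hz1 : z 1 = d0 := by simp [z]
  have hz : ∀ j : Fin q, z (j + 2) = d j := by intro j; simp [z]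
  let W : Set (Fin q × Fin Q × Fin q × Fin Q) :=
    {w | w.1 ≠ w.2.2.1 ∧ x w.1 + w.2.1 * d w.1 = x w.2.2.1 + w.2.2.2 * d w.2.2.1}
  have hpoint : ∀ j s, coverPoint π τ j s z = ((x j + s * d j : ℕ) : ℚ) := by
    intro j s
    unfold coverPoint
    rw [hz0, hz1, hz]
    have e1 : (a j : ℚ) = x0 + (π j : ℕ) * d0 := by exact_mod_cast hπ j
    have e2 : (a j : ℚ) = x j + (τ j : ℕ) * d j := by exact_mod_cast hτ j
    push_cast
    linear_combination e2 - e1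
  have hU : (⋃ j, progression Q (x j) (d j)).Finite :=
    Set.finite_iUnion fun j => progression_finite _ _ _
  have hCn : ∀ j, progression Q (x j) (d j) ⊆ Set.Icc 1 n := by
    intro j; rw [← hCx]; exact (hedge _ (Or.inr ⟨_, hσ j, rfl⟩)).2.1
  have hWne : ∀ i j, (progression Q (x i) (d i) ∩ progression Q (x j) (d j)).Nonempty → i ≠ j →
      ∃ s t, (i, s, j, t) ∈ W := by
    rintro i j ⟨y, ⟨s, hs, e1⟩, t, ht, e2⟩ hij
    exact ⟨⟨s, hs⟩, ⟨t, ht⟩, hij, by rw [← e1, ← e2]⟩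
  have hreal : Realizes π τ W z := by
    refine ⟨fun i j hij => hainj (by rw [hπ, hπ, hij]), by rwa [hz1], fun j => by
      rw [hz]; exact hd j, ?_⟩
    rintro i s j t ⟨hij, e⟩
    refine ⟨hij, ?_, by rw [hpoint, hpoint]; exact_mod_cast e⟩
    -- A coincidence at the attachment position of edge j would place `a j` on another cover edge.
    rintro rfl
    refine hij ((ha i j).1 ⟨s, s.2, ?_⟩)
    rw [hτ]; exact e.symm
  have hle : ∀ i < q + 2, z i ≤ n := by
    intro i hi
    have hE1 : ∀ k < q, x0 + k * d0 ≤ n := fun k hk => (hEn (by rw [hE']; exact ⟨k, hk, rfl⟩)).2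
    rcases i with _ | _ | i
    · rw [hz0]; have := hE1 0 (by omega); omega
    · rw [hz1]; have := hE1 1 (by omega); omega
    · have h1 := hz ⟨i, by omega⟩
      simp only at h1
      rw [h1]
      have := (hCn ⟨i, by omega⟩ ⟨1, by omega, rfl⟩).2
      omega
  refine ⟨π, τ, W, z, hreal, hle, hU.toFinset, ?_, ?_, ?_⟩
  · rw [Set.Finite.coe_toFinset]
    ext y
    simp only [Set.mem_iUnion, Set.mem_ofPred_eq, hpoint, Nat.cast_inj]
    refine exists_congr fun j => ⟨?_, ?_⟩
    · rintro ⟨s, hs, e⟩; exact ⟨⟨s, hs⟩, e⟩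
    · rintro ⟨s, e⟩; exact ⟨s, s.2, e⟩
  · rw [Set.Finite.coe_toFinset]
    refine Set.iUnion_subset fun j => ?_
    rw [← hCx]; exact (hedge _ (Or.inr ⟨_, hσ j, rfl⟩)).1
  · rw [← Set.ncard_eq_toFinset_card _ hU]
    rw [hCx, hCx] at h01
    let T : Finset (Fin q) := Finset.univ.filter (Tight W)
    have hTmem : ∀ j, j ∈ T ↔ Tight W j := by intro j; simp [T]
    have hsymm : ∀ {i s j t}, (i, s, j, t) ∈ W → (j, t, i, s) ∈ W :=
      fun h => ⟨h.1.symm, h.2.symm⟩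
    have hinj : ∀ {i s j t s' t'}, (i, s, j, t) ∈ W → (i, s', j, t') ∈ W → s ≠ s' → t ≠ t' := by
      rintro i s j t s' t' ⟨-, e1⟩ ⟨-, e2⟩ hne rfl
      apply hne
      simp only at e1 e2
      have e3 : (s : ℕ) * d i = s' * d i := by omega
      exact Fin.ext (Nat.eq_of_mul_eq_mul_right (hd i) e3)
    have hstep : ∀ j ∉ T, ∀ i ∈ T, progression Q (x i) (d i) ∩ progression Q (x j) (d j) = ∅ := by
      intro j hj i hi
      rw [← Set.not_nonempty_iff_eq_empty]
      intro hne
      obtain ⟨s, t, hW⟩ := hWne i j hne (by rintro rfl; exact hj hi)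
      exact hj ((hTmem j).2 (.step ((hTmem i).1 hi) hW))
    have hone : ∀ j ∉ T, ∀ i, i ≠ j →
        (progression Q (x i) (d i) ∩ progression Q (x j) (d j)).ncard ≤ 1 := by
      intro j hj i hij
      by_contra! h
      obtain ⟨y, ⟨⟨s, hs, e1⟩, t, ht, e2⟩, y', ⟨⟨s', hs', e1'⟩, t', ht', e2'⟩, hyy⟩ :=
        (Set.one_lt_ncard ((progression_finite _ _ _).inter_of_left _)).1 h
      refine hj ((hTmem j).2 (.pair (i := i) (s := ⟨s, hs⟩) (t := ⟨t, ht⟩) (s' := ⟨s', hs'⟩)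
        (t' := ⟨t', ht'⟩) ⟨hij, by simp only; omega⟩ ⟨hij, by simp only; omega⟩ ?_))
      intro h0
      have : s = s' := congrArg Fin.val h0
      exact hyy (by rw [e1, e1', this])
    -- Two coincidences make both of the edges involved tight, so the tight family is empty or has
    -- at least two members.
    have htwo : ∀ i ∈ T, ∃ j ∈ T, i ≠ j := by
      intro j hj
      cases (hTmem j).1 hj with
      | @pair i _ s t s' t' h1 h2 h3 =>
        exact ⟨i, (hTmem i).2 (.pair (hsymm h1) (hsymm h2) (hinj h1 h2 h3)), h1.1.symm⟩
      | @step i _ s t h1 h2 => exact ⟨i, (hTmem i).2 h1, h2.1.symm⟩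
    refine le_trans ?_ (le_mul_ncard_cover hq hqQ x d a hd ha T htwo hone hstep h01)
    gcongr
    rw [Set.ncard_eq_toFinset_card', Set.toFinset_ofPred]
    refine Finset.card_le_card fun j hj => ?_
    rw [Finset.mem_filter] at hj ⊢
    refine ⟨hj.1, fun h => hj.2.1 ((hTmem j).1 h), fun i hi => ?_⟩
    rw [← Set.not_nonempty_iff_eq_empty]
    intro hne
    obtain ⟨s, t, hW⟩ := hWne i j hne hi.ne
    exact hj.2.2 i hi s t hW


/-! ### Combination of the four types and passage to the complement. -/

theorem rare_isTwoBlocking (q Q : ℕ) (hq : 3 ≤ q) (hqQ : q < Q) :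
    Rare q Q fun n => {S | ∃ B, IsTwoBlocking Q q B ∧
      IsSubhypergraph B (induce (apHypergraph n Q q) S)} := by
  refine ((rare_isNonSimplyCoveredEdge q Q hq hqQ).union ((rare_isSpoiledPath q Q hq hqQ).union
    ((rare_isPathWithSaw q Q hq hqQ).union (rare_isPathWithSpoiledExtension q Q hq hqQ)))).mono ?_
  rintro n S ⟨B, ⟨hu, h | h | h | h⟩, hsub⟩
  · exact Or.inl ⟨B, ⟨hu, h⟩, hsub⟩
  · exact Or.inr (Or.inl ⟨B, ⟨hu, h⟩, hsub⟩)
  · exact Or.inr (Or.inr (Or.inl ⟨B, ⟨hu, h⟩, hsub⟩))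
  · exact Or.inr (Or.inr (Or.inr ⟨B, ⟨hu, h⟩, hsub⟩))

open MeasureTheory in
-- Subadditivity alone gives μ(Aᶜ) ≥ 1 - μ(A), so measurability of the events is not required.
lemma tendsto_measure_compl_of_tendsto_zero {Ω : Type*} [MeasurableSpace Ω] {μ : ℕ → Measure Ω}
    [∀ n, IsProbabilityMeasure (μ n)] {A : ℕ → Set Ω}
    (h : Tendsto (fun n => μ n (A n)) atTop (𝓝 0)) :
    Tendsto (fun n => μ n (A n)ᶜ) atTop (𝓝 1) := by
  have h1 : Tendsto (fun n => 1 - μ n (A n)) atTop (𝓝 1) := by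
    simpa using ENNReal.Tendsto.sub (tendsto_const_nhds (x := (1 : ENNReal))) h (Or.inl (by simp))
  refine tendsto_of_tendsto_of_tendsto_of_le_of_le h1 tendsto_const_nhds (fun n => ?_)
    (fun n => prob_le_one)
  rw [tsub_le_iff_right, ← measure_univ (μ := μ n), ← Set.compl_union_self (A n)]
  exact measure_union_le _ _

end AsymVdW

theorem mainTheorem7 (q₁ q₂ : ℕ) (hq₂ : 3 ≤ q₂) (hq : q₂ < q₁) :
    ∃ c₀ : ℝ, 0 < c₀ ∧ ∀ c : ℝ, 0 < c → c ≤ c₀ → ∀ p : ℕ → unitInterval,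
      (∀ᶠ n : ℕ in atTop,
        (p n : ℝ) = c * (n : ℝ) ^ (-((q₂ : ℝ) / ((q₁ : ℝ) * ((q₂ : ℝ) - 1))))) →
      Tendsto
        (fun n : ℕ => setBernoulli (Set.Icc 1 n) (p n)
          {S : Set ℕ | ¬ ∃ B : Hypergraph ℕ, AsymVdW.IsTwoBlocking q₁ q₂ B ∧
            AsymVdW.IsSubhypergraph B
              (AsymVdW.induce (AsymVdW.apHypergraph n q₁ q₂) S)})
        atTop (𝓝 1) := by
  obtain ⟨c₀, hc₀, h⟩ := AsymVdW.rare_isTwoBlocking q₂ q₁ hq₂ hq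
  exact ⟨c₀, hc₀, fun c hc hcc p hp =>
    AsymVdW.tendsto_measure_compl_of_tendsto_zero (h c hc hcc p hp)⟩
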